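/- Let $\mathfrak h=\mathrm L^2(\mathbb R^3\times\{1,2\})$ and let $\mathcal F=\mathbb C\oplus\bigoplus_{n\ge1}\otimes_s^n\mathfrak h$ be the symmetric Fock space over $\mathfrak h$. For a self-adjoint operator $a$ on $\mathfrak h$, let $\mathrm d\Gamma(a)$ denote its second quantization, which acts on the $n$-particle component as the closure of $\sum_{j=1}^n 1\otimes\cdots\otimes a\otimes\cdots\otimes1$ ($a$ in the $j$-th place). Put $$X:=\mathrm d\Gamma(|\mathrm i\nabla_k|),\qquad |\mathrm i\nabla_k|=\sqrt{-\Delta_k},\qquad \langle X\rangle:=(1+X^2)^{1/2}.$$ Let $\eta\in\mathrm C_0^\infty(\mathbb R^3;[0,1])$ satisfy $\eta(k)=1$ for $|k|\le 1/2$ and $\eta(k)=0$ for $|k|\ge1$. For $\sigma>0$ put $\eta_\sigma(k):=\eta(k/\sigma)$ and $$B^\sigma:=\mathrm d\Gamma(b^\sigma),\qquad b^\sigma:=\frac{\mathrm i}{2}\,\eta_\sigma(k)\,(k\cdot\nabla_k+\nabla_k\cdot k)\,\eta_\sigma(k),$$ where $b^\sigma$ is the closure of this differential expression on $\mathrm C_0^\infty(\mathbb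 R^3\times\{1,2\})$. **Lemma.** Let $e_{\mathrm{gap}}>0$. There is a constant $C>0$, depending only on $\eta$ and $e_{\mathrm{gap}}$, such that for all $0<\sigma\le e_{\mathrm{gap}}/2$ one has $D(X^2)\subset D((B^\sigma)^2)$ and $$\big\|(B^\sigma)^2\langle X\rangle^{-2}\Phi\big\|\le C\,\sigma\,\|\Phi\|\qquad\text{for all }\Phi\in\mathcal F .$$ In the application $e_{\mathrm{gap}}=e_2-e_1$, where $e_1=\inf\operatorname{Spec}(-\Delta+V)$ is assumed to be a simple isolated eigenvalue of the electron Hamiltonian and $e_2=\inf(\operatorname{Spec}(-\Delta+V)\setminus\{e_1\})$; the lemma holds for every positive number $e_{\mathrm{gap}}$. -/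

import Mathlib

open MeasureTheory
open scoped FourierTransform ContDiff

noncomputable section

namespace FockSpace

/-! ### Unbounded operators

A (not necessarily everywhere defined) linear operator on `H` is represented by its graph, a
subspace of `H × H`, where `(x, y)` in the graph means "`x` is in the domain and is mapped to `y`"
(this is the same convention as `LinearPMap.graph`).  The closure of an operator is the operator
whose graph is the closure of the graph. -/

section Operators

variable {H : Type*} [NormedAddCommGroup H] [NormedSpace ℂ H]

/-- The domain `D(T)` of an operator. -/
def dom (T : Submodule ℂ (H × H)) : Submodule ℂ H := T.map (LinearMap.fst ℂ H H)

/-- The composition `S T`, on its natural domain `{x ∈ D(T) | T x ∈ D(S)}`. -/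
def comp (S T : Submodule ℂ (H × H)) : Submodule ℂ (H × H) where
  carrier := {p | ∃ y, (p.1, y) ∈ T ∧ (y, p.2) ∈ S}
  zero_mem' := ⟨0, T.zero_mem, S.zero_mem⟩
  add_mem' := by
    rintro a b ⟨y, h1, h2⟩ ⟨z, h3, h4⟩
    exact ⟨y + z, T.add_mem h1 h3, S.add_mem h2 h4⟩
  smul_mem' := by
    rintro c a ⟨y, h1, h2⟩
    exact ⟨c • y, T.smul_mem c h1, S.smul_mem c h2⟩

/-- The square `T²` of an operator, with `D(T²) = {x ∈ D(T) | T x ∈ D(T)}`. -/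
def sq (T : Submodule ℂ (H × H)) : Submodule ℂ (H × H) := comp T T

/-- The operator `⟨T⟩⁻² = (1 + T²)⁻¹`, where `⟨T⟩ = (1 + T²)^{1/2}`: the vector `x` is mapped
to `y` iff `y ∈ D(T²)` and `y + T² y = x`. -/
def bracketInvSq (T : Submodule ℂ (H × H)) : Submodule ℂ (H × H) where
  carrier := {p | (p.2, p.1 - p.2) ∈ sq T}
  zero_mem' := by simp [Prod.mk_zero_zero]
  add_mem' := by
    intro a b ha hb
    have h := (sq T).add_mem ha hb
    simp only [Prod.mk_add_mk] at h
    simpa only [Set.mem_ofPred_eq, Prod.fst_add, Prod.snd_add, add_sub_add_comm] using h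
  smul_mem' := by
    intro c a ha
    have h := (sq T).smul_mem c ha
    simp only [Prod.smul_mk, smul_sub] at h
    exact h

end Operators

/-! ### The one-photon space `L²(ℝ³ × {1,2})` -/

/-- Momentum space `ℝ³`. -/
abbrev R3 : Type := EuclideanSpace ℝ (Fin 3)

/-- `ℝ³ × {1,2}`: momentum and polarization of a photon. -/
abbrev Mode : Type := R3 × Fin 2

/-- Lebesgue measure times counting measure on `ℝ³ × {1,2}`. -/
abbrev modeMeasure : Measure Mode := (volume : Measure R3).prod Measure.count

/-- The one-photon space `L²(ℝ³ × {1,2})`. -/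
abbrev OnePhoton : Type := Lp ℂ 2 modeMeasure

theorem modeMeasure_map_le (l : Fin 2) :
    (volume : Measure R3).map (fun k => (k, l)) ≤ modeMeasure := by
  rw [← Measure.prod_dirac]
  refine Measure.le_iff.2 fun s hs => ?_
  rw [Measure.prod_apply hs, Measure.prod_apply hs]
  refine lintegral_mono fun x => ?_
  have hle : Measure.dirac l ≤ (Measure.count : Measure (Fin 2)) := by
    refine Measure.le_iff.2 fun t ht => ?_
    rw [Measure.count]
    exact Measure.le_sum Measure.dirac l t
  exact hle _

theorem measurable_inc (l : Fin 2) : Measurable (fun k : R3 => ((k, l) : Mode)) := by fun_prop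

theorem ae_inc {p : Mode → Prop} (h : ∀ᵐ m ∂modeMeasure, p m) (l : Fin 2) :
    ∀ᵐ k : R3, p (k, l) :=
  ae_of_ae_map (measurable_inc l).aemeasurable (ae_mono (modeMeasure_map_le l) h)

theorem memLp_slice (l : Fin 2) (f : OnePhoton) :
    MemLp (fun k : R3 => f (k, l)) 2 volume :=
  ((Lp.memLp f).mono_measure (modeMeasure_map_le l)).comp_of_map (measurable_inc l).aemeasurable

/-- The component `k ↦ f(k, l)` of a one-photon state of polarization `l`. -/
def slice (l : Fin 2) : OnePhoton →ₗ[ℂ] Lp ℂ 2 (volume : Measure R3) where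
  toFun f := (memLp_slice l f).toLp
  map_add' f g := by
    rw [← MemLp.toLp_add]
    exact MemLp.toLp_congr _ _ (ae_inc (Lp.coeFn_add f g) l)
  map_smul' c f := by
    rw [RingHom.id_apply, ← MemLp.toLp_const_smul]
    exact MemLp.toLp_congr _ _ (ae_inc (Lp.coeFn_smul c f) l)

/-- The operator `|i∇_k| = √(-Δ_k)` on `L²(ℝ³ × {1,2})`, as a Fourier multiplier on its maximal
domain.  With the normalization `𝓕 f (ξ) = ∫ e^{-2πi⟨k, ξ⟩} f(k) dk` of the Fourier transform, it
is the multiplication by `2π|ξ|` in the Fourier representation. -/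
def absIGrad : Submodule ℂ (OnePhoton × OnePhoton) where
  carrier := {p | ∀ l : Fin 2, (𝓕 (slice l p.2) : Lp ℂ 2 (volume : Measure R3)) =ᵐ[volume]
    fun ξ => ((2 * Real.pi * ‖ξ‖ : ℝ) : ℂ) * (𝓕 (slice l p.1) : Lp ℂ 2 (volume : Measure R3)) ξ}
  zero_mem' := by
    intro l
    simp only [Prod.fst_zero, Prod.snd_zero, map_zero, FourierTransform.fourier_zero]
    filter_upwards [Lp.coeFn_zero ℂ 2 (volume : Measure R3)] with ξ h
    rw [h, Pi.zero_apply, mul_zero]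
  add_mem' := by
    intro a b ha hb l
    simp only [Prod.fst_add, Prod.snd_add, map_add, FourierTransform.fourier_add]
    filter_upwards [ha l, hb l, Lp.coeFn_add (𝓕 (slice l a.1)) (𝓕 (slice l b.1)),
      Lp.coeFn_add (𝓕 (slice l a.2)) (𝓕 (slice l b.2))] with ξ h1 h2 h3 h4
    rw [h3, h4, Pi.add_apply, Pi.add_apply, h1, h2, mul_add]
  smul_mem' := by
    intro c a ha l
    simp only [Prod.smul_fst, Prod.smul_snd, map_smul, FourierTransform.fourier_smul]
    filter_upwards [ha l, Lp.coeFn_smul c (𝓕 (slice l a.1)),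
      Lp.coeFn_smul c (𝓕 (slice l a.2))] with ξ h1 h2 h3
    rw [h2, h3, Pi.smul_apply, Pi.smul_apply, h1, smul_eq_mul, smul_eq_mul]
    ring

/-- The partial derivative `∂ψ/∂k_j`. -/
def partialDeriv (j : Fin 3) (ψ : R3 → ℂ) (k : R3) : ℂ :=
  fderiv ℝ ψ k (EuclideanSpace.single j 1)

/-- `η_σ(k) = η(k/σ)`. -/
def scaled (η : R3 → ℝ) (σ : ℝ) (k : R3) : ℝ := η (σ⁻¹ • k)

/-- The differential expression `(i/2) η_σ (k·∇_k + ∇_k·k) η_σ` applied to a function `φ` on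
`ℝ³`, where `(k·∇_k ψ)(k) = ∑_j k_j ∂_jψ(k)` and `(∇_k·k ψ)(k) = ∑_j ∂_j(k_j ψ)(k)`. -/
def dilationExpr (η : R3 → ℝ) (σ : ℝ) (φ : R3 → ℂ) (k : R3) : ℂ :=
  (Complex.I / 2) * (scaled η σ k : ℂ) *
    ((∑ j, (k j : ℂ) * partialDeriv j (fun q => (scaled η σ q : ℂ) * φ q) k) +
      ∑ j, partialDeriv j (fun q => (q j : ℂ) * ((scaled η σ q : ℂ) * φ q)) k)

/-- The one-photon operator `b^σ = (i/2) η_σ (k·∇_k + ∇_k·k) η_σ` on `L²(ℝ³ × {1,2})`: the closure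
of the differential expression defined on `C₀^∞(ℝ³ × {1,2})`. -/
def bOp (η : R3 → ℝ) (σ : ℝ) : Submodule ℂ (OnePhoton × OnePhoton) :=
  (Submodule.span ℂ {p : OnePhoton × OnePhoton | ∃ φ : Fin 2 → R3 → ℂ,
    (∀ l, ContDiff ℝ ∞ (φ l)) ∧ (∀ l, HasCompactSupport (φ l)) ∧
    (p.1 =ᵐ[modeMeasure] fun m => φ m.2 m.1) ∧
    (p.2 =ᵐ[modeMeasure] fun m => dilationExpr η σ (φ m.2) m.1)}).topologicalClosure

/-! ### The symmetric Fock space over `L²(ℝ³ × {1,2})` -/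

/-- The product measure on the configuration space `(ℝ³ × {1,2})ⁿ` of `n` photons. -/
abbrev configMeasure (n : ℕ) : Measure (Fin n → Mode) := Measure.pi fun _ => modeMeasure

/-- `L²((ℝ³ × {1,2})ⁿ)`, i.e. the `n`-fold Hilbert space tensor product of `L²(ℝ³ × {1,2})`
(for `n = 0` the configuration space is a point of mass one and the space is `ℂ`). -/
abbrev NPhoton (n : ℕ) : Type := Lp ℂ 2 (configMeasure n)

theorem measurePreserving_perm {n : ℕ} (π : Equiv.Perm (Fin n)) :
    MeasurePreserving (fun k : Fin n → Mode => k ∘ π) (configMeasure n) (configMeasure n) := by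
  have h := measurePreserving_arrowCongr' (fun _ : Fin n => modeMeasure)
    (fun _ : Fin n => modeMeasure) π.symm (MeasurableEquiv.refl Mode)
    (fun _ => MeasurePreserving.id _)
  exact h

/-- The symmetric `n`-fold tensor product: the functions in `L²((ℝ³ × {1,2})ⁿ)` that are invariant
under all permutations of the `n` variables. -/
def symSector (n : ℕ) : Submodule ℂ (NPhoton n) where
  carrier := {Φ | ∀ π : Equiv.Perm (Fin n),
    Lp.compMeasurePreservingₗ ℂ (fun k : Fin n → Mode => k ∘ π) (measurePreserving_perm π) Φ = Φ}
  zero_mem' π := map_zero _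
  add_mem' ha hb π := by rw [map_add, ha π, hb π]
  smul_mem' c a ha π := by rw [map_smul, ha π]

/-- The symmetric Fock space `𝓕 = ⨁ₙ ⊗ˢₙ L²(ℝ³ × {1,2})` (Hilbert space direct sum). -/
abbrev Fock : Type := lp (fun n => symSector n) 2

theorem memLp_tensor {n : ℕ} (f : Fin n → OnePhoton) :
    MemLp (fun k : Fin n → Mode => ∏ i, f i (k i)) 2 (configMeasure n) := by
  have hm : AEStronglyMeasurable (fun k : Fin n → Mode => ∏ i, f i (k i)) (configMeasure n) :=
    Finset.aestronglyMeasurable_fun_prod _ fun i _ =>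
      (Lp.aestronglyMeasurable (f i)).comp_quasiMeasurePreserving
        (Measure.quasiMeasurePreserving_eval (fun _ : Fin n => modeMeasure) i)
  rw [memLp_two_iff_integrable_sq_norm hm]
  have h : Integrable (fun k : Fin n → Mode => ∏ i, ‖f i (k i)‖ ^ 2) (configMeasure n) :=
    Integrable.fintype_prod (f := fun i m => ‖f i m‖ ^ 2)
      fun i => (memLp_two_iff_integrable_sq_norm (Lp.aestronglyMeasurable (f i))).1 (Lp.memLp (f i))
  simpa only [norm_prod, Finset.prod_pow] using h

/-- The tensor product `f₁ ⊗ ⋯ ⊗ fₙ`, i.e. the function `(k₁, …, kₙ) ↦ f₁(k₁) ⋯ fₙ(kₙ)`. -/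
def tensor {n : ℕ} (f : Fin n → OnePhoton) : NPhoton n := (memLp_tensor f).toLp

/-- The operator `∑ⱼ 1 ⊗ ⋯ ⊗ a ⊗ ⋯ ⊗ 1` (`a` at the `j`-th place) on `L²((ℝ³ × {1,2})ⁿ)`: the
closure of its restriction to the algebraic tensor product of `n` copies of `D(a)`, on which
`f₁ ⊗ ⋯ ⊗ fₙ` is mapped to `∑ⱼ f₁ ⊗ ⋯ ⊗ a fⱼ ⊗ ⋯ ⊗ fₙ`. -/
def sumOp (a : Submodule ℂ (OnePhoton × OnePhoton)) (n : ℕ) :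
    Submodule ℂ (NPhoton n × NPhoton n) :=
  (Submodule.span ℂ {p : NPhoton n × NPhoton n | ∃ f g : Fin n → OnePhoton,
    (∀ i, (f i, g i) ∈ a) ∧
    p = (tensor f, ∑ j, tensor (Function.update f j (g j)))}).topologicalClosure

/-- The second quantization `dΓ(a)`: it acts on the `n`-photon component as
`∑ⱼ 1 ⊗ ⋯ ⊗ a ⊗ ⋯ ⊗ 1`, and its domain consists of the `Φ = (Φ⁽ⁿ⁾)ₙ` with each `Φ⁽ⁿ⁾` in the
domain of that operator and with image in the Fock space. -/
def dGamma (a : Submodule ℂ (OnePhoton × OnePhoton)) : Submodule ℂ (Fock × Fock) where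
  carrier := {p | ∀ n, ((p.1 n : NPhoton n), (p.2 n : NPhoton n)) ∈ sumOp a n}
  zero_mem' n := (sumOp a n).zero_mem
  add_mem' ha hb n := (sumOp a n).add_mem (ha n) (hb n)
  smul_mem' c _ ha n := (sumOp a n).smul_mem c (ha n)

/-- `X = dΓ(|i∇_k|)`. -/
def X : Submodule ℂ (Fock × Fock) := dGamma absIGrad

/-- `B^σ = dΓ(b^σ)`. -/
def B (η : R3 → ℝ) (σ : ℝ) : Submodule ℂ (Fock × Fock) := dGamma (bOp η σ)

end FockSpace

end

noncomputable section

namespace FockSpace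

open Filter Topology

/-! ### Symmetrizable operators -/

/-! Write `w` for `|i∇|` and `b` for `b^σ`. Two one-photon bounds drive the proof: `‖b f‖ ≤ C₁ ‖w
f‖` with `C₁ = O(σ)`, and `‖[w, b] f‖ ≤ C₂ ‖w f‖` with `C₂` independent of `σ`. If both lift to
second quantizations, then `X B = B X + dΓ([w, b])` gives `‖B² F‖ ≤ C₁ ‖X B F‖ ≤ C₁ (C₁ ‖X² F‖ + C₂
‖X F‖)`. Since `‖(1 + X²) F‖² = ‖F‖² + 2 ‖X F‖² + ‖X² F‖²`, the right side is at most `C₁ (C₁ + C₂)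
‖(1 + X²) F‖`, which is `O(σ)` for bounded `σ`.

One-photon bounds. Expanding the differential expression gives `b = i (v·∇ + div v / 2)` with `v(k)
= η_σ(k)² k = σ α(k/σ)`. The first order term carries the factor `σ`, and the multiplication term
gains one from a Hardy inequality (`re_inner_weight_le`), because its support lies in `|k| ≤ σ`. In
the Fourier representation the commutator of `w` with multiplication by `a` has kernel `2π (|p| - |p
- q|) 𝓕a(q)`, so the first moment of `𝓕a` controls it (`norm_comm_absGrad_mulS_le`). For `a =
α(·/σ)` this moment is of order `1/σ` and cancels the prefactor `σ`.

Lifting. A norm bound alone does not pass from `a` to `dΓ(a)`: the square of `∑ⱼ aⱼ` also has cross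
terms `aⱼ aₖ`. For symmetric `a` these are handled by the form bound `|⟨f, a f⟩| ≤ ⟨f, w f⟩` and the
identity `w ⊗ w - a ⊗ a = ½ ((w - a) ⊗ (w + a) + (w + a) ⊗ (w - a))`. Positivity of the Gram
matrices that result is the Schur product theorem (`norm_sum_smul_sumTensor_le`). The form bound
follows from the norm bound by Reid's inequality applied to `a (w + l)⁻¹` as `l → 0`
(`norm_inner_le_of_norm_le`). It is used for `b` and for `i [w, b]`.

Domains. The estimates are first proved for finite sums of elementary tensors. Two cores are used:
`b` and `w` act on Schwartz functions, but `w` can be iterated only on functions whose Fourier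
transform is smooth and supported in an annulus, a space that `b` need not preserve. The estimates
pass to the closure of the joint graph of `X, X², B, B²`, on which `1 + X²` is onto
(`CommutatorData.exists_of_mem`). Since `1 + X²` is injective, every vector of `D(X²)` is reached,
and solutions with symmetric data are symmetric. -/

theorem le_of_pow_two_pow_le {x y K : ℝ} (hy : 0 ≤ y)
    (h : ∀ n : ℕ, x ^ 2 ^ n ≤ K * y ^ 2 ^ n) : x ≤ y := by
  by_contra! hlt
  rcases hy.eq_or_lt with rfl | hy0
  · have := h 0
    simp at this
    linarith
  · have h1 : 1 < x / y := (one_lt_div hy0).2 hlt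
    obtain ⟨n, hn⟩ := pow_unbounded_of_one_lt K h1
    have h2 : (x / y) ^ n ≤ (x / y) ^ 2 ^ n :=
      pow_le_pow_right₀ h1.le n.lt_two_pow_self.le
    have h3 : (x / y) ^ 2 ^ n ≤ K := by
      rw [div_pow, div_le_iff₀ (by positivity)]
      exact h n
    linarith

section Reid

variable {H : Type*} [NormedAddCommGroup H] [InnerProductSpace ℂ H]

local notation "⟪" x ", " y "⟫" => inner ℂ x y

/-- Cauchy-Schwarz for the form of a symmetric nonnegative operator. -/
theorem norm_inner_sq_le_of_nonneg (R : H →L[ℂ] H) (hsymm : ∀ x y, ⟪R x, y⟫ = ⟪x, R y⟫)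
    (hpos : ∀ x, 0 ≤ (⟪R x, x⟫).re) (u v : H) :
    ‖⟪R u, v⟫‖ ^ 2 ≤ (⟪R u, u⟫).re * (⟪R v, v⟫).re := by
  -- A degenerate inner product suffices, since `R` may have a kernel.
  let core : PreInnerProductSpace.Core ℂ H :=
    { inner := fun x y => ⟪R x, y⟫
      conj_inner_symm := fun x y => by
        rw [hsymm y x, inner_conj_symm]
      re_inner_nonneg := fun x => hpos x
      add_left := fun x y z => by simp
      smul_left := fun x y r => by simp [mul_comm] }
  have h := @InnerProductSpace.Core.inner_mul_inner_self_le ℂ H _ _ _ core u v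
  have e2 : ‖⟪R v, u⟫‖ = ‖⟪R u, v⟫‖ := by rw [hsymm v u, norm_inner_symm]
  have h' : ‖⟪R u, v⟫‖ * ‖⟪R v, u⟫‖ ≤ (⟪R u, u⟫).re * (⟪R v, v⟫).re := h
  rw [e2] at h'
  rw [pow_two]
  exact h'

/-- Reid's inequality. -/
theorem norm_inner_le_of_symmetrizable (R M : H →L[ℂ] H) (C : ℝ) (hC : 0 ≤ C)
    (hM : ∀ x, ‖M x‖ ≤ C * ‖x‖)
    (hsymm : ∀ x y, ⟪R x, y⟫ = ⟪x, R y⟫) (hpos : ∀ x, 0 ≤ (⟪R x, x⟫).re)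
    (hRM : ∀ x y, ⟪R (M x), y⟫ = ⟪R x, M y⟫) (u : H) :
    ‖⟪R (M u), u⟫‖ ≤ C * (⟪R u, u⟫).re := by
  set q := (⟪R u, u⟫).re with hq
  have hpow : ∀ p x, ‖(M ^ p) x‖ ≤ C ^ p * ‖x‖ := by
    intro p
    induction p with
    | zero => intro x; simp
    | succ p ih =>
      intro x
      rw [pow_succ', mul_apply_eq_comp, pow_succ' C, mul_assoc]
      exact (hM _).trans (mul_le_mul_of_nonneg_left (ih x) hC)
  have hRMp : ∀ p x y, ⟪R ((M ^ p) x), y⟫ = ⟪R x, (M ^ p) y⟫ := by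
    intro p
    induction p with
    | zero => intro x y; simp
    | succ p ih =>
      intro x y
      rw [pow_succ', mul_apply_eq_comp, hRM, ih, ← mul_apply_eq_comp,
        ← pow_succ, pow_succ']
  -- Cauchy-Schwarz for the form of `R` between `u` and `M ^ p u`. Moving one `M ^ p` across the
  -- form by `hRMp` doubles the power, so that iteration reaches the powers `2 ^ n`.
  have hstep : ∀ p, ‖⟪R ((M ^ p) u), u⟫‖ ^ 2 ≤ q * ‖⟪R ((M ^ (2 * p)) u), u⟫‖ := by
    intro p
    have h1 := norm_inner_sq_le_of_nonneg R hsymm hpos u ((M ^ p) u)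
    rw [← hRMp] at h1
    refine h1.trans (mul_le_mul_of_nonneg_left ?_ (hpos u))
    rw [← hRMp, two_mul, pow_add, mul_apply_eq_comp]
    exact Complex.re_le_norm _
  have hq0 : 0 ≤ q := hpos u
  rcases hq0.eq_or_lt with h0 | h0
  · have := hstep 1
    rw [← h0, zero_mul, pow_one] at this
    rw [← h0, mul_zero]
    nlinarith [norm_nonneg ⟪R (M u), u⟫]
  · have hit : ∀ n : ℕ, (‖⟪R (M u), u⟫‖ / q) ^ 2 ^ n ≤ ‖⟪R ((M ^ 2 ^ n) u), u⟫‖ / q := by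
      intro n
      induction n with
      | zero => simp
      | succ n ih =>
        have h1 := hstep (2 ^ n)
        rw [pow_succ, pow_mul]
        refine (pow_le_pow_left₀ (by positivity) ih 2).trans ?_
        rw [div_pow, pow_two q, ← div_div]
        gcongr
        rw [div_le_iff₀ h0, mul_comm (2 ^ n) 2, mul_comm]
        exact h1
    have : ‖⟪R (M u), u⟫‖ / q ≤ C := by
      -- Only the crude operator bound on `M ^ 2 ^ n` enters. The prefactor does not depend on `n`
      -- and disappears on taking roots of order `2 ^ n`.
      refine le_of_pow_two_pow_le (K := ‖R‖ * ‖u‖ * ‖u‖ / q) hC fun n => ?_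
      refine (hit n).trans ?_
      rw [div_mul_eq_mul_div]
      gcongr
      calc ‖⟪R ((M ^ 2 ^ n) u), u⟫‖ ≤ ‖R ((M ^ 2 ^ n) u)‖ * ‖u‖ := norm_inner_le_norm _ _
        _ ≤ (‖R‖ * (C ^ 2 ^ n * ‖u‖)) * ‖u‖ := by
            gcongr
            exact (R.le_opNorm _).trans (mul_le_mul_of_nonneg_left (hpow _ _) (norm_nonneg _))
        _ = _ := by ring
    rwa [div_le_iff₀ h0] at this

end Reid

/-! ### Form bounds from norm bounds -/

section FormBound

variable {H : Type*} [NormedAddCommGroup H] [InnerProductSpace ℂ H] [CompleteSpace H]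
variable {D : Type*} [AddCommGroup D] [Module ℂ D]

local notation "⟪" x ", " y "⟫" => inner ℂ x y

/-- Let `w ≥ 0` be an operator on a dense subspace such that `w + l` is onto this subspace for all
`l > 0`.  If `a` is symmetric and `‖a x‖ ≤ C ‖w x‖`, then `|⟨x, a x⟩| ≤ C ⟨x, w x⟩`. -/
theorem norm_inner_le_of_norm_le (e : D →ₗ[ℂ] H) (he : DenseRange e)
    (w : D →ₗ[ℂ] D) (a : D →ₗ[ℂ] H) (C : ℝ) (hC : 0 ≤ C)
    (hw : ∀ x y, ⟪e (w x), e y⟫ = ⟪e x, e (w y)⟫) (hpos : ∀ x, 0 ≤ (⟪e x, e (w x)⟫).re)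
    (hsurj : ∀ l : ℝ, 0 < l → ∀ y, ∃ x, w x + (l : ℂ) • x = y)
    (ha : ∀ x y, ⟪a x, e y⟫ = ⟪e x, a y⟫) (hbound : ∀ x, ‖a x‖ ≤ C * ‖e (w x)‖) (x : D) :
    ‖⟪e x, a x⟫‖ ≤ C * (⟪e x, e (w x)⟫).re := by
  have key : ∀ l : ℝ, 0 < l → ‖⟪e x, a x⟫‖ ≤ C * ((⟪e x, e (w x)⟫).re + l * ‖e x‖ ^ 2) := by
    intro l hl
    -- The shift by `l > 0` makes `w + l` bounded below, so that its inverse extends to a bounded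
    -- operator. The limit `l → 0` is taken at the end.
    set g : D →ₗ[ℂ] H := e ∘ₗ (w + (l : ℂ) • LinearMap.id) with hg
    have hgx : ∀ x, g x = e (w x) + (l : ℂ) • e x := fun x => by simp [hg]
    have hgd : DenseRange g := by
      have : Set.range g = Set.range e := by
        ext y
        constructor
        · rintro ⟨x, rfl⟩; exact ⟨_, rfl⟩
        · rintro ⟨x, rfl⟩
          obtain ⟨x', hx'⟩ := hsurj l hl x
          exact ⟨x', by rw [← hx', hgx]; simp⟩
      rw [DenseRange, this]; exact he
    have hexp : ∀ x, ‖g x‖ ^ 2 = ‖e (w x)‖ ^ 2 + 2 * l * (⟪e x, e (w x)⟫).re + l ^ 2 * ‖e x‖ ^ 2 := by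
      intro x
      rw [hgx, @norm_add_sq ℂ, inner_smul_right, norm_smul, hw]
      simp [mul_pow, abs_of_pos hl]
      ring
    have h1 : ∀ x, ‖e (w x)‖ ≤ ‖g x‖ := fun x => by
      refine le_of_sq_le_sq ?_ (norm_nonneg _)
      rw [hexp]
      have := hpos x
      nlinarith [mul_nonneg hl.le this, sq_nonneg (l * ‖e x‖)]
    have h2 : ∀ x, ‖e x‖ ≤ l⁻¹ * ‖g x‖ := fun x => by
      rw [inv_mul_eq_div, le_div_iff₀ hl]
      refine le_of_sq_le_sq ?_ (norm_nonneg _)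
      rw [hexp]
      have := hpos x
      nlinarith [mul_nonneg hl.le this, sq_nonneg (‖e (w x)‖)]
    have h3 : ∀ x, ‖a x‖ ≤ C * ‖g x‖ := fun x =>
      (hbound x).trans (mul_le_mul_of_nonneg_left (h1 x) hC)
    -- `R = (w + l)⁻¹` and `M = a (w + l)⁻¹`. Then `R M = (w + l)⁻¹ a (w + l)⁻¹` is symmetric
    -- although `M` need not be, which is the setting of Reid's inequality. At the vector `(w + l)
    -- x` it compares `⟨a x, x⟩` with `⟨x, (w + l) x⟩`.
    set R : H →L[ℂ] H := e.extendOfNorm g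
    set M : H →L[ℂ] H := a.extendOfNorm g
    have hR : ∀ x, R (g x) = e x := LinearMap.extendOfNorm_eq hgd ⟨_, h2⟩
    have hM : ∀ x, M (g x) = a x := LinearMap.extendOfNorm_eq hgd ⟨_, h3⟩
    have hRs : ∀ x y, ⟪R x, y⟫ = ⟪x, R y⟫ := by
      intro x y
      refine hgd.induction_on₂ (p := fun x y => ⟪R x, y⟫ = ⟪x, R y⟫)
        (isClosed_eq (by fun_prop) (by fun_prop)) (fun x y => ?_) x y
      rw [hR, hR, hgx, hgx, inner_add_right, inner_add_left, hw, inner_smul_left, inner_smul_right]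
      simp
    have hRp : ∀ x, 0 ≤ (⟪R x, x⟫).re := by
      intro x
      refine hgd.induction_on (p := fun x => 0 ≤ (⟪R x, x⟫).re) x
        (isClosed_le (by fun_prop) (by fun_prop)) (fun x => ?_)
      rw [hR, hgx, inner_add_right, inner_smul_right, inner_self_eq_norm_sq_to_K]
      have := hpos x
      simp [← Complex.ofReal_pow]
      positivity
    have hRM : ∀ x y, ⟪R (M x), y⟫ = ⟪R x, M y⟫ := by
      intro x y
      rw [hRs]
      refine hgd.induction_on₂ (p := fun x y => ⟪M x, R y⟫ = ⟪R x, M y⟫)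
        (isClosed_eq (by fun_prop) (by fun_prop)) (fun x y => ?_) x y
      rw [hR, hR, hM, hM, ha]
    have h := norm_inner_le_of_symmetrizable R M C hC
      (LinearMap.norm_extendOfNorm_apply_le hgd C h3) hRs hRp hRM (g x)
    rw [hRs, hM, hR, norm_inner_symm, hgx, inner_add_right, inner_smul_right,
      inner_self_eq_norm_sq_to_K] at h
    simpa [← Complex.ofReal_pow] using h
  refine le_of_forall_pos_le_add fun ε hε => ?_
  -- With this `l` the error term `C l ‖e x‖²` is at most `ε`.
  have h := key (ε / (C * ‖e x‖ ^ 2 + 1)) (by positivity)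
  refine h.trans ?_
  rw [mul_add]
  gcongr
  rw [← mul_assoc, mul_comm C, mul_assoc, div_mul_eq_mul_div, div_le_iff₀ (by positivity)]
  nlinarith [sq_nonneg ‖e x‖]

end FormBound

end FockSpace

end

noncomputable section

namespace FockSpace

open Filter Topology Matrix
open scoped ComplexOrder

/-! ### Tensors -/

local notation "⟪" x ", " y "⟫" => inner ℂ x y

theorem coeFn_tensor {n : ℕ} (f : Fin n → OnePhoton) :
    tensor f =ᵐ[configMeasure n] fun k => ∏ i, f i (k i) := MemLp.coeFn_toLp _

theorem inner_tensor {n : ℕ} (f g : Fin n → OnePhoton) :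
    ⟪tensor f, tensor g⟫ = ∏ i, ⟪f i, g i⟫ := by
  simp_rw [L2.inner_def]
  rw [← integral_fintype_prod_eq_prod]
  refine integral_congr_ae ?_
  filter_upwards [coeFn_tensor f, coeFn_tensor g] with k hf hg
  rw [hf, hg]
  simp [Finset.prod_mul_distrib]

theorem norm_tensor {n : ℕ} (f : Fin n → OnePhoton) : ‖tensor f‖ = ∏ i, ‖f i‖ := by
  have h : ((‖tensor f‖ ^ 2 : ℝ) : ℂ) = (((∏ i, ‖f i‖) ^ 2 : ℝ) : ℂ) := by
    have := inner_tensor f f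
    simp_rw [inner_self_eq_norm_sq_to_K] at this
    push_cast [← Finset.prod_pow]
    exact this
  have h2 := Complex.ofReal_injective h
  exact (sq_eq_sq₀ (norm_nonneg _) (Finset.prod_nonneg fun _ _ => norm_nonneg _)).1 h2

theorem ae_eval {n : ℕ} {p : Mode → Prop} (h : ∀ᵐ m ∂modeMeasure, p m) (i : Fin n) :
    ∀ᵐ k ∂configMeasure n, p (k i) :=
  (Measure.quasiMeasurePreserving_eval (fun _ : Fin n => modeMeasure) i).ae h

theorem tensor_update_add {n : ℕ} (f : Fin n → OnePhoton) (j : Fin n) (u v : OnePhoton) :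
    tensor (Function.update f j (u + v)) =
      tensor (Function.update f j u) + tensor (Function.update f j v) := by
  refine Lp.ext ?_
  filter_upwards [coeFn_tensor (Function.update f j (u + v)), coeFn_tensor (Function.update f j u),
    coeFn_tensor (Function.update f j v), ae_eval (Lp.coeFn_add u v) j,
    Lp.coeFn_add (tensor (Function.update f j u)) (tensor (Function.update f j v))]
    with k h1 h2 h3 h4 h5
  rw [h5, Pi.add_apply, h1, h2, h3]
  simp_rw [← Finset.mul_prod_erase _ _ (Finset.mem_univ j), Function.update_self]
  rw [h4, Pi.add_apply, add_mul]
  have : ∀ w, ∏ x ∈ Finset.univ.erase j, Function.update f j w x (k x)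
      = ∏ x ∈ Finset.univ.erase j, f x (k x) := fun w =>
    Finset.prod_congr rfl fun x hx => by rw [Function.update_of_ne (Finset.ne_of_mem_erase hx)]
  simp_rw [this]

theorem tensor_update_smul {n : ℕ} (f : Fin n → OnePhoton) (j : Fin n) (c : ℂ) (u : OnePhoton) :
    tensor (Function.update f j (c • u)) = c • tensor (Function.update f j u) := by
  refine Lp.ext ?_
  filter_upwards [coeFn_tensor (Function.update f j (c • u)),
    coeFn_tensor (Function.update f j u), ae_eval (Lp.coeFn_smul c u) j,
    Lp.coeFn_smul c (tensor (Function.update f j u))]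
    with k h1 h2 h4 h5
  rw [h5, Pi.smul_apply, h1, h2]
  simp_rw [← Finset.mul_prod_erase _ _ (Finset.mem_univ j), Function.update_self]
  rw [h4, Pi.smul_apply, smul_eq_mul, smul_eq_mul, mul_assoc]
  have : ∀ w, ∏ x ∈ Finset.univ.erase j, Function.update f j w x (k x)
      = ∏ x ∈ Finset.univ.erase j, f x (k x) := fun w =>
    Finset.prod_congr rfl fun x hx => by rw [Function.update_of_ne (Finset.ne_of_mem_erase hx)]
  simp_rw [this]

/-- The tensor product as a multilinear map. -/
def tensorₘ (n : ℕ) : MultilinearMap ℂ (fun _ : Fin n => OnePhoton) (NPhoton n) where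
  toFun := tensor
  map_update_add' := by
    intro inst f j u v
    rw [Subsingleton.elim inst (instDecidableEqFin n)]
    exact tensor_update_add f j u v
  map_update_smul' := by
    intro inst f j c u
    rw [Subsingleton.elim inst (instDecidableEqFin n)]
    exact tensor_update_smul f j c u

theorem continuous_tensor (n : ℕ) : Continuous (tensor : (Fin n → OnePhoton) → NPhoton n) :=
  (tensorₘ n).mkContinuous 1 (fun f => by rw [one_mul]; exact (norm_tensor f).le) |>.cont

/-! ### Comparison of second quantized operators on algebraic tensors -/

section Compare

variable {D : Type*} [AddCommGroup D] [Module ℂ D]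

/-- `∑ⱼ e(p₁) ⊗ ⋯ ⊗ a(pⱼ) ⊗ ⋯ ⊗ e(pₙ)`. -/
def sumTensor {n : ℕ} (e a : D → OnePhoton) (p : Fin n → D) : NPhoton n :=
  ∑ j, tensor (Function.update (fun i => e (p i)) j (a (p j)))

theorem inner_sum_smul {ι E : Type*} [NormedAddCommGroup E] [InnerProductSpace ℂ E]
    (s : Finset ι) (c d : ι → ℂ) (x y : ι → E) :
    ⟪∑ α ∈ s, c α • x α, ∑ β ∈ s, d β • y β⟫ =
      ∑ α ∈ s, ∑ β ∈ s, star (c α) * ⟪x α, y β⟫ * d β := by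
  rw [sum_inner]
  refine Finset.sum_congr rfl fun α _ => ?_
  rw [inner_sum]
  refine Finset.sum_congr rfl fun β _ => ?_
  rw [inner_smul_left, inner_smul_right, Complex.star_def]
  ring

/-- The quadratic form of the matrix at `c` is the sesquilinear form evaluated at the single vector
`∑ α, c α • x α`. -/
theorem posSemidef_of_form {ι : Type*} [Fintype ι] (Φ : D →ₗ⋆[ℂ] D →ₗ[ℂ] ℂ)
    (hsymm : ∀ x y, star (Φ x y) = Φ y x) (hpos : ∀ x, 0 ≤ (Φ x x).re) (x : ι → D) :
    (Matrix.of fun α β => Φ (x α) (x β)).PosSemidef := by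
  refine .of_dotProduct_mulVec_nonneg (by ext α β; simpa using hsymm (x β) (x α)) fun c => ?_
  have h : star c ⬝ᵥ ((Matrix.of fun α β => Φ (x α) (x β)) *ᵥ c)
      = Φ (∑ α, c α • x α) (∑ α, c α • x α) := by
    simp only [dotProduct, mulVec, Pi.star_apply, Matrix.of_apply, map_sum, LinearMap.sum_apply,
      map_smulₛₗ, LinearMap.smul_apply, smul_eq_mul, RingHom.id_apply, Finset.mul_sum]
    rw [Finset.sum_comm]
    refine Finset.sum_congr rfl fun α _ => Finset.sum_congr rfl fun β _ => ?_
    rw [Complex.star_def]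
    ring
  rw [h, Complex.le_def]
  refine ⟨hpos _, ?_⟩
  have := congrArg Complex.im (hsymm (∑ α, c α • x α) (∑ α, c α • x α))
  rw [Complex.star_def, Complex.conj_im] at this
  rw [Complex.zero_im]
  linarith

theorem sum_re_nonneg_of_posSemidef {ι : Type*} [Fintype ι] {M : Matrix ι ι ℂ}
    (h : M.PosSemidef) (c : ι → ℂ) : 0 ≤ (∑ α, ∑ β, star (c α) * M α β * c β).re := by
  have h1 := (Complex.le_def.1 (h.dotProduct_mulVec_nonneg c)).1
  simpa [dotProduct, mulVec, Finset.mul_sum, mul_assoc] using h1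

/-- The Schur product theorem, iterated. The empty product is the all-ones matrix, which has rank
one and is positive. -/
theorem posSemidef_prod {ι κ : Type*} [Fintype ι] (s : Finset κ) (M : κ → Matrix ι ι ℂ)
    (h : ∀ k ∈ s, (M k).PosSemidef) : (Matrix.of fun α β => ∏ k ∈ s, M k α β).PosSemidef := by
  classical
  induction s using Finset.induction_on with
  | empty =>
    have h1 := Matrix.posSemidef_self_mul_conjTranspose (Matrix.of fun (_ : ι) (_ : Unit) => (1 : ℂ))
    have h2 : (Matrix.of fun (_ _ : ι) => ∏ k ∈ (∅ : Finset κ), M k ‹_› ‹_›) =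
      (Matrix.of fun (_ : ι) (_ : Unit) => (1 : ℂ)) *
        (Matrix.of fun (_ : ι) (_ : Unit) => (1 : ℂ))ᴴ := by
      ext α β
      simp [Matrix.mul_apply]
    simp only [Finset.prod_empty] at h2 ⊢
    rw [h2]
    exact h1
  | insert k s hk ih =>
    have h1 := (h k (Finset.mem_insert_self _ _)).hadamard
      (ih fun k hk => h k (Finset.mem_insert_of_mem hk))
    have h2 : (Matrix.of fun α β => ∏ k ∈ insert k s, M k α β) =
        M k ⊙ (Matrix.of fun α β => ∏ k ∈ s, M k α β) := by
      ext α β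
      simp [Finset.prod_insert hk]
    rw [h2]
    exact h1

/-- The form `⟨f x, g y⟩`. -/
def innerForm (f g : D →ₗ[ℂ] OnePhoton) : D →ₗ⋆[ℂ] D →ₗ[ℂ] ℂ :=
  LinearMap.mk₂'ₛₗ _ _ (fun x y => ⟪f x, g y⟫) (fun x y z => by simp [inner_add_left])
    (fun c x y => by simp [inner_smul_left]) (fun x y z => by simp [inner_add_right])
    (fun c x y => by simp [inner_smul_right])

theorem innerForm_apply (f g : D →ₗ[ℂ] OnePhoton) (x y : D) : innerForm f g x y = ⟪f x, g y⟫ := rfl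

theorem inner_tensor_update_self {α : Type*} {n : ℕ} (e a : α → OnePhoton) (p q : Fin n → α) (j : Fin n) :
    ⟪tensor (Function.update (fun i => e (p i)) j (a (p j))),
      tensor (Function.update (fun i => e (q i)) j (a (q j)))⟫ =
    ⟪a (p j), a (q j)⟫ * ∏ i ∈ Finset.univ.erase j, ⟪e (p i), e (q i)⟫ := by
  rw [inner_tensor, ← Finset.mul_prod_erase _ _ (Finset.mem_univ j), Function.update_self,
    Function.update_self]
  congr 1
  refine Finset.prod_congr rfl fun i hi => ?_
  rw [Function.update_of_ne (Finset.ne_of_mem_erase hi),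
    Function.update_of_ne (Finset.ne_of_mem_erase hi)]

theorem inner_tensor_update_of_ne {α : Type*} {n : ℕ} (e a : α → OnePhoton) (p q : Fin n → α) {j k : Fin n}
    (hjk : j ≠ k) :
    ⟪tensor (Function.update (fun i => e (p i)) j (a (p j))),
      tensor (Function.update (fun i => e (q i)) k (a (q k)))⟫ =
    (⟪a (p j), e (q j)⟫ * ⟪e (p k), a (q k)⟫) *
      ∏ i ∈ (Finset.univ.erase j).erase k, ⟪e (p i), e (q i)⟫ := by
  rw [inner_tensor, ← Finset.mul_prod_erase _ _ (Finset.mem_univ j),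
    ← Finset.mul_prod_erase _ _ (Finset.mem_erase.2 ⟨hjk.symm, Finset.mem_univ k⟩), ← mul_assoc]
  rw [Function.update_self, Function.update_self, Function.update_of_ne hjk,
    Function.update_of_ne hjk.symm]
  congr 1
  refine Finset.prod_congr rfl fun i hi => ?_
  have h1 := Finset.ne_of_mem_erase hi
  have h2 := Finset.ne_of_mem_erase (Finset.mem_of_mem_erase hi)
  rw [Function.update_of_ne h1, Function.update_of_ne h2]

/-- If `‖a x‖ ≤ ‖w x‖` and `|⟨x, a x⟩| ≤ ⟨x, w x⟩` for symmetric `a` and `w`, then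
`‖dΓ(a) F‖ ≤ ‖dΓ(w) F‖` on the algebraic tensor product. -/
theorem norm_sum_smul_sumTensor_le {ι : Type*} [Fintype ι] {n : ℕ} (e a w : D →ₗ[ℂ] OnePhoton)
    (ha : ∀ x y, ⟪a x, e y⟫ = ⟪e x, a y⟫) (hw : ∀ x y, ⟪w x, e y⟫ = ⟪e x, w y⟫)
    (hnorm : ∀ x, ‖a x‖ ≤ ‖w x‖) (hform : ∀ x, |(⟪e x, a x⟫).re| ≤ (⟪e x, w x⟫).re)
    (c : ι → ℂ) (p : ι → Fin n → D) :
    ‖∑ α, c α • sumTensor e a (p α)‖ ≤ ‖∑ α, c α • sumTensor e w (p α)‖ := by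
  have hG : ∀ i, (Matrix.of fun α β => ⟪e (p α i), e (p β i)⟫).PosSemidef := fun i =>
    posSemidef_of_form (innerForm e e) (fun x y => by simp [innerForm_apply])
      (fun x => by rw [innerForm_apply]; exact inner_self_nonneg (𝕜 := ℂ) (x := e x)) fun α => p α i
  have hdiag : ∀ i, (Matrix.of fun α β =>
      ⟪w (p α i), w (p β i)⟫ - ⟪a (p α i), a (p β i)⟫).PosSemidef := fun i =>
    posSemidef_of_form (innerForm w w - innerForm a a) (fun x y => by simp [innerForm_apply])
      (fun x => by
        simp only [LinearMap.sub_apply, innerForm_apply, inner_self_eq_norm_sq_to_K]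
        have := pow_le_pow_left₀ (norm_nonneg _) (hnorm x) 2
        simpa [← Complex.ofReal_pow] using this) fun α => p α i
  have hsub : ∀ i, (Matrix.of fun α β =>
      ⟪e (p α i), w (p β i)⟫ - ⟪e (p α i), a (p β i)⟫).PosSemidef := fun i =>
    posSemidef_of_form (innerForm e w - innerForm e a)
      (fun x y => by simp [innerForm_apply, ha, hw])
      (fun x => by
        simpa [innerForm_apply] using (le_abs_self _).trans (hform x)) fun α => p α i
  have hadd : ∀ i, (Matrix.of fun α β =>
      ⟪e (p α i), w (p β i)⟫ + ⟪e (p α i), a (p β i)⟫).PosSemidef := fun i =>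
    posSemidef_of_form (innerForm e w + innerForm e a)
      (fun x y => by simp [innerForm_apply, ha, hw])
      (fun x => by
        have := (neg_le_abs _).trans (hform x)
        simp only [LinearMap.add_apply, innerForm_apply, Complex.add_re]
        linarith) fun α => p α i
  -- The square of the norm splits over the pairs `(j, k)` of places where the operator acts. The
  -- comparison is made separately for each pair.
  have hexp : ∀ b : D →ₗ[ℂ] OnePhoton, ‖∑ α, c α • sumTensor e b (p α)‖ ^ 2 =
      ∑ j, ∑ k, (∑ α, ∑ β, star (c α) *
        ⟪tensor (Function.update (fun i => e (p α i)) j (b (p α j))),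
          tensor (Function.update (fun i => e (p β i)) k (b (p β k)))⟫ * c β).re := by
    intro b
    rw [← inner_self_eq_norm_sq (𝕜 := ℂ), inner_sum_smul]
    simp only [sumTensor, sum_inner, inner_sum, Finset.mul_sum, Finset.sum_mul]
    simp only [RCLike.re_to_complex, Complex.re_sum]
    have hswap : ∀ g : ι → ι → Fin n → ℝ, ∑ α, ∑ β, ∑ j, g α β j = ∑ j, ∑ α, ∑ β, g α β j := by
      intro g
      exact (Finset.sum_congr rfl fun α _ => Finset.sum_comm).trans Finset.sum_comm
    conv_rhs => rw [Finset.sum_comm]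
    rw [hswap]
    refine Finset.sum_congr rfl fun k _ => ?_
    rw [hswap]
  refine le_of_sq_le_sq ?_ (norm_nonneg _)
  rw [hexp, hexp]
  refine Finset.sum_le_sum fun j _ => Finset.sum_le_sum fun k _ => ?_
  rw [← sub_nonneg, ← Complex.sub_re]
  simp_rw [← Finset.sum_sub_distrib, ← sub_mul, ← mul_sub]
  rcases eq_or_ne j k with rfl | hjk
  -- Diagonal pairs: the norm bound makes the Gram matrix of `w` minus that of `a` positive, and the
  -- remaining factors are Gram matrices of `e`.
  · refine (sum_re_nonneg_of_posSemidef ((hdiag j).hadamard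
      (posSemidef_prod (Finset.univ.erase j) _ fun i _ => hG i)) c).trans_eq ?_
    simp_rw [inner_tensor_update_self, ← sub_mul]
    rfl
  -- Off-diagonal pairs: symmetry puts every operator on the right, and `w ⊗ w - a ⊗ a` is half of
  -- `(w - a) ⊗ (w + a) + (w + a) ⊗ (w - a)`. Each factor is positive by the form bound.
  · refine (sum_re_nonneg_of_posSemidef (((((hsub j).hadamard (hadd k)).add
      ((hadd j).hadamard (hsub k))).smul (show (0 : ℂ) ≤ 1 / 2 by simp)).hadamard
      (posSemidef_prod ((Finset.univ.erase j).erase k) _ fun i _ => hG i)) c).trans_eq ?_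
    simp_rw [inner_tensor_update_of_ne _ _ _ _ hjk, ← sub_mul, ha, hw]
    congr 1
    refine Finset.sum_congr rfl fun α _ => Finset.sum_congr rfl fun β _ => ?_
    simp only [Matrix.hadamard_apply, Matrix.smul_apply, Matrix.add_apply, Matrix.of_apply,
      smul_eq_mul]
    ring

end Compare

end FockSpace

end

noncomputable section

namespace FockSpace

open Filter Topology

/-! ### Density of the algebraic tensor product -/

local notation "⟪" x ", " y "⟫" => inner ℂ x y

/-- The indicator function of a box is itself an elementary tensor. -/
theorem setIntegral_box_eq_zero {n : ℕ} (F : NPhoton n) (hF : ∀ f, ⟪tensor f, F⟫ = 0)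
    (A : Fin n → Set Mode) (hA : ∀ i, MeasurableSet (A i)) (hfin : ∀ i, modeMeasure (A i) ≠ ⊤) :
    ∫ k in Set.univ.pi A, F k ∂configMeasure n = 0 := by
  rw [← hF fun i => indicatorConstLp 2 (hA i) (hfin i) (1 : ℂ), L2.inner_def,
    ← integral_indicator (MeasurableSet.univ_pi hA)]
  refine integral_congr_ae ?_
  have h : ∀ᵐ k ∂configMeasure n, ∀ i, indicatorConstLp 2 (hA i) (hfin i) (1 : ℂ) (k i) =
      (A i).indicator (fun _ => (1 : ℂ)) (k i) :=
    ae_all_iff.2 fun i => ae_eval indicatorConstLp_coeFn i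
  filter_upwards [coeFn_tensor fun i => indicatorConstLp 2 (hA i) (hfin i) (1 : ℂ), h] with k h1 h2
  rw [h1]
  simp_rw [h2]
  by_cases hk : k ∈ Set.univ.pi A
  · have : ∀ i, (A i).indicator (fun _ => (1 : ℂ)) (k i) = 1 := fun i =>
      Set.indicator_of_mem (hk i (Set.mem_univ i)) _
    simp [this, Set.indicator_of_mem hk]
  · rw [Set.indicator_of_notMem hk]
    simp only [Set.mem_univ_pi, not_forall] at hk
    obtain ⟨i, hi⟩ := hk
    rw [Finset.prod_eq_zero (Finset.mem_univ i) (Set.indicator_of_notMem hi _), inner_zero_left]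

/-- Boxes form a π-system generating the product σ-algebra, so the vanishing of integrals over boxes
spreads to all measurable sets. -/
theorem eq_zero_of_inner_tensor_eq_zero {n : ℕ} (F : NPhoton n) (hF : ∀ f, ⟪tensor f, F⟫ = 0) :
    F = 0 := by
  set B : ℕ → Set (Fin n → Mode) := fun N => Set.univ.pi fun _ => spanningSets modeMeasure N
  have hBm : ∀ N, MeasurableSet (B N) := fun N =>
    MeasurableSet.univ_pi fun _ => measurableSet_spanningSets _ _
  have hBfin : ∀ N, configMeasure n (B N) < ⊤ := fun N => by
    rw [Measure.pi_pi]
    exact ENNReal.prod_lt_top fun i _ => measure_spanningSets_lt_top _ _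
  have hint : ∀ s, configMeasure n s < ⊤ → IntegrableOn F s (configMeasure n) := fun s hs => by
    have : IsFiniteMeasure ((configMeasure n).restrict s) := ⟨by simpa using hs⟩
    exact ((Lp.memLp F).restrict s).integrable (by norm_num)
  have hB : ∀ N, ∫ k in B N, F k ∂configMeasure n = 0 := fun N =>
    setIntegral_box_eq_zero F hF _ (fun _ => measurableSet_spanningSets _ _)
      fun _ => (measure_spanningSets_lt_top _ _).ne
  -- Dynkin's argument is run inside the finite boxes `B N`: `F` is only square integrable, and
  -- passing to complements needs `F` integrable on the ambient set.
  have hinter : ∀ N s, MeasurableSet s → ∫ k in s ∩ B N, F k ∂configMeasure n = 0 := by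
    intro N s hs
    refine MeasurableSpace.induction_on_inter
      (C := fun s _ => ∫ k in s ∩ B N, F k ∂configMeasure n = 0) generateFrom_pi.symm isPiSystem_pi
      (by simp) ?_ ?_ ?_ s hs
    · rintro t ⟨A, hA, rfl⟩
      have hA' : ∀ i, MeasurableSet (A i) := fun i => by simpa using hA i (Set.mem_univ i)
      rw [← Set.pi_inter_distrib]
      refine setIntegral_box_eq_zero F hF _ (fun i => (hA' i).inter
        (measurableSet_spanningSets _ _)) fun i => ?_
      exact ((measure_mono Set.inter_subset_right).trans_lt (measure_spanningSets_lt_top _ _)).ne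
    · intro t ht ih
      have h := integral_inter_add_sdiff (μ := configMeasure n) ht (hint (B N) (hBfin N))
      rw [Set.inter_comm, ih, hB, zero_add] at h
      rwa [Set.inter_comm, ← Set.sdiff_eq]
    · intro f hd hm ih
      rw [Set.iUnion_inter, integral_iUnion (fun i => (hm i).inter (hBm N))
        (fun i j hij => (hd hij).mono Set.inter_subset_left Set.inter_subset_left)]
      · simp [ih]
      · exact (hint (B N) (hBfin N)).mono_set (Set.iUnion_subset fun i => Set.inter_subset_right)
  have hmono : Monotone B := fun N M h =>
    Set.pi_mono fun _ _ => monotone_spanningSets modeMeasure h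
  have hU : ⋃ N, B N = Set.univ := by
    rw [Set.eq_univ_iff_forall]
    intro k
    have : ∀ i, ∃ N, k i ∈ spanningSets modeMeasure N := fun i => by
      have := Set.mem_univ (k i)
      rwa [← iUnion_spanningSets modeMeasure, Set.mem_iUnion] at this
    choose N hN using this
    refine Set.mem_iUnion.2 ⟨Finset.univ.sup N, fun i _ => ?_⟩
    exact monotone_spanningSets modeMeasure (Finset.le_sup (Finset.mem_univ i)) (hN i)
  have hzero : (F : (Fin n → Mode) → ℂ) =ᵐ[configMeasure n] 0 := by
    refine Lp.ae_eq_zero_of_forall_setIntegral_eq_zero F (by norm_num) (by norm_num)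
      (fun s _ hs => hint s hs) fun s hs hsfin => ?_
    have h := tendsto_setIntegral_of_monotone (μ := configMeasure n) (f := F) (s := fun N => s ∩ B N)
      (fun N => hs.inter (hBm N)) (fun N M h => Set.inter_subset_inter_right s (hmono h))
      (by rw [← Set.inter_iUnion, hU, Set.inter_univ]; exact hint s hsfin)
    rw [← Set.inter_iUnion, hU, Set.inter_univ] at h
    simp_rw [hinter _ s hs] at h
    exact tendsto_nhds_unique h tendsto_const_nhds
  exact (Lp.eq_zero_iff_ae_eq_zero).2 hzero

theorem dense_span_tensor {n : ℕ} {D : Type*} (e : D → OnePhoton) (he : DenseRange e) :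
    Dense (Submodule.span ℂ (Set.range fun p : Fin n → D => tensor fun i => e (p i)) :
      Set (NPhoton n)) := by
  rw [Submodule.dense_iff_topologicalClosure_eq_top, Submodule.topologicalClosure_eq_top_iff,
    Submodule.eq_bot_iff]
  intro F hF
  refine eq_zero_of_inner_tensor_eq_zero F fun f => ?_
  have hd : DenseRange fun (p : Fin n → D) i => e (p i) := by
    have := DenseRange.piMap (fun _ : Fin n => he)
    exact this
  refine hd.induction_on (p := fun f => ⟪tensor f, F⟫ = 0) f
    (isClosed_eq ((continuous_tensor n).inner continuous_const) continuous_const) fun p => ?_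
  exact (Submodule.mem_orthogonal _ _).1 hF _ (Submodule.subset_span ⟨p, rfl⟩)

end FockSpace

end

noncomputable section

namespace FockSpace

open Filter Topology

local notation "⟪" x ", " y "⟫" => inner ℂ x y

/-! ### Symmetric operators as graphs -/

/-- `⟨T x, x'⟩ = ⟨x, T x'⟩` on the domain. -/
def IsSymm {H : Type*} [NormedAddCommGroup H] [InnerProductSpace ℂ H] (T : Submodule ℂ (H × H)) :
    Prop := ∀ p ∈ T, ∀ q ∈ T, ⟪p.2, q.1⟫ = ⟪p.1, q.2⟫

theorem IsSymm.topologicalClosure_span {H : Type*} [NormedAddCommGroup H] [InnerProductSpace ℂ H]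
    {s : Set (H × H)} (hs : ∀ p ∈ s, ∀ q ∈ s, ⟪p.2, q.1⟫ = ⟪p.1, q.2⟫) :
    IsSymm (Submodule.span ℂ s).topologicalClosure := by
  have h1 : ∀ p ∈ Submodule.span ℂ s, ∀ q ∈ s, ⟪p.2, q.1⟫ = ⟪p.1, q.2⟫ := by
    intro p hp q hq
    induction hp using Submodule.span_induction with
    | mem x hx => exact hs x hx q hq
    | zero => simp
    | add x y _ _ hx hy => simp [hx, hy]
    | smul c x _ hx => simp [hx]
  have h2 : ∀ p ∈ Submodule.span ℂ s, ∀ q ∈ Submodule.span ℂ s, ⟪p.2, q.1⟫ = ⟪p.1, q.2⟫ := by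
    intro p hp q hq
    induction hq using Submodule.span_induction with
    | mem x hx => exact h1 p hp x hx
    | zero => simp
    | add x y _ _ hx hy => simp [hx, hy]
    | smul c x _ hx => simp [hx]
  have h3 : ∀ p ∈ closure (Submodule.span ℂ s : Set (H × H)), ∀ q ∈ Submodule.span ℂ s,
      ⟪p.2, q.1⟫ = ⟪p.1, q.2⟫ := by
    intro p hp q hq
    exact closure_minimal (t := {p | ⟪p.2, q.1⟫ = ⟪p.1, q.2⟫}) (fun p hp => by rw [Set.mem_ofPred_eq]; exact h2 p hp q hq)
      (isClosed_eq (by fun_prop) (by fun_prop)) hp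
  intro p hp q hq
  exact closure_minimal (t := {q | ⟪p.2, q.1⟫ = ⟪p.1, q.2⟫}) (fun q hq => by rw [Set.mem_ofPred_eq]; exact h3 p hp q hq)
    (isClosed_eq (by fun_prop) (by fun_prop)) hq

/-- Graphs are not assumed single-valued. If `(0, v)` lies in a symmetric graph, then `v` is
orthogonal to the domain, so density forces `v = 0`. -/
theorem IsSymm.eq_of_mem {H : Type*} [NormedAddCommGroup H] [InnerProductSpace ℂ H]
    {T : Submodule ℂ (H × H)} (hT : IsSymm T) (hd : Dense (dom T : Set H)) {x y y' : H}
    (h : (x, y) ∈ T) (h' : (x, y') ∈ T) : y = y' := by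
  have h0 : (0, y - y') ∈ T := by simpa using T.sub_mem h h'
  rw [← sub_eq_zero]
  refine hd.eq_zero_of_inner_left ℂ fun z hz => ?_
  obtain ⟨q, hq, hqz⟩ := hz
  have := hT _ h0 q hq
  rw [inner_zero_left] at this
  rw [← hqz]
  exact this

/-- The cross term is `⟨x, T² x⟩ = ‖T x‖²`. This identity gives both the injectivity of `1 + T²` and
the bounds of `x`, `T x` and `T² x` by `(1 + T²) x`. -/
theorem IsSymm.norm_add_sq {H : Type*} [NormedAddCommGroup H] [InnerProductSpace ℂ H]
    {T : Submodule ℂ (H × H)} (hT : IsSymm T) {x y z : H} (h : (x, y) ∈ T) (h' : (y, z) ∈ T) :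
    ‖x + z‖ ^ 2 = ‖x‖ ^ 2 + 2 * ‖y‖ ^ 2 + ‖z‖ ^ 2 := by
  rw [_root_.norm_add_sq (𝕜 := ℂ), ← hT _ h _ h', ← inner_self_eq_norm_sq (𝕜 := ℂ) y]

theorem IsSymm.re_inner_add {H : Type*} [NormedAddCommGroup H] [InnerProductSpace ℂ H]
    {T : Submodule ℂ (H × H)} (hT : IsSymm T) {x y z : H} (h : (x, y) ∈ T) (h' : (y, z) ∈ T) :
    (⟪x, x + z⟫).re = ‖x‖ ^ 2 + ‖y‖ ^ 2 := by
  rw [inner_add_right, ← hT _ h _ h', Complex.add_re, ← inner_self_eq_norm_sq (𝕜 := ℂ) y,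
    ← inner_self_eq_norm_sq (𝕜 := ℂ) x]
  rfl

theorem isClosed_sumOp (a : Submodule ℂ (OnePhoton × OnePhoton)) (n : ℕ) :
    IsClosed (sumOp a n : Set (NPhoton n × NPhoton n)) :=
  Submodule.isClosed_topologicalClosure _

theorem sumTensor_mem_sumOp {D : Type*} {a : Submodule ℂ (OnePhoton × OnePhoton)} {n : ℕ}
    {e w : D → OnePhoton} (h : ∀ x, (e x, w x) ∈ a) (p : Fin n → D) :
    (tensor (fun i => e (p i)), sumTensor e w p) ∈ sumOp a n :=
  Submodule.le_topologicalClosure _ (Submodule.subset_span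
    ⟨fun i => e (p i), fun i => w (p i), fun i => h (p i), rfl⟩)

theorem isSymm_sumOp {a : Submodule ℂ (OnePhoton × OnePhoton)} (ha : IsSymm a) (n : ℕ) :
    IsSymm (sumOp a n) := by
  refine IsSymm.topologicalClosure_span ?_
  rintro _ ⟨f, g, hfg, rfl⟩ _ ⟨f', g', hfg', rfl⟩
  simp only [sum_inner, inner_sum]
  refine Finset.sum_congr rfl fun j _ => ?_
  rw [inner_tensor, inner_tensor]
  refine Finset.prod_congr rfl fun i _ => ?_
  rcases eq_or_ne i j with rfl | hij
  · simpa using ha _ (hfg i) _ (hfg' i)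
  · simp [Function.update_of_ne hij]

theorem dense_dom_sumOp {D : Type*} {a : Submodule ℂ (OnePhoton × OnePhoton)} {e w : D → OnePhoton}
    (h : ∀ x, (e x, w x) ∈ a) (he : DenseRange e) (n : ℕ) :
    Dense (dom (sumOp a n) : Set (NPhoton n)) := by
  refine (dense_span_tensor e he).mono ?_
  refine Submodule.span_le.2 ?_
  rintro _ ⟨p, rfl⟩
  exact ⟨_, sumTensor_mem_sumOp h p, rfl⟩

/-! ### The `n`-photon estimate -/

/-- A nonnegative operator `w` and a symmetric operator `b` on a common core `S`, and a
`w`-invariant subspace `Z` on which the commutator of `w` and `b` is controlled by `w`. -/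
structure CommutatorData (S Z : Type*) [AddCommGroup S] [Module ℂ S] [AddCommGroup Z]
    [Module ℂ Z] where
  e : S →ₗ[ℂ] OnePhoton
  w : S →ₗ[ℂ] OnePhoton
  b : S →ₗ[ℂ] S
  ι : Z →ₗ[ℂ] S
  wz : Z →ₗ[ℂ] Z
  C₁ : ℝ
  C₂ : ℝ
  C₁_nonneg : 0 ≤ C₁
  C₂_nonneg : 0 ≤ C₂
  e_wz : ∀ z, e (ι (wz z)) = w (ι z)
  w_symm : ∀ x y, ⟪w x, e y⟫ = ⟪e x, w y⟫
  b_symm : ∀ x y, ⟪e (b x), e y⟫ = ⟪e x, e (b y)⟫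
  norm_b_le : ∀ x, ‖e (b x)‖ ≤ C₁ * ‖w x‖
  form_b_le : ∀ x, |(⟪e x, e (b x)⟫).re| ≤ C₁ * (⟪e x, w x⟫).re
  -- The commutator is evaluated only on `Z`, where applying `w` leads back into the core. `b` need
  -- not preserve `Z`, which is why two spaces are needed.
  norm_comm_le : ∀ z, ‖w (b (ι z)) - e (b (ι (wz z)))‖ ≤ C₂ * ‖w (ι z)‖
  -- The commutator of two symmetric operators is skew-symmetric, so the imaginary part carries its
  -- form.
  form_comm_le : ∀ z, |(⟪e (ι z), w (b (ι z)) - e (b (ι (wz z)))⟫).im| ≤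
    C₂ * (⟪e (ι z), w (ι z)⟫).re
  -- Finitely many vectors lie in a `w`-invariant subspace on which `w` is bounded. This is what
  -- makes the range of `1 + X²` on algebraic tensors dense.
  exists_bounded : ∀ (n : ℕ) (p : Fin n → Z), ∃ (Y : Submodule ℂ Z) (m : ℝ), 0 ≤ m ∧
    (∀ i, p i ∈ Y) ∧ (∀ z ∈ Y, wz z ∈ Y) ∧ ∀ z ∈ Y, ‖w (ι z)‖ ≤ m * ‖e (ι z)‖
  dense : DenseRange fun z => e (ι z)

theorem norm_sum_smul_sumTensor_le_mul {D ι : Type*} [AddCommGroup D] [Module ℂ D] [Fintype ι]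
    {n : ℕ} (e a w : D →ₗ[ℂ] OnePhoton)
    (ha : ∀ x y, ⟪a x, e y⟫ = ⟪e x, a y⟫) (hw : ∀ x y, ⟪w x, e y⟫ = ⟪e x, w y⟫) (C : ℝ)
    (hC : 0 ≤ C) (hnorm : ∀ x, ‖a x‖ ≤ C * ‖w x‖)
    (hform : ∀ x, |(⟪e x, a x⟫).re| ≤ C * (⟪e x, w x⟫).re) (c : ι → ℂ) (p : ι → Fin n → D) :
    ‖∑ α, c α • sumTensor e a (p α)‖ ≤ C * ‖∑ α, c α • sumTensor e w (p α)‖ := by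
  obtain ⟨v, hv⟩ : ∃ v : D →ₗ[ℂ] OnePhoton, ∀ x, v x = (C : ℂ) • w x := ⟨(C : ℂ) • w, fun _ => rfl⟩
  have h := norm_sum_smul_sumTensor_le e a v ha
    (fun x y => by rw [hv, hv, inner_smul_left, inner_smul_right, hw, Complex.conj_ofReal])
    (fun x => by
      rw [hv, norm_smul, Complex.norm_real, Real.norm_of_nonneg hC]
      exact hnorm x)
    (fun x => by rw [hv, inner_smul_right, Complex.re_ofReal_mul]; exact hform x) c p
  have h2 : ∑ α, c α • sumTensor e v (p α) = (C : ℂ) • ∑ α, c α • sumTensor e w (p α) := by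
    simp only [sumTensor, hv, tensor_update_smul, Finset.smul_sum]
    simp_rw [smul_comm (C : ℂ)]
  rwa [h2, norm_smul, Complex.norm_real, Real.norm_of_nonneg hC] at h

theorem sumTensor_self {D : Type*} {n : ℕ} (e : D → OnePhoton) (p : Fin n → D) :
    sumTensor e e p = (n : ℂ) • tensor fun i => e (p i) := by
  simp [sumTensor, ← Nat.cast_smul_eq_nsmul ℂ]

/-- The identity `X B = B X + dΓ([w, b])` on an elementary tensor. Operators acting at different
places commute, so after exchanging the two sums only the terms with both operators at the same
place differ, and there the difference is `c`. -/
theorem sum_sumTensor_update_sub {D : Type*} {n : ℕ} (e w a : D → OnePhoton) (p b v : Fin n → D)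
    (c : Fin n → OnePhoton) (hw : ∀ i, e (v i) = w (p i)) (hb : ∀ i, e (b i) = a (p i))
    (hc : ∀ i, c i = w (b i) - a (v i)) :
    ∑ j, sumTensor e w (Function.update p j (b j)) =
      ∑ j, sumTensor e a (Function.update p j (v j)) +
        ∑ j, tensor (Function.update (fun i => e (p i)) j (c j)) := by
  have key : ∀ (g : D → OnePhoton) (u : Fin n → D) (j k : Fin n),
      tensor (Function.update (fun i => e (Function.update p j (u j) i)) k
        (g (Function.update p j (u j) k))) =
      if k = j then tensor (Function.update (fun i => e (p i)) j (g (u j)))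
      else tensor (Function.update (Function.update (fun i => e (p i)) j (e (u j))) k
        (g (p k))) := by
    intro g u j k
    have h1 : (fun i => e (Function.update p j (u j) i)) =
        Function.update (fun i => e (p i)) j (e (u j)) := by
      ext1 i
      rcases eq_or_ne i j with rfl | hij
      · simp
      · simp [Function.update_of_ne hij]
    rw [h1]
    split_ifs with hkj
    · subst hkj
      simp
    · rw [Function.update_of_ne hkj]
  simp only [sumTensor, key]
  conv_rhs => rw [Finset.sum_comm]
  rw [← Finset.sum_add_distrib]
  refine Finset.sum_congr rfl fun j _ => ?_
  -- The commutator term is spread over `k` with support at `k = j`, so that the double sums can be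
  -- compared term by term.
  have hself : ∀ (x : NPhoton n), x = ∑ k : Fin n, if k = j then x else 0 := by simp
  rw [hself (tensor (Function.update (fun i => e (p i)) j (c j))), ← Finset.sum_add_distrib]
  refine Finset.sum_congr rfl fun k _ => ?_
  rcases eq_or_ne k j with rfl | hkj
  · simp [hc, ← tensor_update_add]
  · rw [if_neg hkj, if_neg hkj.symm, if_neg hkj, add_zero, hw, hb, Function.update_comm hkj]

namespace CommutatorData

variable {S Z : Type*} [AddCommGroup S] [Module ℂ S] [AddCommGroup Z] [Module ℂ Z]
variable (d : CommutatorData S Z) (n : ℕ)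

/-- The values of `1`, `X`, `X²`, `B`, `B²` on an elementary tensor. -/
def values (p : Fin n → Z) : NPhoton n × NPhoton n × NPhoton n × NPhoton n × NPhoton n :=
  (tensor fun i => d.e (d.ι (p i)),
    sumTensor d.e d.w fun i => d.ι (p i),
    ∑ j, sumTensor d.e d.w fun i => d.ι (Function.update p j (d.wz (p j)) i),
    sumTensor d.e (d.e ∘ₗ d.b) fun i => d.ι (p i),
    ∑ j, sumTensor d.e (d.e ∘ₗ d.b)
      (Function.update (fun i => d.ι (p i)) j (d.b (d.ι (p j)))))

/-- The algebraic graph. -/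
def graph : Submodule ℂ (NPhoton n × NPhoton n × NPhoton n × NPhoton n × NPhoton n) :=
  Submodule.span ℂ (Set.range (d.values n))

/-- The comparison theorem is used three times: `‖B(BF)‖ ≤ C₁ ‖X B F‖`, then `‖B X F‖ ≤ C₁ ‖X² F‖`
and `‖dΓ([w, b]) F‖ ≤ C₂ ‖X F‖` for the two parts of `X B F`. -/
theorem norm_le_of_mem_graph {n : ℕ} {x}
    (hx : x ∈ d.graph n) :
    ‖x.2.2.2.1‖ ≤ d.C₁ * ‖x.2.1‖ ∧
      ‖x.2.2.2.2‖ ≤ d.C₁ * (d.C₁ * ‖x.2.2.1‖ + d.C₂ * ‖x.2.1‖) := by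
  obtain ⟨N, c, g, rfl⟩ := (Submodule.mem_span_set' (s := Set.range (d.values n))).1 hx
  have hg : ∀ α, ∃ p, d.values n p = g α := fun α => (g α).2
  choose p hp using hg
  simp only [← hp]
  simp only [values, Prod.smul_mk, Prod.fst_sum, Prod.snd_sum]
  refine ⟨norm_sum_smul_sumTensor_le_mul d.e (d.e ∘ₗ d.b) d.w d.b_symm d.w_symm d.C₁ d.C₁_nonneg
    d.norm_b_le d.form_b_le c _, ?_⟩
  -- `B F` is again a combination of elementary tensors, indexed by the term of `F` and the place
  -- where `b` acts; likewise `X F` in `h2`.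
  have h1 := norm_sum_smul_sumTensor_le_mul (n := n) d.e (d.e ∘ₗ d.b) d.w d.b_symm d.w_symm d.C₁
    d.C₁_nonneg d.norm_b_le d.form_b_le (fun α : Fin N × Fin n => c α.1)
    (fun α => Function.update (fun i => d.ι (p α.1 i)) α.2 (d.b (d.ι (p α.1 α.2))))
  have h2 := norm_sum_smul_sumTensor_le_mul (n := n) d.e (d.e ∘ₗ d.b) d.w d.b_symm d.w_symm d.C₁
    d.C₁_nonneg d.norm_b_le d.form_b_le (fun α : Fin N × Fin n => c α.1)
    (fun α i => d.ι (Function.update (p α.1) α.2 (d.wz (p α.1 α.2)) i))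
  simp only [Fintype.sum_prod_type, ← Finset.smul_sum] at h1 h2
  refine h1.trans (mul_le_mul_of_nonneg_left ?_ d.C₁_nonneg)
  set comm : Z →ₗ[ℂ] OnePhoton := d.w ∘ₗ d.b ∘ₗ d.ι - d.e ∘ₗ d.b ∘ₗ d.ι ∘ₗ d.wz with hcomm
  have hcommx : ∀ x, comm x = d.w (d.b (d.ι x)) - d.e (d.b (d.ι (d.wz x))) := fun x => rfl
  have hcs : ∀ x y, ⟪comm x, d.e (d.ι y)⟫ = -⟪d.e (d.ι x), comm y⟫ := by
    intro x y
    rw [hcommx, hcommx, inner_sub_left, inner_sub_right, d.w_symm (d.b (d.ι x)),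
      d.b_symm (d.ι (d.wz x)), d.e_wz, d.w_symm (d.ι x), ← d.b_symm (d.ι x), d.e_wz]
    ring
  -- The comparison theorem asks for a symmetric operator, so the skew-symmetric commutator is
  -- multiplied by `i`.
  obtain ⟨v, hv⟩ : ∃ v : Z →ₗ[ℂ] OnePhoton, ∀ x, v x = Complex.I • comm x :=
    ⟨Complex.I • comm, fun _ => rfl⟩
  have h3 := norm_sum_smul_sumTensor_le_mul (n := n) (d.e ∘ₗ d.ι) v (d.w ∘ₗ d.ι)
    (fun x y => by simp [hv, inner_smul_left, inner_smul_right, hcs])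
    (fun x y => d.w_symm _ _) d.C₂ d.C₂_nonneg
    (fun x => by
      rw [hv, norm_smul, Complex.norm_I, one_mul]
      exact d.norm_comm_le x)
    (fun x => by
      have := d.form_comm_le x
      rw [← hcommx] at this
      simpa [hv, inner_smul_right] using this) c p
  have h4 : ∑ α, c α • sumTensor (d.e ∘ₗ d.ι) v (p α) =
      Complex.I • ∑ α, c α • sumTensor (d.e ∘ₗ d.ι) comm (p α) := by
    simp only [sumTensor, hv, tensor_update_smul, Finset.smul_sum]
    simp_rw [smul_comm Complex.I]
  rw [h4, norm_smul, Complex.norm_I, one_mul] at h3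
  have h5 : ∑ α, c α • ∑ j, sumTensor d.e d.w
        (Function.update (fun i => d.ι (p α i)) j (d.b (d.ι (p α j)))) =
      ∑ α, c α • ∑ j, sumTensor d.e (d.e ∘ₗ d.b)
        (fun i => d.ι (Function.update (p α) j (d.wz (p α j)) i)) +
      ∑ α, c α • sumTensor (d.e ∘ₗ d.ι) comm (p α) := by
    rw [← Finset.sum_add_distrib]
    refine Finset.sum_congr rfl fun α _ => ?_
    rw [← smul_add, sum_sumTensor_update_sub d.e d.w (d.e ∘ₗ d.b) (fun i => d.ι (p α i))
      (fun i => d.b (d.ι (p α i))) (fun i => d.ι (d.wz (p α i))) (fun i => comm (p α i))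
      (fun i => d.e_wz _) (fun i => rfl) (fun i => rfl)]
    congr 3
    ext1 j
    congr 1
    exact (Function.comp_update d.ι (p α) j _).symm
  rw [h5]
  exact (norm_add_le _ _).trans (add_le_add h2 h3)

theorem sumTensor_w_eq {n : ℕ} (p : Fin n → Z) : sumTensor d.e d.w (fun i => d.ι (p i)) =
    ∑ j, tensor fun i => d.e (d.ι (Function.update p j (d.wz (p j)) i)) := by
  refine Finset.sum_congr rfl fun j _ => congrArg tensor (funext fun i => ?_)
  rcases eq_or_ne i j with rfl | hij
  · simp [d.e_wz]
  · simp [Function.update_of_ne hij]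

theorem mem_sumOp_of_mem_graph {T β : Submodule ℂ (OnePhoton × OnePhoton)}
    (hT : ∀ x, (d.e x, d.w x) ∈ T) (hβ : ∀ x, (d.e x, d.e (d.b x)) ∈ β) {n : ℕ} {x}
    (hx : x ∈ d.graph n) :
    ((x.1, x.2.1) ∈ sumOp T n ∧ (x.2.1, x.2.2.1) ∈ sumOp T n) ∧
      (x.1, x.2.2.2.1) ∈ sumOp β n ∧ (x.2.2.2.1, x.2.2.2.2) ∈ sumOp β n := by
  induction hx using Submodule.span_induction with
  | mem x hx =>
    obtain ⟨p, rfl⟩ := hx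
    refine ⟨⟨sumTensor_mem_sumOp hT _, ?_⟩, sumTensor_mem_sumOp hβ _, ?_⟩
    · have h1 := d.sumTensor_w_eq p
      have h2 := (sumOp T n).sum_mem fun j (_ : j ∈ Finset.univ) => sumTensor_mem_sumOp hT
        fun i => d.ι (Function.update p j (d.wz (p j)) i)
      rw [← prod_mk_sum, ← h1] at h2
      exact h2
    · have h1 : sumTensor d.e (d.e ∘ₗ d.b) (fun i => d.ι (p i)) =
          ∑ j, tensor fun i =>
            d.e (Function.update (fun i => d.ι (p i)) j (d.b (d.ι (p j))) i) := by
        refine Finset.sum_congr rfl fun j _ => congrArg tensor (funext fun i => ?_)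
        rcases eq_or_ne i j with rfl | hij
        · simp
        · simp [Function.update_of_ne hij]
      have h2 := (sumOp β n).sum_mem fun j (_ : j ∈ Finset.univ) => sumTensor_mem_sumOp hβ
        (Function.update (fun i => d.ι (p i)) j (d.b (d.ι (p j))))
      rw [← prod_mk_sum, ← h1] at h2
      exact h2
  | zero => exact ⟨⟨zero_mem _, zero_mem _⟩, zero_mem _, zero_mem _⟩
  | add x y _ _ hx hy =>
    exact ⟨⟨add_mem hx.1.1 hy.1.1, add_mem hx.1.2 hy.1.2⟩, add_mem hx.2.1 hy.2.1,
      add_mem hx.2.2 hy.2.2⟩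
  | smul c x _ hx =>
    exact ⟨⟨Submodule.smul_mem _ c hx.1.1, Submodule.smul_mem _ c hx.1.2⟩,
      Submodule.smul_mem _ c hx.2.1, Submodule.smul_mem _ c hx.2.2⟩

end CommutatorData

end FockSpace

end

noncomputable section

namespace FockSpace

open Filter Topology

local notation "⟪" x ", " y "⟫" => inner ℂ x y

/-! ### Surjectivity of `1 + X²` on the closed joint graph -/

namespace CommutatorData

variable {S Z : Type*} [AddCommGroup S] [Module ℂ S] [AddCommGroup Z] [Module ℂ Z]
variable (d : CommutatorData S Z)

/-- The part of the algebraic graph over the tensor power of a subspace. -/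
def graphOn (n : ℕ) (Y : Submodule ℂ Z) :
    Submodule ℂ (NPhoton n × NPhoton n × NPhoton n × NPhoton n × NPhoton n) :=
  Submodule.span ℂ (d.values n '' {p | ∀ i, p i ∈ Y})

theorem graphOn_le (n : ℕ) (Y : Submodule ℂ Z) : d.graphOn n Y ≤ d.graph n :=
  Submodule.span_mono (Set.image_subset_range _ _)

/-- The comparison theorem with `m · 1` in place of `w` as the larger operator: `dΓ(1) = n` on `n`
photons, hence `X` is bounded by `m n` on the tensor power of `Y`. -/
theorem norm_le_of_mem_graphOn {n : ℕ} {Y : Submodule ℂ Z} {m : ℝ} (hm : 0 ≤ m)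
    (hY : ∀ z ∈ Y, d.wz z ∈ Y) (hbound : ∀ z ∈ Y, ‖d.w (d.ι z)‖ ≤ m * ‖d.e (d.ι z)‖) {x}
    (hx : x ∈ d.graphOn n Y) :
    ‖x.2.1‖ ≤ m * (n * ‖x.1‖) ∧ ‖x.2.2.1‖ ≤ m * (n * ‖x.2.1‖) := by
  obtain ⟨N, c, g, rfl⟩ := Submodule.mem_span_set'.1 hx
  choose p hpY hp using fun α => (g α).2
  simp only [← hp]
  simp only [values, Prod.smul_mk, Prod.fst_sum, Prod.snd_sum]
  have hpY' : ∀ α i, p α i ∈ Y := fun α i => by simpa using hpY α i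
  have hT : ∀ {κ : Type} [Fintype κ] (c : κ → ℂ) (q : κ → Fin n → Y),
      ‖∑ α, c α • sumTensor d.e d.w fun i => d.ι (q α i)‖ ≤
        m * (n * ‖∑ α, c α • tensor fun i => d.e (d.ι (q α i))‖) := by
    intro κ _ c q
    have h := norm_sum_smul_sumTensor_le_mul (n := n) (d.e ∘ₗ d.ι ∘ₗ Y.subtype)
      (d.w ∘ₗ d.ι ∘ₗ Y.subtype) (d.e ∘ₗ d.ι ∘ₗ Y.subtype) (fun x y => d.w_symm _ _)
      (fun x y => rfl) m hm (fun x => hbound x x.2)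
      -- For comparison with a multiple of the identity, Cauchy-Schwarz turns the norm bound
      -- directly into the form bound.
      (fun x => by
        refine (Complex.abs_re_le_norm _).trans ((norm_inner_le_norm _ _).trans ?_)
        have h1 : (⟪d.e (d.ι x), d.e (d.ι x)⟫).re = ‖d.e (d.ι x)‖ ^ 2 :=
          inner_self_eq_norm_sq (𝕜 := ℂ) _
        simp only [LinearMap.comp_apply, Submodule.subtype_apply, h1]
        nlinarith [hbound x x.2, norm_nonneg (d.e (d.ι x))]) c q
    simp only [sumTensor_self] at h
    simp_rw [smul_comm _ (n : ℂ), ← Finset.smul_sum, norm_smul, Complex.norm_natCast] at h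
    exact h
  refine ⟨hT c fun α i => ⟨p α i, hpY' α i⟩, ?_⟩
  have h2 := hT (fun α : Fin N × Fin n => c α.1)
    (fun α i => ⟨Function.update (p α.1) α.2 (d.wz (p α.1 α.2)) i, by
      rcases eq_or_ne i α.2 with h | h
      · rw [h, Function.update_self]
        exact hY _ (hpY' _ _)
      · rw [Function.update_of_ne h]
        exact hpY' _ _⟩)
  simp only [Fintype.sum_prod_type, ← Finset.smul_sum] at h2
  simp only [← d.sumTensor_w_eq] at h2
  exact h2

theorem fst_mem_of_mem_graphOn {n : ℕ} {Y : Submodule ℂ Z} (hY : ∀ z ∈ Y, d.wz z ∈ Y) {x}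
    (hx : x ∈ d.graphOn n Y) :
    x.2.2.1 ∈ (d.graphOn n Y).map (LinearMap.fst ℂ _ _) := by
  have hupd : ∀ (p : Fin n → Z), (∀ i, p i ∈ Y) → ∀ j i, Function.update p j (d.wz (p j)) i ∈ Y := by
    intro p hp j i
    rcases eq_or_ne i j with h | h
    · rw [h, Function.update_self]
      exact hY _ (hp _)
    · rw [Function.update_of_ne h]
      exact hp _
  induction hx using Submodule.span_induction with
  | mem x hx =>
    obtain ⟨p, hp, rfl⟩ := hx
    have hp' : ∀ i, p i ∈ Y := fun i => by simpa using hp i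
    simp only [values, d.sumTensor_w_eq]
    refine Submodule.sum_mem _ fun j _ => Submodule.sum_mem _ fun k _ => ?_
    refine ⟨_, Submodule.subset_span ⟨_, ?_, rfl⟩, rfl⟩
    rw [Set.mem_ofPred_eq]
    exact hupd _ (hupd p hp' j) k
  | zero => exact zero_mem _
  | add x y _ _ hx hy => exact add_mem hx hy
  | smul c x _ hx => exact Submodule.smul_mem _ c hx

/-- `(1 + X²)` applied to the first component. -/
def oneAddSq (n : ℕ) :
    NPhoton n × NPhoton n × NPhoton n × NPhoton n × NPhoton n →L[ℂ] NPhoton n :=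
  ContinuousLinearMap.fst ℂ _ _ + ContinuousLinearMap.fst ℂ _ _ ∘L ContinuousLinearMap.snd ℂ _ _ ∘L
    ContinuousLinearMap.snd ℂ _ _

theorem oneAddSq_apply {n : ℕ}
    (x : NPhoton n × NPhoton n × NPhoton n × NPhoton n × NPhoton n) :
    oneAddSq n x = x.1 + x.2.2.1 := rfl

variable {T β : Submodule ℂ (OnePhoton × OnePhoton)}

/-- A Lax-Milgram argument. On the algebraic tensor power `V` of `Y` the operator `1 + X²` is
bounded, maps into `V`, and its form dominates `‖·‖²`. So no nonzero vector of the closure of `V` is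
orthogonal to its range. -/
theorem tensor_mem_closure (hT : ∀ x, (d.e x, d.w x) ∈ T) (hβ : ∀ x, (d.e x, d.e (d.b x)) ∈ β)
    (hsymm : IsSymm T) {n : ℕ} (p : Fin n → Z) :
    (tensor fun i => d.e (d.ι (p i))) ∈
      ((d.graph n).map (oneAddSq n).toLinearMap).topologicalClosure := by
  obtain ⟨Y, m, hm, hpY, hY, hbound⟩ := d.exists_bounded n p
  set W := (d.graphOn n Y).map (oneAddSq n).toLinearMap with hW
  set V := (d.graphOn n Y).map (LinearMap.fst ℂ (NPhoton n)
    (NPhoton n × NPhoton n × NPhoton n × NPhoton n)) with hV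
  have hWV : W ≤ V := by
    rintro _ ⟨x, hx, rfl⟩
    exact add_mem ⟨x, hx, rfl⟩ (d.fst_mem_of_mem_graphOn hY hx)
  have hWg : W ≤ (d.graph n).map (oneAddSq n).toLinearMap :=
    Submodule.map_mono (d.graphOn_le n Y)
  refine Submodule.topologicalClosure_mono hWg ?_
  have : CompleteSpace W.topologicalClosure :=
    (Submodule.isClosed_topologicalClosure W).completeSpace_coe
  set v := tensor fun i => d.e (d.ι (p i)) with hv
  have hvV : v ∈ V := ⟨_, Submodule.subset_span ⟨p, by rw [Set.mem_ofPred_eq]; exact hpY, rfl⟩, rfl⟩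
  -- `Q` is the part of the tensor orthogonal to the range. It stays in the closure of `V` because
  -- the range is contained in `V`.
  obtain ⟨P, hP, Q, hQ, hPQ⟩ := W.topologicalClosure.exists_add_mem_mem_orthogonal v
  have hQV : Q ∈ V.topologicalClosure := by
    have : Q = v - P := by rw [hPQ]; abel
    rw [this]
    exact sub_mem (V.le_topologicalClosure hvV) (Submodule.topologicalClosure_mono hWV hP)
  have hzero : ∀ y ∈ W, ⟪Q, y⟫ = 0 := fun y hy =>
    Submodule.inner_left_of_mem_orthogonal (W.le_topologicalClosure hy) hQ
  set K : ℝ := 1 + m * (n * (m * n)) with hK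
  -- `‖u‖² ≤ Re ⟨u, (1 + X²) u⟩ = Re ⟨u - Q, (1 + X²) u⟩ ≤ K ‖u - Q‖ ‖u‖`. This condition is closed
  -- in `u`, so it may be applied to `u = Q`.
  have key : ∀ u ∈ V, ‖u‖ ≤ K * ‖u - Q‖ := by
    rintro _ ⟨x, hx, rfl⟩
    change ‖x.1‖ ≤ K * ‖x.1 - Q‖
    obtain ⟨⟨h1, h2⟩, -⟩ := d.mem_sumOp_of_mem_graph hT hβ (d.graphOn_le n Y hx)
    have h3 := (isSymm_sumOp hsymm n).re_inner_add h1 h2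
    have h4 := hzero _ (show x.1 + x.2.2.1 ∈ W from ⟨x, hx, rfl⟩)
    have h5 : ⟪x.1, x.1 + x.2.2.1⟫ = ⟪x.1 - Q, x.1 + x.2.2.1⟫ := by
      rw [inner_sub_left, h4, sub_zero]
    obtain ⟨h6, h7⟩ := d.norm_le_of_mem_graphOn hm hY hbound hx
    have h8 : ‖x.1 + x.2.2.1‖ ≤ K * ‖x.1‖ := by
      refine (norm_add_le _ _).trans ?_
      have : m * (n * ‖x.2.1‖) ≤ m * (n * (m * (n * ‖x.1‖))) := by gcongr
      rw [hK]
      linarith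
    have h9 : (⟪x.1 - Q, x.1 + x.2.2.1⟫).re ≤ ‖x.1 - Q‖ * (K * ‖x.1‖) :=
      (Complex.re_le_norm _).trans ((norm_inner_le_norm _ _).trans (by gcongr))
    rw [← h5, h3] at h9
    rcases (norm_nonneg x.1).eq_or_lt with h0 | h0
    · rw [← h0]; positivity
    · refine le_of_mul_le_mul_right ?_ h0
      nlinarith [sq_nonneg ‖x.2.1‖]
  have hQ0 : Q = 0 := by
    have h1 : ‖Q‖ ≤ K * ‖Q - Q‖ :=
      closure_minimal (t := {u | ‖u‖ ≤ K * ‖u - Q‖})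
        (fun u hu => by rw [Set.mem_ofPred_eq]; exact key u hu)
        (isClosed_le (by fun_prop) (by fun_prop)) hQV
    simpa using h1
  rw [hPQ, hQ0, add_zero]
  exact hP

/-- The closure of the algebraic graph inherits the estimates, and `1 + X²` maps onto. -/
theorem exists_of_mem (hT : ∀ x, (d.e x, d.w x) ∈ T) (hβ : ∀ x, (d.e x, d.e (d.b x)) ∈ β)
    (hsymm : IsSymm T) {n : ℕ} (Φ : NPhoton n) :
    ∃ y y₁ y₂ v₁ v₂ : NPhoton n, y + y₂ = Φ ∧ (y, y₁) ∈ sumOp T n ∧ (y₁, y₂) ∈ sumOp T n ∧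
      (y, v₁) ∈ sumOp β n ∧ (v₁, v₂) ∈ sumOp β n ∧ ‖v₁‖ ≤ d.C₁ * ‖y₁‖ ∧
      ‖v₂‖ ≤ d.C₁ * (d.C₁ * ‖y₂‖ + d.C₂ * ‖y₁‖) := by
  set G := (d.graph n).topologicalClosure with hG
  -- Membership in the closed graphs and the norm estimates are closed conditions, so they extend
  -- from the algebraic graph to its closure.
  have hclosed : ∀ {P : NPhoton n × NPhoton n × NPhoton n × NPhoton n × NPhoton n → Prop},
      IsClosed {x | P x} → (∀ x ∈ d.graph n, P x) → ∀ x ∈ G, P x := by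
    intro P hP h x hx
    exact closure_minimal (t := {x | P x}) (fun x hx => by rw [Set.mem_ofPred_eq]; exact h x hx) hP hx
  have h1 : ∀ x ∈ G, (x.1, x.2.1) ∈ sumOp T n :=
    hclosed ((isClosed_sumOp T n).preimage (f := fun x :
        NPhoton n × NPhoton n × NPhoton n × NPhoton n × NPhoton n => (x.1, x.2.1)) (by fun_prop))
      fun x hx => (d.mem_sumOp_of_mem_graph hT hβ hx).1.1
  have h2 : ∀ x ∈ G, (x.2.1, x.2.2.1) ∈ sumOp T n :=
    hclosed ((isClosed_sumOp T n).preimage (f := fun x :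
        NPhoton n × NPhoton n × NPhoton n × NPhoton n × NPhoton n => (x.2.1, x.2.2.1))
        (by fun_prop))
      fun x hx => (d.mem_sumOp_of_mem_graph hT hβ hx).1.2
  have h3 : ∀ x ∈ G, (x.1, x.2.2.2.1) ∈ sumOp β n :=
    hclosed ((isClosed_sumOp β n).preimage (f := fun x :
        NPhoton n × NPhoton n × NPhoton n × NPhoton n × NPhoton n => (x.1, x.2.2.2.1))
        (by fun_prop))
      fun x hx => (d.mem_sumOp_of_mem_graph hT hβ hx).2.1
  have h4 : ∀ x ∈ G, (x.2.2.2.1, x.2.2.2.2) ∈ sumOp β n :=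
    hclosed ((isClosed_sumOp β n).preimage (f := fun x :
        NPhoton n × NPhoton n × NPhoton n × NPhoton n × NPhoton n => (x.2.2.2.1, x.2.2.2.2))
        (by fun_prop))
      fun x hx => (d.mem_sumOp_of_mem_graph hT hβ hx).2.2
  have h5 : ∀ x ∈ G, ‖x.2.2.2.1‖ ≤ d.C₁ * ‖x.2.1‖ :=
    hclosed (isClosed_le (by fun_prop) (by fun_prop)) fun x hx => (d.norm_le_of_mem_graph hx).1
  have h6 : ∀ x ∈ G, ‖x.2.2.2.2‖ ≤ d.C₁ * (d.C₁ * ‖x.2.2.1‖ + d.C₂ * ‖x.2.1‖) :=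
    hclosed (isClosed_le (by fun_prop) (by fun_prop)) fun x hx => (d.norm_le_of_mem_graph hx).2
  have hC₁ := d.C₁_nonneg
  have hC₂ := d.C₂_nonneg
  set K : ℝ := 1 + d.C₁ + d.C₁ * (d.C₁ + d.C₂) with hK
  -- All five components are controlled by `(1 + X²) y`. Hence `oneAddSq` is antilipschitz on the
  -- complete space `G` and its range is closed. The range is also dense, so it is everything.
  have hbound : ∀ x ∈ G, ‖x‖ ≤ K * ‖oneAddSq n x‖ := by
    intro x hx
    have h := (isSymm_sumOp hsymm n).norm_add_sq (h1 x hx) (h2 x hx)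
    rw [oneAddSq_apply]
    set s := ‖x.1 + x.2.2.1‖ with hs
    have hs0 : 0 ≤ s := norm_nonneg _
    have b0 : ‖x.1‖ ≤ s := le_of_sq_le_sq (by nlinarith [sq_nonneg ‖x.2.1‖, sq_nonneg ‖x.2.2.1‖]) hs0
    have b1 : ‖x.2.1‖ ≤ s := le_of_sq_le_sq (by nlinarith [sq_nonneg ‖x.1‖, sq_nonneg ‖x.2.2.1‖, sq_nonneg ‖x.2.1‖]) hs0
    have b2 : ‖x.2.2.1‖ ≤ s := le_of_sq_le_sq (by nlinarith [sq_nonneg ‖x.2.1‖, sq_nonneg ‖x.1‖]) hs0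
    have b3 : ‖x.2.2.2.1‖ ≤ d.C₁ * s := (h5 x hx).trans (by gcongr)
    have b4 : ‖x.2.2.2.2‖ ≤ d.C₁ * (d.C₁ * s + d.C₂ * s) := (h6 x hx).trans (by gcongr)
    have c1 : 0 ≤ d.C₁ * s := by positivity
    have c2 : 0 ≤ d.C₁ * (d.C₁ * s + d.C₂ * s) := by positivity
    have hKs : K * s = s + d.C₁ * s + d.C₁ * (d.C₁ * s + d.C₂ * s) := by rw [hK]; ring
    rw [hKs]
    simp only [Prod.norm_def, sup_le_iff]
    refine ⟨?_, ?_, ?_, ?_, ?_⟩ <;> linarith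
  have hGc := Submodule.isClosed_topologicalClosure (d.graph n)
  have hcomplete : IsComplete (G.map (oneAddSq n).toLinearMap : Set (NPhoton n)) := by
    have : CompleteSpace G := hGc.completeSpace_coe
    have hanti : AntilipschitzWith (Real.toNNReal K) fun x : G => oneAddSq n x := by
      refine AddMonoidHomClass.antilipschitz_of_bound
        ((oneAddSq n).toLinearMap ∘ₗ G.subtype) fun x => ?_
      rw [Real.coe_toNNReal _ (by positivity)]
      exact hbound x x.2
    have hr := hanti.isComplete_range ((oneAddSq n).uniformContinuous.comp uniformContinuous_subtype_val)
    have hset : (G.map (oneAddSq n).toLinearMap : Set (NPhoton n)) =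
        Set.range fun x : G => oneAddSq n x := by
      rw [Submodule.map_coe, Set.image_eq_range]
      rfl
    rw [hset]
    exact hr
  have hall : ∀ y, y ∈ G.map (oneAddSq n).toLinearMap := by
    intro y
    refine hcomplete.isClosed.closure_subset_iff.2 le_rfl ?_
    have hle : Submodule.span ℂ (Set.range fun p : Fin n → Z => tensor fun i => d.e (d.ι (p i))) ≤
        (G.map (oneAddSq n).toLinearMap).topologicalClosure := by
      refine Submodule.span_le.2 ?_
      rintro _ ⟨p, rfl⟩
      exact Submodule.topologicalClosure_mono (Submodule.map_mono (d.graph n).le_topologicalClosure)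
        (d.tensor_mem_closure hT hβ hsymm p)
    have := closure_mono (s := (Submodule.span ℂ (Set.range fun p : Fin n → Z =>
      tensor fun i => d.e (d.ι (p i))) : Set (NPhoton n))) hle
    rw [Submodule.topologicalClosure_coe, closure_closure] at this
    exact this (dense_span_tensor (fun z => d.e (d.ι z)) d.dense y)
  obtain ⟨x, hx, hxy⟩ := hall Φ
  exact ⟨x.1, x.2.1, x.2.2.1, x.2.2.2.1, x.2.2.2.2, hxy, h1 x hx, h2 x hx, h3 x hx, h4 x hx,
    h5 x hx, h6 x hx⟩

end CommutatorData

end FockSpace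

end

noncomputable section

namespace FockSpace

open Filter Topology

local notation "⟪" x ", " y "⟫" => inner ℂ x y

/-! ### Permutations of the photons -/

/-- The action of a permutation on `n`-photon states. -/
def permute {n : ℕ} (π : Equiv.Perm (Fin n)) : NPhoton n →ₗᵢ[ℂ] NPhoton n :=
  Lp.compMeasurePreservingₗᵢ ℂ (fun k : Fin n → Mode => k ∘ π) (measurePreserving_perm π)

theorem mem_symSector {n : ℕ} {Φ : NPhoton n} : Φ ∈ symSector n ↔ ∀ π, permute π Φ = Φ := Iff.rfl

theorem permute_tensor {n : ℕ} (π : Equiv.Perm (Fin n)) (f : Fin n → OnePhoton) :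
    permute π (tensor f) = tensor (f ∘ π.symm) := by
  refine Lp.ext ?_
  have h1 : permute π (tensor f) =ᵐ[configMeasure n] tensor f ∘ fun k => k ∘ π :=
    Lp.coeFn_compMeasurePreserving _ (measurePreserving_perm π)
  have h2 := (measurePreserving_perm π).quasiMeasurePreserving.ae (coeFn_tensor f)
  filter_upwards [h1, h2, coeFn_tensor (f ∘ π.symm)] with k h1 h2 h3
  rw [h1, h3, Function.comp_apply, h2]
  conv_rhs => rw [← Equiv.prod_comp π]
  simp

/-- Permuting the factors of an elementary tensor only relabels the summation index `j`. -/
theorem permute_mem_sumOp (a : Submodule ℂ (OnePhoton × OnePhoton)) {n : ℕ}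
    (π : Equiv.Perm (Fin n)) {x y : NPhoton n} (h : (x, y) ∈ sumOp a n) :
    (permute π x, permute π y) ∈ sumOp a n := by
  have hle : sumOp a n ≤ (sumOp a n).comap
      ((permute π).toLinearMap.prodMap (permute π).toLinearMap) := by
    refine Submodule.topologicalClosure_minimal _ (Submodule.span_le.2 ?_) ?_
    · rintro _ ⟨f, g, hfg, rfl⟩
      refine Submodule.le_topologicalClosure _ (Submodule.subset_span
        ⟨f ∘ π.symm, g ∘ π.symm, fun i => hfg _, ?_⟩)
      simp only [LinearMap.prodMap_apply, map_sum, LinearIsometry.coe_toLinearMap, permute_tensor]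
      congr 1
      conv_rhs => rw [← Equiv.sum_comp π]
      refine Finset.sum_congr rfl fun j _ => ?_
      congr 1
      ext1 i
      rcases eq_or_ne i (π j) with rfl | hij
      · simp
      · have : π.symm i ≠ j := fun h => hij (by rw [← h, Equiv.apply_symm_apply])
        simp [Function.update_of_ne hij, Function.update_of_ne this]
    · refine (isClosed_sumOp a n).preimage ?_
      exact ((permute π).continuous.comp continuous_fst).prodMk
        ((permute π).continuous.comp continuous_snd)
  exact hle h

/-! ### The Fock space estimate -/

/-- `1 + T²` is injective: apply `IsSymm.norm_add_sq` to the difference of the two triples. -/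
theorem IsSymm.eq_of_add_eq {H : Type*} [NormedAddCommGroup H] [InnerProductSpace ℂ H]
    {T : Submodule ℂ (H × H)} (hT : IsSymm T) {x y z x' y' z' : H} (h₁ : (x, y) ∈ T)
    (h₂ : (y, z) ∈ T) (h₁' : (x', y') ∈ T) (h₂' : (y', z') ∈ T) (h : x + z = x' + z') :
    x = x' ∧ y = y' ∧ z = z' := by
  have h3 := hT.norm_add_sq (T.sub_mem h₁ h₁') (T.sub_mem h₂ h₂')
  have h4 : x - x' + (z - z') = 0 := by rw [← add_sub_add_comm, h, sub_self]
  simp only [h4, norm_zero] at h3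
  have e1 : ‖x - x'‖ = 0 := by
    nlinarith [sq_nonneg ‖x - x'‖, sq_nonneg ‖y - y'‖, sq_nonneg ‖z - z'‖]
  have e2 : ‖y - y'‖ = 0 := by
    nlinarith [sq_nonneg ‖x - x'‖, sq_nonneg ‖y - y'‖, sq_nonneg ‖z - z'‖]
  have e3 : ‖z - z'‖ = 0 := by
    nlinarith [sq_nonneg ‖x - x'‖, sq_nonneg ‖y - y'‖, sq_nonneg ‖z - z'‖]
  exact ⟨sub_eq_zero.1 (norm_eq_zero.1 e1), sub_eq_zero.1 (norm_eq_zero.1 e2),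
    sub_eq_zero.1 (norm_eq_zero.1 e3)⟩

theorem exists_fock_of_norm_le (Φ : Fock) (C : ℝ) (hC : 0 ≤ C) (f : ∀ n, symSector n)
    (hf : ∀ n, ‖f n‖ ≤ C * ‖Φ n‖) : ∃ Ψ : Fock, (∀ n, Ψ n = f n) ∧ ‖Ψ‖ ≤ C * ‖Φ‖ := by
  have hΦ := (memℓp_gen_iff (by norm_num : 0 < (2 : ENNReal).toReal)).1 (lp.memℓp Φ)
  have hle : ∀ n, ‖f n‖ ^ (2 : ENNReal).toReal ≤
      C ^ (2 : ENNReal).toReal * ‖Φ n‖ ^ (2 : ENNReal).toReal := fun n => by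
    rw [← Real.mul_rpow hC (norm_nonneg _)]
    exact Real.rpow_le_rpow (norm_nonneg _) (hf n) (by norm_num)
  have hs : Memℓp f 2 := memℓp_gen (Summable.of_nonneg_of_le
    (fun n => Real.rpow_nonneg (norm_nonneg _) _) hle (hΦ.mul_left _))
  refine ⟨⟨f, hs⟩, fun n => rfl, ?_⟩
  refine lp.norm_le_of_tsum_le (by norm_num) (by positivity) ?_
  rw [Real.mul_rpow hC (norm_nonneg _), lp.norm_rpow_eq_tsum (by norm_num), ← tsum_mul_left]
  exact Summable.tsum_le_tsum hle ((memℓp_gen_iff (by norm_num)).1 hs) (hΦ.mul_left _)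

namespace CommutatorData

variable {S Z : Type*} [AddCommGroup S] [Module ℂ S] [AddCommGroup Z] [Module ℂ Z]
variable (d : CommutatorData S Z) {T β : Submodule ℂ (OnePhoton × OnePhoton)}

theorem denseRange_e : DenseRange d.e :=
  d.dense.mono (by rintro _ ⟨z, rfl⟩; exact ⟨d.ι z, rfl⟩)

/-- The solution on the full `n`-photon space is invariant under permutations because a permuted
solution solves the same equation and solutions are unique. Single-valuedness of `sumOp β n` carries
the invariance over to `B y` and `B² y`. -/
theorem sector_exists (hT : ∀ x, (d.e x, d.w x) ∈ T) (hβ : ∀ x, (d.e x, d.e (d.b x)) ∈ β)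
    (hTs : IsSymm T) (hβs : IsSymm β) {n : ℕ} (Φ : symSector n) :
    ∃ y y₁ y₂ v₁ v₂ : symSector n, y + y₂ = Φ ∧ ((y : NPhoton n), (y₁ : NPhoton n)) ∈ sumOp T n ∧
      ((y₁ : NPhoton n), (y₂ : NPhoton n)) ∈ sumOp T n ∧
      ((y : NPhoton n), (v₁ : NPhoton n)) ∈ sumOp β n ∧
      ((v₁ : NPhoton n), (v₂ : NPhoton n)) ∈ sumOp β n ∧
      ‖y‖ ≤ 1 * ‖Φ‖ ∧ ‖y₁‖ ≤ 1 * ‖Φ‖ ∧ ‖y₂‖ ≤ 1 * ‖Φ‖ ∧ ‖v₁‖ ≤ d.C₁ * ‖Φ‖ ∧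
      ‖v₂‖ ≤ d.C₁ * (d.C₁ + d.C₂) * ‖Φ‖ := by
  obtain ⟨y, y₁, y₂, v₁, v₂, hadd, h1, h2, h3, h4, h5, h6⟩ := d.exists_of_mem hT hβ hTs (Φ : NPhoton n)
  have hsym : ∀ π, permute π y = y ∧ permute π y₁ = y₁ ∧ permute π y₂ = y₂ := by
    intro π
    refine (isSymm_sumOp hTs n).eq_of_add_eq (permute_mem_sumOp T π h1) (permute_mem_sumOp T π h2)
      h1 h2 ?_
    rw [← map_add, hadd]
    exact mem_symSector.1 Φ.2 π
  have hβu : ∀ {x z z' : NPhoton n}, (x, z) ∈ sumOp β n → (x, z') ∈ sumOp β n → z = z' :=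
    fun h h' => (isSymm_sumOp hβs n).eq_of_mem (dense_dom_sumOp hβ d.denseRange_e n) h h'
  have hv₁ : ∀ π, permute π v₁ = v₁ := fun π => by
    have := permute_mem_sumOp β π h3
    rw [(hsym π).1] at this
    exact hβu this h3
  have hv₂ : ∀ π, permute π v₂ = v₂ := fun π => by
    have := permute_mem_sumOp β π h4
    rw [hv₁] at this
    exact hβu this h4
  have hC₁ := d.C₁_nonneg
  have hC₂ := d.C₂_nonneg
  have hn := (isSymm_sumOp hTs n).norm_add_sq h1 h2
  rw [hadd] at hn
  set s := ‖(Φ : NPhoton n)‖ with hs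
  have hs0 : 0 ≤ s := norm_nonneg _
  have b0 : ‖y‖ ≤ s := le_of_sq_le_sq (by nlinarith [sq_nonneg ‖y₁‖, sq_nonneg ‖y₂‖]) hs0
  have b1 : ‖y₁‖ ≤ s :=
    le_of_sq_le_sq (by nlinarith [sq_nonneg ‖y‖, sq_nonneg ‖y₂‖, sq_nonneg ‖y₁‖]) hs0
  have b2 : ‖y₂‖ ≤ s := le_of_sq_le_sq (by nlinarith [sq_nonneg ‖y₁‖, sq_nonneg ‖y‖]) hs0
  refine ⟨⟨y, mem_symSector.2 fun π => (hsym π).1⟩, ⟨y₁, mem_symSector.2 fun π => (hsym π).2.1⟩,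
    ⟨y₂, mem_symSector.2 fun π => (hsym π).2.2⟩, ⟨v₁, mem_symSector.2 hv₁⟩,
    ⟨v₂, mem_symSector.2 hv₂⟩, Subtype.ext hadd, h1, h2, h3, h4, ?_, ?_, ?_, ?_, ?_⟩
  · rw [one_mul]; exact b0
  · rw [one_mul]; exact b1
  · rw [one_mul]; exact b2
  · exact h5.trans (by gcongr; exact b1)
  · refine h6.trans ?_
    rw [mul_assoc, add_mul]
    gcongr
    · exact b2
    · exact b1

theorem fock_exists (hT : ∀ x, (d.e x, d.w x) ∈ T) (hβ : ∀ x, (d.e x, d.e (d.b x)) ∈ β)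
    (hTs : IsSymm T) (hβs : IsSymm β) (Φ : Fock) :
    ∃ y y₁ y₂ v₁ v₂ : Fock, y + y₂ = Φ ∧ (y, y₁) ∈ dGamma T ∧ (y₁, y₂) ∈ dGamma T ∧
      (y, v₁) ∈ dGamma β ∧ (v₁, v₂) ∈ dGamma β ∧ ‖v₂‖ ≤ d.C₁ * (d.C₁ + d.C₂) * ‖Φ‖ := by
  have hC₁ := d.C₁_nonneg
  have hC₂ := d.C₂_nonneg
  choose y y₁ y₂ v₁ v₂ hadd h1 h2 h3 h4 b0 b1 b2 b3 b4 using
    fun n => d.sector_exists hT hβ hTs hβs (Φ n)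
  obtain ⟨y', hy, -⟩ := exists_fock_of_norm_le Φ 1 zero_le_one y b0
  obtain ⟨y₁', hy₁, -⟩ := exists_fock_of_norm_le Φ 1 zero_le_one y₁ b1
  obtain ⟨y₂', hy₂, -⟩ := exists_fock_of_norm_le Φ 1 zero_le_one y₂ b2
  obtain ⟨v₁', hv₁, -⟩ := exists_fock_of_norm_le Φ _ hC₁ v₁ b3
  obtain ⟨v₂', hv₂, hb⟩ := exists_fock_of_norm_le Φ _ (by positivity) v₂ b4
  refine ⟨y', y₁', y₂', v₁', v₂', ?_, fun n => ?_, fun n => ?_, fun n => ?_, fun n => ?_, hb⟩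
  · refine lp.ext (funext fun n => ?_)
    rw [lp.coeFn_add, Pi.add_apply, hy, hy₂, hadd]
  · simp only [hy, hy₁]; exact h1 n
  · simp only [hy₁, hy₂]; exact h2 n
  · simp only [hy, hv₁]; exact h3 n
  · simp only [hv₁, hv₂]; exact h4 n

/-- Any `x` in `D(X²)` is the unique solution for the datum `x + X² x`, so it coincides with the one
constructed in `fock_exists`. Single-valuedness of `dGamma β` identifies its images. -/
theorem fock_estimate (hT : ∀ x, (d.e x, d.w x) ∈ T) (hβ : ∀ x, (d.e x, d.e (d.b x)) ∈ β)
    (hTs : IsSymm T) (hβs : IsSymm β) :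
    dom (sq (dGamma T)) ≤ dom (sq (dGamma β)) ∧
      (∀ Φ : Fock, ∃ Ψ : Fock, (Φ, Ψ) ∈ comp (sq (dGamma β)) (bracketInvSq (dGamma T))) ∧
      ∀ Φ Ψ : Fock, (Φ, Ψ) ∈ comp (sq (dGamma β)) (bracketInvSq (dGamma T)) →
        ‖Ψ‖ ≤ d.C₁ * (d.C₁ + d.C₂) * ‖Φ‖ := by
  have hTu : ∀ {x y z x' y' z' : Fock}, (x, y) ∈ dGamma T → (y, z) ∈ dGamma T →
      (x', y') ∈ dGamma T → (y', z') ∈ dGamma T → x + z = x' + z' → x = x' := by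
    intro x y z x' y' z' h1 h2 h1' h2' h
    refine lp.ext (funext fun n => Subtype.ext ?_)
    refine ((isSymm_sumOp hTs n).eq_of_add_eq (h1 n) (h2 n) (h1' n) (h2' n) ?_).1
    have := congrArg (fun x : Fock => (x n : NPhoton n)) h
    simpa using this
  have hβu : ∀ {x z z' : Fock}, (x, z) ∈ dGamma β → (x, z') ∈ dGamma β → z = z' := by
    intro x z z' h h'
    refine lp.ext (funext fun n => Subtype.ext ?_)
    exact (isSymm_sumOp hβs n).eq_of_mem (dense_dom_sumOp hβ d.denseRange_e n) (h n) (h' n)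
  refine ⟨?_, fun Φ => ?_, ?_⟩
  · rintro _ ⟨⟨x, z⟩, ⟨x₁, h1, h2⟩, rfl⟩
    obtain ⟨y, y₁, y₂, v₁, v₂, hadd, g1, g2, g3, g4, -⟩ := d.fock_exists hT hβ hTs hβs (x + z)
    have hxy : y = x := hTu g1 g2 h1 h2 hadd
    subst hxy
    exact ⟨(y, v₂), ⟨v₁, g3, g4⟩, rfl⟩
  · obtain ⟨y, y₁, y₂, v₁, v₂, hadd, g1, g2, g3, g4, -⟩ := d.fock_exists hT hβ hTs hβs Φ
    refine ⟨v₂, y, ⟨y₁, g1, ?_⟩, v₁, g3, g4⟩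
    rw [← hadd, add_sub_cancel_left]
    exact g2
  · rintro Φ Ψ ⟨x, ⟨x₁, h1, h2⟩, w₁, h3, h4⟩
    obtain ⟨y, y₁, y₂, v₁, v₂, hadd, g1, g2, g3, g4, hb⟩ := d.fock_exists hT hβ hTs hβs Φ
    have hxy : y = x := hTu g1 g2 h1 h2 (by simp [hadd])
    subst hxy
    have e1 : v₁ = w₁ := hβu g3 h3
    subst e1
    have e2 : v₂ = Ψ := hβu g4 h4
    subst e2
    exact hb

end CommutatorData

end FockSpace

end

noncomputable section

namespace FockSpace

open Filter Topology
open scoped LineDeriv SchwartzMap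

local notation "⟪" x ", " y "⟫" => inner ℂ x y

/-! ### Schwartz functions on momentum space -/

/-- `L²(ℝ³)`. -/
abbrev L2 : Type := Lp ℂ 2 (volume : Measure R3)

/-- Schwartz functions on `ℝ³`. -/
abbrev Schw : Type := 𝓢(R3, ℂ)

/-- The inclusion of Schwartz functions into `L²`. -/
def toL2 : Schw →ₗ[ℂ] L2 := (SchwartzMap.toLpCLM ℂ ℂ 2 (volume : Measure R3)).toLinearMap

theorem coeFn_toL2 (f : Schw) : toL2 f =ᵐ[volume] f := SchwartzMap.coeFn_toLp f 2

theorem denseRange_toL2 : DenseRange toL2 :=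
  SchwartzMap.denseRange_toLpCLM (p := 2) ENNReal.ofNat_ne_top

theorem inner_toL2 (f g : Schw) : ⟪toL2 f, toL2 g⟫ = ∫ x, star (f x) * g x := by
  refine (SchwartzMap.inner_toL2_toL2_eq f g).trans ?_
  simp [mul_comm]

theorem fourier_toL2 (f : Schw) : 𝓕 (toL2 f) = toL2 (𝓕 f) := SchwartzMap.toLp_fourier_eq f

theorem norm_toL2_fourier (f : Schw) : ‖toL2 (𝓕 f)‖ = ‖toL2 f‖ :=
  SchwartzMap.norm_fourier_toL2_eq f

theorem norm_toL2_le_of_le {f g : Schw} {C : ℝ} (h : ∀ x, ‖f x‖ ≤ C * ‖g x‖) :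
    ‖toL2 f‖ ≤ C * ‖toL2 g‖ := by
  refine Lp.norm_le_mul_norm_of_ae_le_mul ?_
  filter_upwards [coeFn_toL2 f, coeFn_toL2 g] with x hf hg
  rw [hf, hg]
  exact h x

/-- Multiplication of a Schwartz function by a function of temperate growth. -/
abbrev mulS (v : R3 → ℂ) : Schw →L[ℂ] Schw := SchwartzMap.smulLeftCLM ℂ v

theorem mulS_apply {v : R3 → ℂ} (hv : v.HasTemperateGrowth) (f : Schw) (x : R3) :
    mulS v f x = v x * f x := SchwartzMap.smulLeftCLM_apply_apply hv f x

theorem inner_mulS {v : R3 → ℂ} (hv : v.HasTemperateGrowth) (hreal : ∀ x, star (v x) = v x)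
    (f g : Schw) : ⟪toL2 (mulS v f), toL2 g⟫ = ⟪toL2 f, toL2 (mulS v g)⟫ := by
  rw [inner_toL2, inner_toL2]
  congr 1
  ext x
  rw [mulS_apply hv, mulS_apply hv, star_mul', hreal]
  ring

theorem norm_mulS_le {v : R3 → ℂ} (hv : v.HasTemperateGrowth) {C : ℝ} (hC : ∀ x, ‖v x‖ ≤ C)
    (f : Schw) : ‖toL2 (mulS v f)‖ ≤ C * ‖toL2 f‖ :=
  norm_toL2_le_of_le fun x => by
    rw [mulS_apply hv, norm_mul]
    exact mul_le_mul_of_nonneg_right (hC x) (norm_nonneg _)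

theorem lineDeriv_mulS {v dv : R3 → ℂ} (hv : v.HasTemperateGrowth) (hdv : dv.HasTemperateGrowth)
    (m : R3) (h : ∀ x, HasLineDerivAt ℝ v (dv x) x m) (f : Schw) :
    ∂_{m} (mulS v f) = mulS dv f + mulS v (∂_{m} f) := by
  ext x
  rw [SchwartzMap.lineDerivOp_apply, add_apply, mulS_apply hdv, mulS_apply hv,
    SchwartzMap.lineDerivOp_apply]
  have hf : HasLineDerivAt ℝ f (lineDeriv ℝ f x m) x m :=
    (f.differentiableAt.hasFDerivAt.hasLineDerivAt m).lineDifferentiableAt.hasLineDerivAt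
  have h2 : HasLineDerivAt ℝ (fun x => v x * f x) (dv x * f x + v x * lineDeriv ℝ f x m) x m := by
    have := HasDerivAt.mul (h x) hf
    simp only [zero_smul, add_zero] at this
    exact this
  have h3 : (mulS v f : R3 → ℂ) = fun x => v x * f x := by
    ext x
    exact mulS_apply hv f x
  rw [h3]
  exact h2.lineDeriv

/-- Integration by parts. -/
theorem inner_lineDeriv (m : R3) (f g : Schw) :
    ⟪toL2 f, toL2 (∂_{m} g)⟫ = -⟪toL2 (∂_{m} f), toL2 g⟫ := by
  rw [inner_toL2, inner_toL2]
  have h := SchwartzMap.integral_bilinear_lineDerivOp_right_eq_neg_left (μ := (volume : Measure R3))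
    f g ((ContinuousLinearMap.mul ℝ ℂ).comp (Complex.conjCLE : ℂ →L[ℝ] ℂ)) m
  simpa using h

/-- The partial derivative of a Schwartz function. -/
def pd (j : Fin 3) : Schw →ₗ[ℂ] Schw where
  toFun f := ∂_{(EuclideanSpace.single j (1 : ℝ) : R3)} f
  map_add' f g := LineDeriv.lineDerivOp_add _ f g
  map_smul' c f := LineDeriv.lineDerivOp_smul _ c f

theorem pd_apply (j : Fin 3) (f : Schw) (x : R3) : pd j f x = partialDeriv j f x := rfl

theorem inner_pd (j : Fin 3) (f g : Schw) : ⟪toL2 f, toL2 (pd j g)⟫ = -⟪toL2 (pd j f), toL2 g⟫ :=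
  inner_lineDeriv _ f g

theorem fourier_pd (j : Fin 3) (f : Schw) (ξ : R3) :
    𝓕 (pd j f) ξ = 2 * Real.pi * Complex.I * (ξ j : ℂ) * 𝓕 f ξ := by
  have h : 𝓕 (pd j f) = _ := SchwartzMap.fourier_lineDerivOp_eq f (EuclideanSpace.single j (1 : ℝ))
  rw [h, smul_apply, SchwartzMap.smulLeftCLM_apply_apply (by fun_prop)]
  simp [EuclideanSpace.inner_single_right]
  ring

/-! ### The operator `|i∇|` -/

/-- The multiplier `2π|ξ|`. -/
def absMul (ξ : R3) : ℂ := ((2 * Real.pi * ‖ξ‖ : ℝ) : ℂ)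

theorem continuous_absMul : Continuous absMul := by unfold absMul; fun_prop

theorem norm_absMul (ξ : R3) : ‖absMul ξ‖ = 2 * Real.pi * ‖ξ‖ := by
  rw [absMul, Complex.norm_real, Real.norm_of_nonneg (by positivity)]

theorem conj_absMul (ξ : R3) : (starRingEnd ℂ) (absMul ξ) = absMul ξ := Complex.conj_ofReal _

/-- The multiplier is not smooth at the origin, so the product need not be a Schwartz function; it
is dominated by one, via `|ξ| ≤ 1 + |ξ|²`. -/
theorem memLp_absMul (f : Schw) : MemLp (fun ξ => absMul ξ * 𝓕 f ξ) 2 (volume : Measure R3) := by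
  have ht : (fun x : R3 => ((1 + ‖x‖ ^ 2 : ℝ) : ℂ)).HasTemperateGrowth :=
    Function.HasTemperateGrowth.comp (f := fun x : R3 => (1 + ‖x‖ ^ 2 : ℝ))
      Function.Complex.hasTemperateGrowth_ofReal (by fun_prop)
  refine ((mulS (fun x => ((1 + ‖x‖ ^ 2 : ℝ) : ℂ)) (𝓕 f)).memLp 2 volume).of_le_mul
    (c := 2 * Real.pi) (continuous_absMul.mul (𝓕 f).continuous).aestronglyMeasurable ?_
  refine Eventually.of_forall fun ξ => ?_
  rw [mulS_apply ht, norm_mul, norm_mul, norm_absMul, Complex.norm_real,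
    Real.norm_of_nonneg (by positivity), ← mul_assoc]
  have : ‖ξ‖ ≤ 1 + ‖ξ‖ ^ 2 := by nlinarith [sq_nonneg (‖ξ‖ - 1)]
  gcongr

/-- The Fourier transform of `|i∇| f`. -/
def absHat : Schw →ₗ[ℂ] L2 where
  toFun f := (memLp_absMul f).toLp
  map_add' f g := by
    rw [← MemLp.toLp_add]
    refine MemLp.toLp_congr _ _ (Eventually.of_forall fun ξ => ?_)
    simp [FourierTransform.fourier_add, mul_add]
  map_smul' c f := by
    rw [RingHom.id_apply, ← MemLp.toLp_const_smul]
    refine MemLp.toLp_congr _ _ (Eventually.of_forall fun ξ => ?_)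
    simp [FourierTransform.fourier_smul, mul_left_comm]

theorem coeFn_absHat (f : Schw) : absHat f =ᵐ[volume] fun ξ => absMul ξ * 𝓕 f ξ :=
  MemLp.coeFn_toLp (memLp_absMul f)

/-- `|i∇|` on Schwartz functions. -/
def absGrad : Schw →ₗ[ℂ] L2 where
  toFun f := 𝓕⁻ (absHat f)
  map_add' f g := by rw [map_add, FourierTransform.fourierInv_add]
  map_smul' c f := by rw [map_smul, FourierTransform.fourierInv_smul]; rfl

theorem fourier_absGrad (f : Schw) : 𝓕 (absGrad f) = absHat f :=
  FourierTransform.fourier_fourierInv_eq _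

theorem inner_absGrad_left (f : Schw) (u : L2) : ⟪absGrad f, u⟫ = ⟪absHat f, 𝓕 u⟫ := by
  rw [← fourier_absGrad, Lp.inner_fourier_eq]

theorem inner_absGrad_symm (f g : Schw) : ⟪absGrad f, toL2 g⟫ = ⟪toL2 f, absGrad g⟫ := by
  rw [inner_absGrad_left, ← Lp.inner_fourier_eq (toL2 f), fourier_absGrad, fourier_toL2,
    fourier_toL2, L2.inner_def, L2.inner_def]
  refine integral_congr_ae ?_
  filter_upwards [coeFn_absHat f, coeFn_absHat g, coeFn_toL2 (𝓕 f), coeFn_toL2 (𝓕 g)]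
    with ξ h1 h2 h3 h4
  rw [h1, h2, h3, h4]
  simp [conj_absMul]
  ring

theorem re_inner_absGrad_nonneg (f : Schw) : 0 ≤ (⟪toL2 f, absGrad f⟫).re := by
  rw [← Lp.inner_fourier_eq (toL2 f), fourier_absGrad, fourier_toL2, L2.inner_def,
    ← RCLike.re_to_complex, ← integral_re (L2.integrable_inner _ _)]
  refine integral_nonneg_of_ae ?_
  filter_upwards [coeFn_absHat f, coeFn_toL2 (𝓕 f)] with ξ h1 h2
  rw [h1, h2]
  have : ⟪𝓕 f ξ, absMul ξ * 𝓕 f ξ⟫ = ((2 * Real.pi * ‖ξ‖ * ‖𝓕 f ξ‖ ^ 2 : ℝ) : ℂ) := by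
    rw [← smul_eq_mul, inner_smul_right, inner_self_eq_norm_sq_to_K, absMul]
    simp
  rw [this, RCLike.re_to_complex, Complex.ofReal_re]
  positivity

theorem norm_absGrad (f : Schw) : ‖absGrad f‖ = ‖absHat f‖ := by
  rw [← fourier_absGrad, Lp.norm_fourier_eq]

/-- Plancherel and `|ξ|² = ∑ ξⱼ²`. This makes bounds for `|i∇|` equivalent to bounds for the partial
derivatives. -/
theorem norm_absGrad_sq (f : Schw) : ‖absGrad f‖ ^ 2 = ∑ j, ‖toL2 (pd j f)‖ ^ 2 := by
  simp_rw [← norm_toL2_fourier (pd _ f), norm_absGrad, ← inner_self_eq_norm_sq (𝕜 := ℂ), L2.inner_def]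
  rw [← map_sum, ← integral_finsetSum _ fun j _ => L2.integrable_inner _ _]
  congr 1
  refine integral_congr_ae ?_
  have h : ∀ᵐ ξ ∂(volume : Measure R3), ∀ j, toL2 (𝓕 (pd j f)) ξ = 𝓕 (pd j f) ξ :=
    ae_all_iff.2 fun j => coeFn_toL2 _
  filter_upwards [coeFn_absHat f, h] with ξ h1 h2
  have h3 : ‖ξ‖ ^ 2 = ∑ j, ‖ξ j‖ ^ 2 := EuclideanSpace.norm_sq_eq ξ
  have h4 : ‖absMul ξ * 𝓕 f ξ‖ ^ 2 = ∑ j, ‖𝓕 (pd j f) ξ‖ ^ 2 := by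
    simp only [fourier_pd, norm_mul, norm_absMul, mul_pow, h3, Complex.norm_real, Complex.norm_I]
    rw [← Finset.sum_mul, ← Finset.mul_sum]
    simp [abs_of_pos Real.pi_pos]
  simp only [h1, h2, inner_self_eq_norm_sq_to_K]
  exact_mod_cast congrArg (fun r : ℝ => (r : ℂ)) h4

theorem norm_pd_le (j : Fin 3) (f : Schw) : ‖toL2 (pd j f)‖ ≤ ‖absGrad f‖ := by
  refine le_of_sq_le_sq ?_ (norm_nonneg _)
  rw [norm_absGrad_sq]
  exact Finset.single_le_sum (f := fun j => ‖toL2 (pd j f)‖ ^ 2) (fun _ _ => sq_nonneg _)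
    (Finset.mem_univ j)

theorem norm_absGrad_le_of_forall {f : Schw} {C : ℝ} (hC : 0 ≤ C)
    (h : ∀ j, ‖toL2 (pd j f)‖ ≤ C) : ‖absGrad f‖ ≤ 2 * C := by
  refine le_of_sq_le_sq ?_ (by positivity)
  rw [norm_absGrad_sq]
  -- The factor `2` is a convenient upper bound for `√3`.
  calc ∑ j, ‖toL2 (pd j f)‖ ^ 2 ≤ ∑ _j : Fin 3, C ^ 2 :=
        Finset.sum_le_sum fun j _ => pow_le_pow_left₀ (norm_nonneg _) (h j) 2
    _ ≤ (2 * C) ^ 2 := by simp; nlinarith [sq_nonneg C]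

end FockSpace

end

noncomputable section

namespace FockSpace

open Filter Topology
open scoped LineDeriv SchwartzMap

local notation "⟪" x ", " y "⟫" => inner ℂ x y

/-! ### A Hardy type inequality -/

theorem norm_toL2_sq (f : Schw) : ‖toL2 f‖ ^ 2 = ∫ x, ‖f x‖ ^ 2 := by
  rw [← inner_self_eq_norm_sq (𝕜 := ℂ), inner_toL2]
  have : ∀ x, star (f x) * f x = ((‖f x‖ ^ 2 : ℝ) : ℂ) := fun x => by
    rw [Complex.star_def, Complex.conj_mul']
    push_cast
    rfl
  simp_rw [this]
  exact (congrArg Complex.re integral_complex_ofReal).trans (Complex.ofReal_re _)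

theorem integrable_norm_sq (f : Schw) : Integrable fun x => ‖f x‖ ^ 2 :=
  (memLp_two_iff_integrable_sq_norm f.continuous.aestronglyMeasurable).1 (f.memLp 2)

theorem integrable_star_mul (f g : Schw) : Integrable fun x => star (f x) * g x := by
  have h := L2.integrable_inner (𝕜 := ℂ) (toL2 f) (toL2 g)
  refine h.congr ?_
  filter_upwards [coeFn_toL2 f, coeFn_toL2 g] with x hf hg
  rw [hf, hg]
  simp [mul_comm]

theorem re_inner_mulS {u : R3 → ℂ} (hu : u.HasTemperateGrowth) (f : Schw) :
    (⟪toL2 f, toL2 (mulS u f)⟫).re = ∫ x, (u x).re * ‖f x‖ ^ 2 := by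
  rw [inner_toL2, ← RCLike.re_to_complex, ← integral_re (integrable_star_mul _ _)]
  congr 1
  ext x
  rw [mulS_apply hu, mul_left_comm, Complex.star_def, Complex.conj_mul', RCLike.re_to_complex,
    ← Complex.ofReal_pow, Complex.re_mul_ofReal]

theorem norm_mulS_sq_le {a u : R3 → ℂ} (ha : a.HasTemperateGrowth) (hu : u.HasTemperateGrowth)
    {C : ℝ} (h : ∀ x, ‖a x‖ ^ 2 ≤ C * (u x).re) (f : Schw) :
    ‖toL2 (mulS a f)‖ ^ 2 ≤ C * (⟪toL2 f, toL2 (mulS u f)⟫).re := by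
  rw [re_inner_mulS hu, norm_toL2_sq, ← integral_const_mul]
  have hi : Integrable fun x => (u x).re * ‖f x‖ ^ 2 := by
    have := (integrable_star_mul f (mulS u f)).re
    refine this.congr (Eventually.of_forall fun x => ?_)
    simp only
    rw [mulS_apply hu, mul_left_comm, Complex.star_def, Complex.conj_mul', RCLike.re_to_complex,
      ← Complex.ofReal_pow, Complex.re_mul_ofReal]
  refine integral_mono (integrable_norm_sq _) (hi.const_mul C) fun x => ?_
  simp only
  rw [mulS_apply ha, norm_mul, mul_pow, ← mul_assoc]
  exact mul_le_mul_of_nonneg_right (h x) (sq_nonneg _)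

/-- The weight `(1 + |x|²/s²)⁻¹`. -/
def weight (s : ℝ) (x : R3) : ℝ := (1 + ‖s⁻¹ • x‖ ^ 2)⁻¹

theorem weight_pos (s : ℝ) (x : R3) : 0 < weight s x := by unfold weight; positivity

theorem hasTemperateGrowth_weight (s : ℝ) :
    (fun x => (weight s x : ℂ)).HasTemperateGrowth := by
  have h1 : (fun x : R3 => (1 + ‖x‖ ^ 2) ^ (-1 : ℝ)).HasTemperateGrowth := by fun_prop
  have h2 := h1.comp (f := fun x : R3 => s⁻¹ • x)
    (s⁻¹ • ContinuousLinearMap.id ℝ R3).hasTemperateGrowth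
  have h3 := Function.Complex.hasTemperateGrowth_ofReal.comp h2
  have h4 : (fun x => (weight s x : ℂ)) = Complex.ofReal ∘ (fun x : R3 => (1 + ‖x‖ ^ 2) ^ (-1 : ℝ)) ∘
      fun x : R3 => s⁻¹ • x := by
    funext x
    simp [weight, Real.rpow_neg_one]
  rw [h4]
  exact h3

theorem hasTemperateGrowth_coord (j : Fin 3) : (fun x : R3 => (x j : ℂ)).HasTemperateGrowth :=
  Function.Complex.hasTemperateGrowth_ofReal.comp
    (EuclideanSpace.proj j : R3 →L[ℝ] ℝ).hasTemperateGrowth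

theorem hasLineDerivAt_coord_mul_weight (s : ℝ) (j : Fin 3) (x : R3) :
    HasLineDerivAt ℝ (fun x : R3 => (x j : ℂ) * (weight s x : ℂ))
      ((weight s x : ℂ) - 2 * ((s⁻¹ : ℝ) : ℂ) ^ 2 * ((x j : ℂ) * (weight s x : ℂ)) ^ 2) x
      (EuclideanSpace.single j (1 : ℝ)) := by
  have hn : ∀ t : ℝ, ‖s⁻¹ • (x + t • (EuclideanSpace.single j (1 : ℝ) : R3))‖ ^ 2 =
      s⁻¹ ^ 2 * (‖x‖ ^ 2 + 2 * (t * x j) + t ^ 2) := by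
    intro t
    rw [norm_smul, mul_pow, Real.norm_eq_abs, sq_abs, norm_add_sq_real, inner_smul_right,
      norm_smul, EuclideanSpace.inner_single_right, PiLp.norm_single]
    simp
  have h1 : HasDerivAt (fun t : ℝ => 1 + s⁻¹ ^ 2 * (‖x‖ ^ 2 + 2 * (t * x j) + t ^ 2))
      (s⁻¹ ^ 2 * (2 * (1 * x j) + 2 * 0)) 0 := by
    have ht : HasDerivAt (fun t : ℝ => t) 1 0 := hasDerivAt_id 0
    have := ((((ht.mul_const (x j)).const_mul 2).const_add (‖x‖ ^ 2)).add (ht.pow 2)).const_mul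
      (s⁻¹ ^ 2)
    have h2 := this.const_add 1
    simpa using h2
  have h2 : HasDerivAt (fun t : ℝ => (x j + t) *
      (1 + s⁻¹ ^ 2 * (‖x‖ ^ 2 + 2 * (t * x j) + t ^ 2))⁻¹)
      (weight s x - 2 * s⁻¹ ^ 2 * (x j * weight s x) ^ 2) 0 := by
    have ht : HasDerivAt (fun t : ℝ => x j + t) 1 0 := (hasDerivAt_id 0).const_add _
    have h0 : (1 + s⁻¹ ^ 2 * (‖x‖ ^ 2 + 2 * (0 * x j) + 0 ^ 2)) ≠ 0 := by
      have : 0 < 1 + s⁻¹ ^ 2 * (‖x‖ ^ 2 + 2 * (0 * x j) + 0 ^ 2) := by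
        simp only [zero_mul, mul_zero, add_zero, ne_eq, OfNat.ofNat_ne_zero, not_false_eq_true,
          zero_pow]
        positivity
      exact this.ne'
    have h3 := ht.mul (h1.inv h0)
    have hw : weight s x = (1 + s⁻¹ ^ 2 * (‖x‖ ^ 2 + 2 * (0 * x j) + 0 ^ 2))⁻¹ := by
      have := hn 0
      simp only [zero_smul, add_zero] at this
      rw [weight, this]
    refine h3.congr_deriv ?_
    simp only [Pi.inv_apply]
    rw [div_eq_mul_inv, ← inv_pow, ← hw]
    ring
  have h3 := h2.ofReal_comp
  rw [HasLineDerivAt]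
  have h4 : (fun t : ℝ => (((x + t • (EuclideanSpace.single j (1 : ℝ) : R3)) j : ℝ) : ℂ) *
      (weight s (x + t • (EuclideanSpace.single j (1 : ℝ) : R3)) : ℂ)) = fun y : ℝ =>
      (((x j + y) * (1 + s⁻¹ ^ 2 * (‖x‖ ^ 2 + 2 * (y * x j) + y ^ 2))⁻¹ : ℝ) : ℂ) := by
    funext t
    rw [weight, hn]
    simp
  rw [h4]
  refine h3.congr_deriv ?_
  push_cast
  rfl

/-- Hardy's inequality by integration by parts, with `1/|x|²` replaced by a smooth weight so that
products stay Schwartz. The field `vⱼ = xⱼ · weight` has divergence at least `weight`. Hence `Q ≤ ∫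
(div v) |f|² = -2 ∑ⱼ Re ⟨vⱼ f, ∂ⱼ f⟩`, and `|v|² ≤ s² · weight` bounds each term by `2 s √Q ‖|i∇|
f‖`. -/
theorem re_inner_weight_le (s : ℝ) (hs : 0 < s) (f : Schw) :
    (⟪toL2 f, toL2 (mulS (fun x => (weight s x : ℂ)) f)⟫).re ≤ 36 * s ^ 2 * ‖absGrad f‖ ^ 2 := by
  set u : R3 → ℂ := fun x => (weight s x : ℂ) with hu
  set v : Fin 3 → R3 → ℂ := fun j x => (x j : ℂ) * (weight s x : ℂ) with hv
  set dv : Fin 3 → R3 → ℂ := fun j x => (weight s x : ℂ) -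
    2 * ((s⁻¹ : ℝ) : ℂ) ^ 2 * ((x j : ℂ) * (weight s x : ℂ)) ^ 2 with hdv
  set Q := (⟪toL2 f, toL2 (mulS u f)⟫).re with hQ
  have tu : u.HasTemperateGrowth := hasTemperateGrowth_weight s
  have tv : ∀ j, (v j).HasTemperateGrowth := fun j => (hasTemperateGrowth_coord j).mul tu
  have tdv : ∀ j, (dv j).HasTemperateGrowth := fun j =>
    tu.sub ((Function.HasTemperateGrowth.const _).mul ((tv j).pow 2))
  have hn : ∀ x : R3, s⁻¹ ^ 2 * ‖x‖ ^ 2 * weight s x ≤ 1 := by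
    intro x
    rw [weight, norm_smul, mul_pow, Real.norm_eq_abs, sq_abs, ← div_eq_mul_inv,
      div_le_one (by positivity)]
    linarith
  have hnorm : ∀ x : R3, ‖x‖ ^ 2 = ∑ j, x j ^ 2 := fun x => EuclideanSpace.real_norm_sq_eq x
  have hQ0 : 0 ≤ Q := by
    rw [hQ, re_inner_mulS tu]
    exact integral_nonneg fun x => mul_nonneg (weight_pos s x).le (sq_nonneg _)
  have hvQ : ∀ j, ‖toL2 (mulS (v j) f)‖ ^ 2 ≤ s ^ 2 * Q := fun j =>
    norm_mulS_sq_le (tv j) tu (fun x => by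
      have h1 : x j ^ 2 ≤ ‖x‖ ^ 2 := by
        rw [hnorm]
        exact Finset.single_le_sum (f := fun j => x j ^ 2) (fun _ _ => sq_nonneg _)
          (Finset.mem_univ j)
      have h2 := hn x
      have h3 := (weight_pos s x).le
      simp only [hv, hu, norm_mul, Complex.norm_real, mul_pow, Real.norm_eq_abs, sq_abs,
        Complex.ofReal_re]
      have h4 : s ^ 2 * (s⁻¹ ^ 2 * ‖x‖ ^ 2 * weight s x) = ‖x‖ ^ 2 * weight s x := by
        field_simp
      have h5 : x j ^ 2 * weight s x ≤ s ^ 2 := by nlinarith [sq_nonneg s]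
      nlinarith) f
  have hvQ' : ∀ j, ‖toL2 (mulS (v j) f)‖ ≤ s * √Q := fun j => by
    refine le_of_sq_le_sq ?_ (by positivity)
    rw [mul_pow, Real.sq_sqrt hQ0]
    exact hvQ j
  have hj : ∀ j, (⟪toL2 f, toL2 (mulS (dv j) f)⟫).re ≤ 2 * (s * √Q * ‖absGrad f‖) := by
    intro j
    have h1 := inner_pd j (mulS (v j) f) f
    have h2 : pd j (mulS (v j) f) = mulS (dv j) f + mulS (v j) (pd j f) :=
      lineDeriv_mulS (tv j) (tdv j) _ (hasLineDerivAt_coord_mul_weight s j) f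
    rw [h2, map_add, inner_add_left, inner_mulS (tv j) (by simp [hv]) (pd j f) f] at h1
    have h3 : (⟪toL2 (pd j f), toL2 (mulS (v j) f)⟫).re =
        (⟪toL2 (mulS (v j) f), toL2 (pd j f)⟫).re := inner_re_symm (𝕜 := ℂ) _ _
    have h4 : (⟪toL2 (mulS (dv j) f), toL2 f⟫).re = (⟪toL2 f, toL2 (mulS (dv j) f)⟫).re :=
      inner_re_symm (𝕜 := ℂ) _ _
    have h5 := congrArg Complex.re h1
    rw [Complex.neg_re, Complex.add_re, h3, h4] at h5
    have h6 : |(⟪toL2 (mulS (v j) f), toL2 (pd j f)⟫).re| ≤ s * √Q * ‖absGrad f‖ :=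
      (Complex.abs_re_le_norm _).trans ((norm_inner_le_norm _ _).trans
        (mul_le_mul (hvQ' j) (norm_pd_le j f) (norm_nonneg _) (by positivity)))
    have := neg_abs_le (⟪toL2 (mulS (v j) f), toL2 (pd j f)⟫).re
    linarith
  -- `div v = 3 weight - 2 s⁻² |x|² weight²`, which is at least `weight` because `s⁻² |x|² weight ≤
  -- 1`.
  have hsum : Q ≤ ∑ j, (⟪toL2 f, toL2 (mulS (dv j) f)⟫).re := by
    have h1 : ∑ j, (⟪toL2 f, toL2 (mulS (dv j) f)⟫).re - Q =
        ∫ x, (∑ j, (dv j x).re - (u x).re) * ‖f x‖ ^ 2 := by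
      have hD : (fun x => ∑ j, dv j x - u x).HasTemperateGrowth :=
        (Function.HasTemperateGrowth.sum fun j _ => tdv j).sub tu
      have h2 := re_inner_mulS hD f
      simp only [Complex.sub_re, Complex.re_sum] at h2
      rw [← h2, hQ, ← Complex.re_sum, ← Complex.sub_re, ← inner_sum, ← inner_sub_right,
        ← map_sum, ← map_sub]
      congr 3
      ext x
      rw [mulS_apply hD]
      simp [mulS_apply (tdv _), mulS_apply tu, sub_mul, Fin.sum_univ_three]
      ring
    have h2 : 0 ≤ ∫ x, (∑ j, (dv j x).re - (u x).re) * ‖f x‖ ^ 2 := by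
      refine integral_nonneg fun x => mul_nonneg ?_ (sq_nonneg _)
      have h3 : ∀ j, (dv j x).re = weight s x - 2 * s⁻¹ ^ 2 * (x j * weight s x) ^ 2 := fun j => by
        have : dv j x = ((weight s x - 2 * s⁻¹ ^ 2 * (x j * weight s x) ^ 2 : ℝ) : ℂ) := by
          simp [hdv]
        rw [this, Complex.ofReal_re]
      simp_rw [h3]
      rw [Finset.sum_sub_distrib, ← Finset.mul_sum]
      simp_rw [mul_pow]
      rw [← Finset.sum_mul, ← hnorm]
      have := hn x
      have hw := weight_pos s x
      simp [hu]
      have h4 : s⁻¹ ^ 2 * (‖x‖ ^ 2 * weight s x ^ 2) ≤ weight s x := by nlinarith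
      simp only [inv_pow] at h4
      linarith
    linarith
  -- Three coordinates, each contributing `2 s √Q ‖|i∇| f‖`. Dividing by `√Q` and squaring gives the
  -- constant `36`.
  have hQ6 : Q ≤ 6 * s * ‖absGrad f‖ * √Q := by
    refine hsum.trans ((Finset.sum_le_sum fun j _ => hj j).trans ?_)
    simp
    linarith
  have hsq := Real.sq_sqrt hQ0
  rcases (Real.sqrt_nonneg Q).eq_or_lt with h0 | h0
  · have h1 : Q = 0 := by
      rw [← hsq, ← h0]
      norm_num
    rw [h1]
    positivity
  · have : √Q ≤ 6 * s * ‖absGrad f‖ := by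
      refine le_of_mul_le_mul_right ?_ h0
      nlinarith
    rw [← hsq]
    nlinarith

end FockSpace

end

noncomputable section

namespace FockSpace

open Filter Topology
open scoped LineDeriv SchwartzMap Convolution

local notation "⟪" x ", " y "⟫" => inner ℂ x y

/-! ### Commutator of `|i∇|` with a multiplication operator -/

theorem fourier_fourier_apply (f : Schw) (x : R3) : 𝓕 (𝓕 f) x = f (-x) := by
  have h : 𝓕⁻ (𝓕 f) (-x) = f (-x) := by rw [FourierTransform.fourierInv_fourier_eq]
  rw [← h]
  have h2 : 𝓕⁻ (𝓕 f) (-x) = 𝓕 (𝓕 f) (- -x) := rfl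
  rw [h2, neg_neg]

/-- Deduced from the transform of a convolution: `𝓕` is applied once more to both sides, and `𝓕 𝓕`
is the reflection `x ↦ -x`. -/
theorem fourier_mulS (a g : Schw) (p : R3) :
    𝓕 (mulS a g) p = ∫ q, 𝓕 a q * 𝓕 g (p - q) := by
  have h : 𝓕 (mulS a g) =
      SchwartzMap.convolution (ContinuousLinearMap.mul ℂ ℂ) (𝓕 a) (𝓕 g) := by
    have h1 : 𝓕 (𝓕 (mulS a g)) =
        𝓕 (SchwartzMap.convolution (ContinuousLinearMap.mul ℂ ℂ) (𝓕 a) (𝓕 g)) := by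
      ext x
      rw [SchwartzMap.fourier_convolution, SchwartzMap.pairing_apply_apply, fourier_fourier_apply,
        fourier_fourier_apply, fourier_fourier_apply, mulS_apply a.hasTemperateGrowth]
      rfl
    have h2 := congrArg (fun f : Schw => 𝓕⁻ f) h1
    simpa using h2
  rw [h, SchwartzMap.convolution_apply]
  rfl

theorem integral_norm_mul_norm_le (f g : Schw) :
    ∫ x, ‖f x‖ * ‖g x‖ ≤ ‖toL2 f‖ * ‖toL2 g‖ := by
  have h := integral_mul_norm_le_Lp_mul_Lq (μ := (volume : Measure R3)) (f := f) (g := g)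
    (p := 2) (q := 2) Real.HolderConjugate.two_two (by simpa using f.memLp 2)
    (by simpa using g.memLp 2)
  have hn : ∀ f : Schw, (∫ x, ‖f x‖ ^ (2 : ℝ)) ^ (1 / 2 : ℝ) = ‖toL2 f‖ := fun f => by
    simp_rw [Real.rpow_two]
    rw [← norm_toL2_sq, ← Real.sqrt_eq_rpow, Real.sqrt_sq (norm_nonneg _)]
  rwa [hn, hn] at h

theorem norm_toL2_compSubConst (g : Schw) (q : R3) :
    ‖toL2 (SchwartzMap.compSubConstCLM ℂ q g)‖ = ‖toL2 g‖ := by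
  have h : ‖toL2 (SchwartzMap.compSubConstCLM ℂ q g)‖ ^ 2 = ‖toL2 g‖ ^ 2 := by
    rw [norm_toL2_sq, norm_toL2_sq]
    simp only [SchwartzMap.compSubConstCLM_apply]
    exact integral_sub_right_eq_self (fun x => ‖g x‖ ^ 2) q
  exact (sq_eq_sq₀ (norm_nonneg _) (norm_nonneg _)).1 h

/-- The first moment of the Fourier transform of `a`. -/
def fourierMoment (a : Schw) : ℝ := ∫ q, 2 * Real.pi * ‖q‖ * ‖𝓕 a q‖

theorem integrable_fourierMoment (a : Schw) :
    Integrable fun q => 2 * Real.pi * ‖q‖ * ‖𝓕 a q‖ := by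
  have h := ((𝓕 a).integrable_pow_mul volume 1).const_mul (2 * Real.pi)
  simpa [mul_assoc] using h

theorem fourierMoment_nonneg (a : Schw) : 0 ≤ fourierMoment a :=
  integral_nonneg fun q => by positivity

/-- Here `g'` is `|i∇| g`, assumed Schwartz. In the Fourier representation the commutator has kernel
`2π (|p| - |p - q|) 𝓕a(q)`, at most `2π |q| |𝓕a(q)|` in modulus. For fixed `q`, Cauchy-Schwarz in
`p` leaves exactly the first moment of `𝓕a`. -/
theorem norm_comm_absGrad_mulS_le (a h g g' : Schw) (hg : ∀ ξ, 𝓕 g' ξ = absMul ξ * 𝓕 g ξ) :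
    ‖⟪absGrad h, toL2 (mulS a g)⟫ - ⟪toL2 h, toL2 (mulS a g')⟫‖ ≤
      fourierMoment a * ‖toL2 h‖ * ‖toL2 g‖ := by
  set G : R3 → ℝ := fun q => 2 * Real.pi * ‖q‖ * ‖𝓕 a q‖ with hG
  have hGi : Integrable G := integrable_fourierMoment a
  have hgi : Integrable fun p => ‖𝓕 g p‖ := (𝓕 g).integrable.norm
  have hconv : Integrable (fun z : R3 × R3 => G z.2 * ‖𝓕 g (z.1 - z.2)‖)
      ((volume : Measure R3).prod volume) :=
    hGi.convolution_integrand (ContinuousLinearMap.mul ℝ ℝ) hgi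
  -- Joint integrability, needed to exchange the `p` and `q` integrals; it uses that `𝓕 h` is
  -- bounded.
  have htri : Integrable (fun z : R3 × R3 => ‖𝓕 h z.1‖ * (G z.2 * ‖𝓕 g (z.1 - z.2)‖))
      ((volume : Measure R3).prod volume) := by
    obtain ⟨M, hM⟩ : ∃ M, ∀ x, ‖𝓕 h x‖ ≤ M := ⟨_, (𝓕 h).norm_le_seminorm ℝ⟩
    exact hconv.bdd_mul (c := M)
      ((𝓕 h).continuous.norm.comp continuous_fst).aestronglyMeasurable
      (Eventually.of_forall fun z => by simpa using hM z.1)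
  have hbound : ∀ p, ‖absMul p * 𝓕 (mulS a g) p - 𝓕 (mulS a g') p‖ ≤
      ∫ q, G q * ‖𝓕 g (p - q)‖ := by
    intro p
    obtain ⟨M, hM⟩ : ∃ M, ∀ x, ‖𝓕 g x‖ ≤ M := ⟨_, (𝓕 g).norm_le_seminorm ℝ⟩
    obtain ⟨M', hM'⟩ : ∃ M, ∀ x, ‖𝓕 g' x‖ ≤ M := ⟨_, (𝓕 g').norm_le_seminorm ℝ⟩
    have hc : Continuous fun q : R3 => p - q := by fun_prop
    have i1 : Integrable fun q => 𝓕 a q * 𝓕 g (p - q) :=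
      (𝓕 a).integrable.mul_bdd (c := M) ((𝓕 g).continuous.comp hc).aestronglyMeasurable
        (Eventually.of_forall fun q => hM _)
    have i2 : Integrable fun q => 𝓕 a q * 𝓕 g' (p - q) :=
      (𝓕 a).integrable.mul_bdd (c := M') ((𝓕 g').continuous.comp hc).aestronglyMeasurable
        (Eventually.of_forall fun q => hM' _)
    have i3 : Integrable fun q => G q * ‖𝓕 g (p - q)‖ :=
      hGi.mul_bdd (c := M) ((𝓕 g).continuous.norm.comp hc).aestronglyMeasurable
        (Eventually.of_forall fun q => by simpa using hM _)
    rw [fourier_mulS, fourier_mulS, ← integral_const_mul, ← integral_sub (i1.const_mul _) i2]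
    refine norm_integral_le_of_norm_le i3 (Eventually.of_forall fun q => ?_)
    have e1 : absMul p * (𝓕 a q * 𝓕 g (p - q)) - 𝓕 a q * 𝓕 g' (p - q) =
        ((2 * Real.pi * (‖p‖ - ‖p - q‖) : ℝ) : ℂ) * 𝓕 a q * 𝓕 g (p - q) := by
      rw [hg, absMul, absMul]
      push_cast
      ring
    rw [e1, norm_mul, norm_mul, Complex.norm_real, Real.norm_eq_abs, abs_mul,
      abs_of_pos (by positivity : 0 < 2 * Real.pi)]
    have e2 : |‖p‖ - ‖p - q‖| ≤ ‖q‖ := by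
      have := abs_norm_sub_norm_le p (p - q)
      rwa [sub_sub_cancel] at this
    simp only [hG]
    gcongr
  have e1 : ⟪absGrad h, toL2 (mulS a g)⟫ - ⟪toL2 h, toL2 (mulS a g')⟫ =
      ∫ p, star (𝓕 h p) * (absMul p * 𝓕 (mulS a g) p - 𝓕 (mulS a g') p) := by
    rw [inner_absGrad_symm, ← Lp.inner_fourier_eq (toL2 h), ← Lp.inner_fourier_eq (toL2 h),
      fourier_absGrad, fourier_toL2, fourier_toL2, L2.inner_def, L2.inner_def,
      ← integral_sub (L2.integrable_inner _ _) (L2.integrable_inner _ _)]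
    refine integral_congr_ae ?_
    filter_upwards [coeFn_toL2 (𝓕 h), coeFn_absHat (mulS a g), coeFn_toL2 (𝓕 (mulS a g'))]
      with p h1 h2 h3
    rw [h1, h2, h3]
    simp
    ring
  rw [e1]
  calc ‖∫ p, star (𝓕 h p) * (absMul p * 𝓕 (mulS a g) p - 𝓕 (mulS a g') p)‖
      ≤ ∫ p, ∫ q, ‖𝓕 h p‖ * (G q * ‖𝓕 g (p - q)‖) := by
        refine norm_integral_le_of_norm_le htri.integral_prod_left
          (Eventually.of_forall fun p => ?_)
        rw [norm_mul, norm_star, integral_const_mul]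
        exact mul_le_mul_of_nonneg_left (hbound p) (norm_nonneg _)
    _ = ∫ q, ∫ p, ‖𝓕 h p‖ * (G q * ‖𝓕 g (p - q)‖) := integral_integral_swap htri
    _ ≤ ∫ q, G q * (‖toL2 h‖ * ‖toL2 g‖) := by
        refine integral_mono htri.integral_prod_right (hGi.mul_const _) fun q => ?_
        simp only
        have e3 : ∀ p, ‖𝓕 h p‖ * (G q * ‖𝓕 g (p - q)‖) =
            G q * (‖𝓕 h p‖ * ‖SchwartzMap.compSubConstCLM ℂ q (𝓕 g) p‖) := fun p => by
          rw [SchwartzMap.compSubConstCLM_apply]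
          ring
        simp_rw [e3]
        rw [integral_const_mul]
        refine mul_le_mul_of_nonneg_left ?_ (by simp only [hG]; positivity)
        refine (integral_norm_mul_norm_le _ _).trans ?_
        rw [norm_toL2_compSubConst, norm_toL2_fourier, norm_toL2_fourier]
    _ = fourierMoment a * ‖toL2 h‖ * ‖toL2 g‖ := by
        rw [integral_mul_const, fourierMoment]
        ring

/-! ### Dilations -/

/-- The dilated function `x ↦ α(x/s)`. -/
def dil (s : ℝˣ) : Schw →ₗ[ℂ] Schw :=
  (SchwartzMap.compCLMOfContinuousLinearEquiv ℂ (ContinuousLinearEquiv.smulLeft s⁻¹ : R3 ≃L[ℝ] R3)).toLinearMap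

theorem dil_apply (s : ℝˣ) (α : Schw) (x : R3) : dil s α x = α ((s : ℝ)⁻¹ • x) := by
  have : dil s α x = α (s⁻¹ • x) := rfl
  rw [this, Units.smul_def, Units.val_inv_eq_inv_val]

theorem pd_dil (s : ℝˣ) (j : Fin 3) (α : Schw) :
    pd j (dil s α) = ((s : ℝ) : ℂ)⁻¹ • dil s (pd j α) := by
  have h : pd j (dil s α) = dil s (∂_{s⁻¹ • (EuclideanSpace.single j (1 : ℝ) : R3)} α) :=
    SchwartzMap.lineDerivOp_compCLMOfContinuousLinearEquiv (𝕜 := ℂ) _ _ _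
  rw [h, Units.smul_def, LineDeriv.lineDerivOp_left_smul]
  have h2 : ((s⁻¹ : ℝˣ) : ℝ) • ∂_{(EuclideanSpace.single j (1 : ℝ) : R3)} α =
      ((s : ℝ) : ℂ)⁻¹ • pd j α := by
    ext x
    rw [smul_apply, smul_apply, Units.val_inv_eq_inv_val, ← Complex.ofReal_inv]
    exact (Complex.coe_smul _ _).symm
  rw [h2, map_smul]

theorem fourier_dil (s : ℝˣ) (hs : 0 < (s : ℝ)) (α : Schw) (q : R3) :
    𝓕 (dil s α) q = ((s : ℝ) : ℂ) ^ 3 * 𝓕 α ((s : ℝ) • q) := by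
  rw [SchwartzMap.fourier_coe, SchwartzMap.fourier_coe, Real.fourier_eq, Real.fourier_eq]
  have h := Measure.integral_comp_inv_smul (volume : Measure R3)
    (fun y => Real.fourierChar (-(inner ℝ y ((s : ℝ) • q))) • α y) (s : ℝ)
  have e1 : ∀ x : R3, Real.fourierChar (-(inner ℝ x q)) • dil s α x =
      Real.fourierChar (-(inner ℝ ((s : ℝ)⁻¹ • x) ((s : ℝ) • q))) • α ((s : ℝ)⁻¹ • x) := by
    intro x
    rw [dil_apply, real_inner_smul_left, real_inner_smul_right, inv_mul_cancel_left₀ hs.ne']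
  simp_rw [e1]
  rw [h, abs_of_pos (by positivity)]
  simp

/-- The factor `s³` of the dilated transform cancels against the Jacobian, and the weight `|q|`
leaves `s⁻¹`. This power cancels the factor `s` in `genS` and makes the commutator bound scale
invariant. -/
theorem fourierMoment_dil (s : ℝˣ) (hs : 0 < (s : ℝ)) (α : Schw) :
    fourierMoment (dil s α) = (s : ℝ)⁻¹ * fourierMoment α := by
  rw [fourierMoment, fourierMoment]
  have h := Measure.integral_comp_smul (volume : Measure R3)
    (fun q => 2 * Real.pi * ‖q‖ * ‖𝓕 α q‖) (s : ℝ)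
  have e1 : ∀ q : R3, 2 * Real.pi * ‖q‖ * ‖𝓕 (dil s α) q‖ =
      (s : ℝ) ^ 2 * (2 * Real.pi * ‖(s : ℝ) • q‖ * ‖𝓕 α ((s : ℝ) • q)‖) := by
    intro q
    rw [fourier_dil s hs, norm_mul, norm_pow, Complex.norm_real, norm_smul,
      Real.norm_of_nonneg hs.le]
    ring
  simp_rw [e1]
  rw [integral_const_mul, h, abs_of_pos (by positivity)]
  simp
  field_simp

/-- `α` vanishes outside of the unit ball. -/
def SuppUnit (α : Schw) : Prop := ∀ x, 1 < ‖x‖ → α x = 0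

theorem SuppUnit.pd {α : Schw} (h : SuppUnit α) (j : Fin 3) : SuppUnit (pd j α) := by
  intro x hx
  rw [pd_apply, partialDeriv]
  have : (α : R3 → ℂ) =ᶠ[𝓝 x] fun _ => 0 := by
    filter_upwards [continuous_norm.continuousAt.eventually (lt_mem_nhds hx)] with y hy
    exact h y hy
  rw [this.fderiv_eq]
  simp

/-- The dilated function lives in `|x| ≤ s`, where the weight is at least `1/2`. So its square is at
most `2 M²` times the weight, and the Hardy inequality gives `72 M² s² ≤ (9 M s)²`. -/
theorem norm_mulS_dil_le_absGrad (s : ℝˣ) (hs : 0 < (s : ℝ)) {β : Schw} (hβ : SuppUnit β) {M : ℝ}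
    (hM : ∀ x, ‖β x‖ ≤ M) (f : Schw) :
    ‖toL2 (mulS (dil s β) f)‖ ≤ 9 * M * s * ‖absGrad f‖ := by
  have hM0 : 0 ≤ M := (norm_nonneg _).trans (hM 0)
  refine le_of_sq_le_sq ?_ (by positivity)
  have h1 := norm_mulS_sq_le (dil s β).hasTemperateGrowth (hasTemperateGrowth_weight (s : ℝ))
    (C := 2 * M ^ 2) (fun x => by
      rw [dil_apply, Complex.ofReal_re, weight]
      rcases le_or_gt ‖(s : ℝ)⁻¹ • x‖ 1 with h | h
      · have h2 : (2 : ℝ)⁻¹ ≤ (1 + ‖(s : ℝ)⁻¹ • x‖ ^ 2)⁻¹ := by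
          refine inv_anti₀ (by positivity) ?_
          nlinarith [norm_nonneg ((s : ℝ)⁻¹ • x)]
        have h3 : ‖β ((s : ℝ)⁻¹ • x)‖ ^ 2 ≤ M ^ 2 :=
          pow_le_pow_left₀ (norm_nonneg _) (hM _) 2
        nlinarith [sq_nonneg M]
      · rw [hβ _ h, norm_zero, zero_pow two_ne_zero]
        positivity) f
  have h2 := re_inner_weight_le (s : ℝ) hs f
  have h3 : 2 * M ^ 2 * (⟪toL2 f, toL2 (mulS (fun x => (weight (s : ℝ) x : ℂ)) f)⟫).re ≤
      2 * M ^ 2 * (36 * (s : ℝ) ^ 2 * ‖absGrad f‖ ^ 2) := by gcongr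
  refine h1.trans (h3.trans ?_)
  have : 0 ≤ (M * (s : ℝ) * ‖absGrad f‖) ^ 2 := sq_nonneg _
  nlinarith

end FockSpace

end

noncomputable section

namespace FockSpace

open Filter Topology
open scoped LineDeriv SchwartzMap

local notation "⟪" x ", " y "⟫" => inner ℂ x y

/-! ### Schwartz functions with Fourier transform supported in an annulus -/

theorem ext_fourier {f g : Schw} (h : ∀ ξ, 𝓕 f ξ = 𝓕 g ξ) : f = g := by
  have h1 : 𝓕 f = 𝓕 g := SchwartzMap.ext h
  have h2 := congrArg (fun f : Schw => 𝓕⁻ f) h1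
  simpa using h2

theorem L2_norm_sq (U : L2) : ‖U‖ ^ 2 = ∫ x, ‖U x‖ ^ 2 := by
  rw [← inner_self_eq_norm_sq (𝕜 := ℂ), L2.inner_def]
  have : ∀ x, ⟪U x, U x⟫ = ((‖U x‖ ^ 2 : ℝ) : ℂ) := fun x => by
    rw [inner_self_eq_norm_sq_to_K]
    simp
  simp_rw [this]
  exact (congrArg Complex.re integral_complex_ofReal).trans (Complex.ofReal_re _)

/-- Dominated convergence with majorant `4 |U|²`, since `|χ n - 1| ≤ 2`. -/
theorem tendsto_L2_of_ae_mul {U : L2} {V : ℕ → L2} {χ : ℕ → R3 → ℂ}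
    (h : ∀ n, V n =ᵐ[volume] fun x => χ n x * U x) (hb : ∀ n x, ‖χ n x‖ ≤ 1)
    (hlim : ∀ᵐ x ∂(volume : Measure R3), Tendsto (fun n => χ n x) atTop (𝓝 1)) :
    Tendsto V atTop (𝓝 U) := by
  rw [tendsto_iff_norm_sub_tendsto_zero]
  have hd : ∀ n, ∀ᵐ x ∂(volume : Measure R3), ‖(V n - U : L2) x‖ ^ 2 =
      ‖χ n x - 1‖ ^ 2 * ‖U x‖ ^ 2 := fun n => by
    filter_upwards [h n, Lp.coeFn_sub (V n) U] with x h1 h2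
    rw [h2, Pi.sub_apply, h1, ← mul_pow, ← norm_mul, sub_mul, one_mul]
  have hUi : Integrable fun x => ‖U x‖ ^ 2 :=
    (memLp_two_iff_integrable_sq_norm (Lp.aestronglyMeasurable U)).1 (Lp.memLp U)
  have h0 : Tendsto (fun n => ‖V n - U‖ ^ 2) atTop (𝓝 0) := by
    simp_rw [L2_norm_sq]
    have := tendsto_integral_of_dominated_convergence (μ := (volume : Measure R3))
      (F := fun n x => ‖(V n - U : L2) x‖ ^ 2) (f := fun _ => (0 : ℝ))
      (fun x => 4 * ‖U x‖ ^ 2)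
      (fun n => ((Lp.aestronglyMeasurable (V n - U)).norm.pow 2)) (hUi.const_mul 4)
      (fun n => by
        filter_upwards [hd n] with x hx
        rw [hx, norm_mul, norm_pow, norm_pow, norm_norm, norm_norm]
        have : ‖χ n x - 1‖ ≤ 2 := (norm_sub_le _ _).trans (by
          rw [norm_one]
          linarith [hb n x])
        have h2 : ‖χ n x - 1‖ ^ 2 ≤ 2 ^ 2 := pow_le_pow_left₀ (norm_nonneg _) this 2
        nlinarith [sq_nonneg ‖U x‖])
      (by
        filter_upwards [hlim, ae_all_iff.2 hd] with x h1 h2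
        simp_rw [h2]
        have h3 : Tendsto (fun n => ‖χ n x - 1‖ ^ 2 * ‖U x‖ ^ 2) atTop
            (𝓝 (‖(1 : ℂ) - 1‖ ^ 2 * ‖U x‖ ^ 2)) :=
          (((h1.sub_const 1).norm).pow 2).mul_const _
        simpa using h3)
    simpa using this
  have h1 := h0.sqrt
  simpa using h1

/-- Schwartz functions whose Fourier transform is supported in an annulus. -/
def Annular : Submodule ℂ Schw where
  carrier := {f | ∃ r > 0, ∃ R : ℝ, ∀ ξ, (‖ξ‖ < r ∨ R < ‖ξ‖) → 𝓕 f ξ = 0}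
  zero_mem' := ⟨1, one_pos, 1, fun ξ _ => by simp [FourierTransform.fourier_zero]⟩
  add_mem' := by
    rintro f g ⟨r, hr, R, hf⟩ ⟨r', hr', R', hg⟩
    refine ⟨min r r', lt_min hr hr', max R R', fun ξ hξ => ?_⟩
    rw [FourierTransform.fourier_add, add_apply, hf ξ, hg ξ, add_zero]
    · exact hξ.imp (fun h => h.trans_le (min_le_right _ _)) fun h => (le_max_right _ _).trans_lt h
    · exact hξ.imp (fun h => h.trans_le (min_le_left _ _)) fun h => (le_max_left _ _).trans_lt h
  smul_mem' := by
    rintro c f ⟨r, hr, R, hf⟩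
    refine ⟨r, hr, R, fun ξ hξ => ?_⟩
    rw [FourierTransform.fourier_smul, smul_apply, hf ξ hξ, smul_zero]

theorem mem_annular {f : Schw} : f ∈ Annular ↔
    ∃ r > 0, ∃ R : ℝ, ∀ ξ, (‖ξ‖ < r ∨ R < ‖ξ‖) → 𝓕 f ξ = 0 := Iff.rfl

theorem annular_of_fourier_eq_zero {f g : Schw} (hf : f ∈ Annular)
    (h : ∀ ξ, 𝓕 f ξ = 0 → 𝓕 g ξ = 0) : g ∈ Annular := by
  obtain ⟨r, hr, R, hf⟩ := mem_annular.1 hf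
  exact mem_annular.2 ⟨r, hr, R, fun ξ hξ => h ξ (hf ξ hξ)⟩

/-- The transform of `f` vanishes near the origin and outside a ball, so a singularity of `m` at the
origin is harmless and the product is smooth with compact support. -/
theorem exists_annular_multiplier {m : R3 → ℂ} (hm : ∀ ξ, ξ ≠ 0 → ContDiffAt ℝ ∞ m ξ)
    (f : Annular) : ∃ g : Annular, ∀ ξ, 𝓕 (g : Schw) ξ = m ξ * 𝓕 (f : Schw) ξ := by
  obtain ⟨f, hf⟩ := f
  obtain ⟨r, hr, R, h⟩ := mem_annular.1 hf
  have hsmooth : ContDiff ℝ ∞ fun ξ => m ξ * 𝓕 f ξ := by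
    rw [contDiff_iff_contDiffAt]
    intro ξ
    rcases eq_or_ne ξ 0 with rfl | hξ
    · have : (fun ξ => m ξ * 𝓕 f ξ) =ᶠ[𝓝 (0 : R3)] fun _ => 0 := by
        filter_upwards [Metric.ball_mem_nhds (0 : R3) hr] with x hx
        rw [h x (Or.inl (by simpa using hx)), mul_zero]
      exact contDiffAt_const.congr_of_eventuallyEq this
    · exact (hm ξ hξ).mul ((𝓕 f).smooth ⊤).contDiffAt
  have hsupp : HasCompactSupport fun ξ => m ξ * 𝓕 f ξ := by
    refine HasCompactSupport.of_support_subset_isCompact (isCompact_closedBall (0 : R3) R) ?_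
    intro ξ hξ
    by_contra hn
    rw [Metric.mem_closedBall, dist_zero_right, not_le] at hn
    exact hξ (by simp only [h ξ (Or.inr hn), mul_zero])
  have key : ∀ ξ, 𝓕 (𝓕⁻ (hsupp.toSchwartzMap hsmooth)) ξ = m ξ * 𝓕 f ξ := by
    intro ξ
    rw [FourierTransform.fourier_fourierInv_eq]
    rfl
  exact ⟨⟨𝓕⁻ (hsupp.toSchwartzMap hsmooth), annular_of_fourier_eq_zero hf fun ξ h0 => by
    rw [key, h0, mul_zero]⟩, key⟩

theorem contDiffAt_absMul {ξ : R3} (hξ : ξ ≠ 0) : ContDiffAt ℝ ∞ absMul ξ := by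
  have h : ContDiffAt ℝ ∞ (fun ξ : R3 => 2 * Real.pi * ‖ξ‖) ξ :=
    contDiffAt_const.mul (contDiffAt_norm ℝ hξ)
  exact Complex.ofRealCLM.contDiff.contDiffAt.comp ξ h

/-- `|i∇|` as an operator on annular functions. -/
def absAnn : Annular →ₗ[ℂ] Annular where
  toFun f := (exists_annular_multiplier (fun _ => contDiffAt_absMul) f).choose
  map_add' f g := by
    refine Subtype.ext (ext_fourier fun ξ => ?_)
    rw [(exists_annular_multiplier (fun _ => contDiffAt_absMul) (f + g)).choose_spec,
      Submodule.coe_add, Submodule.coe_add, FourierTransform.fourier_add,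
      FourierTransform.fourier_add, add_apply, add_apply,
      (exists_annular_multiplier (fun _ => contDiffAt_absMul) f).choose_spec,
      (exists_annular_multiplier (fun _ => contDiffAt_absMul) g).choose_spec, mul_add]
  map_smul' c f := by
    refine Subtype.ext (ext_fourier fun ξ => ?_)
    rw [(exists_annular_multiplier (fun _ => contDiffAt_absMul) (c • f)).choose_spec,
      RingHom.id_apply, Submodule.coe_smul, Submodule.coe_smul, FourierTransform.fourier_smul,
      FourierTransform.fourier_smul, smul_apply, smul_apply,
      (exists_annular_multiplier (fun _ => contDiffAt_absMul) f).choose_spec, smul_eq_mul,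
      smul_eq_mul, mul_left_comm]

theorem fourier_absAnn (f : Annular) (ξ : R3) :
    𝓕 (absAnn f : Schw) ξ = absMul ξ * 𝓕 (f : Schw) ξ :=
  (exists_annular_multiplier (fun _ => contDiffAt_absMul) f).choose_spec ξ

theorem toL2_absAnn (f : Annular) : toL2 (absAnn f) = absGrad f := by
  have h : 𝓕 (toL2 (absAnn f)) = 𝓕 (absGrad f) := by
    rw [fourier_absGrad, fourier_toL2]
    refine Lp.ext ?_
    filter_upwards [coeFn_toL2 (𝓕 (absAnn f : Schw)), coeFn_absHat f] with ξ h1 h2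
    rw [h1, h2, fourier_absAnn]
  have h2 := congrArg (fun f : L2 => 𝓕⁻ f) h
  simpa using h2

/-- `(2π|ξ| + l)⁻¹` is again smooth away from the origin. This supplies the surjectivity hypothesis
of `norm_inner_le_of_norm_le`. -/
theorem exists_absAnn_add_smul (l : ℝ) (hl : 0 < l) (g : Annular) :
    ∃ f, absAnn f + (l : ℂ) • f = g := by
  have hne : ∀ ξ, absMul ξ + l ≠ 0 := fun ξ => by
    rw [absMul, ← Complex.ofReal_add, Ne, Complex.ofReal_eq_zero]
    have : 0 ≤ 2 * Real.pi * ‖ξ‖ := by positivity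
    exact (by linarith : 0 < 2 * Real.pi * ‖ξ‖ + l).ne'
  obtain ⟨f, hf⟩ := exists_annular_multiplier (m := fun ξ => (absMul ξ + l)⁻¹)
    (fun ξ hξ => ((contDiffAt_absMul hξ).add contDiffAt_const).inv (hne ξ)) g
  refine ⟨f, Subtype.ext (ext_fourier fun ξ => ?_)⟩
  rw [Submodule.coe_add, Submodule.coe_smul, FourierTransform.fourier_add,
    FourierTransform.fourier_smul, add_apply, smul_apply, fourier_absAnn, hf, smul_eq_mul,
    ← add_mul, mul_inv_cancel_left₀ (hne ξ)]

theorem fourier_pd_absAnn (j : Fin 3) (f : Annular) (ξ : R3) :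
    𝓕 (pd j (absAnn f)) ξ = absMul ξ * 𝓕 (pd j f) ξ := by
  rw [fourier_pd, fourier_pd, fourier_absAnn]
  ring

theorem norm_absGrad_le_of_fourier_supp {f : Schw} {R : ℝ}
    (h : ∀ ξ, R < ‖ξ‖ → 𝓕 f ξ = 0) : ‖absGrad f‖ ≤ 2 * Real.pi * R * ‖toL2 f‖ := by
  rw [norm_absGrad, ← norm_toL2_fourier f]
  refine Lp.norm_le_mul_norm_of_ae_le_mul ?_
  filter_upwards [coeFn_absHat f, coeFn_toL2 (𝓕 f)] with ξ h1 h2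
  rw [h1, h2, norm_mul, norm_absMul]
  rcases le_or_gt ‖ξ‖ R with hξ | hξ
  · gcongr
  · rw [h ξ hξ, norm_zero, mul_zero, mul_zero]

/-- Smooth cutoffs to annuli exhausting `ℝ³ ∖ {0}`. -/
theorem exists_annular_cutoff : ∃ χ : ℕ → R3 → ℂ, (∀ n, (χ n).HasTemperateGrowth) ∧
    (∀ n x, ‖χ n x‖ ≤ 1) ∧ (∀ x, x ≠ 0 → Tendsto (fun n => χ n x) atTop (𝓝 1)) ∧
    ∀ n, ∃ r > 0, ∃ R : ℝ, ∀ x, (‖x‖ < r ∨ R < ‖x‖) → χ n x = 0 := by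
  let φ : ContDiffBump (0 : R3) := ⟨1, 2, one_pos, one_lt_two⟩
  have hφ1 : ∀ x : R3, ‖x‖ ≤ 1 → φ x = 1 := fun x hx =>
    φ.one_of_mem_closedBall (by simpa using hx)
  have hφ0 : ∀ x : R3, 2 ≤ ‖x‖ → φ x = 0 := fun x hx =>
    φ.zero_of_le_dist (by simpa using hx)
  have hpos : ∀ n : ℕ, (0 : ℝ) < n + 1 := fun n => by positivity
  refine ⟨fun n x => (φ (((n : ℝ) + 1)⁻¹ • x) * (1 - φ (((n : ℝ) + 1) • x)) : ℝ),
    fun n => ?_, fun n x => ?_, fun x hx => ?_, fun n => ?_⟩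
  · have hs : ContDiff ℝ ∞ fun x : R3 =>
        ((φ (((n : ℝ) + 1)⁻¹ • x) * (1 - φ (((n : ℝ) + 1) • x)) : ℝ) : ℂ) := by
      refine Complex.ofRealCLM.contDiff.comp ?_
      exact (φ.contDiff.comp (contDiff_const_smul _)).mul
        (contDiff_const.sub (φ.contDiff.comp (contDiff_const_smul _)))
    refine HasCompactSupport.hasTemperateGrowth ?_ hs
    refine HasCompactSupport.of_support_subset_isCompact
      (isCompact_closedBall (0 : R3) (2 * (n + 1))) fun x hx => ?_
    by_contra hn
    rw [Metric.mem_closedBall, dist_zero_right, not_le] at hn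
    refine hx ?_
    simp only
    rw [hφ0, zero_mul, Complex.ofReal_zero]
    rw [norm_smul, norm_inv, Real.norm_of_nonneg (hpos n).le, ← div_eq_inv_mul,
      le_div_iff₀ (hpos n)]
    exact hn.le
  · rw [Complex.norm_real, norm_mul, Real.norm_of_nonneg φ.nonneg, Real.norm_of_nonneg
      (sub_nonneg.2 φ.le_one)]
    exact mul_le_one₀ φ.le_one (sub_nonneg.2 φ.le_one) (sub_le_self _ φ.nonneg)
  · refine tendsto_const_nhds.congr' ?_
    have hx' : 0 < ‖x‖ := norm_pos_iff.2 hx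
    have t : Tendsto (fun n : ℕ => (n : ℝ) + 1) atTop atTop :=
      tendsto_atTop_add_const_right _ _ tendsto_natCast_atTop_atTop
    filter_upwards [t.eventually_ge_atTop ‖x‖, t.eventually_ge_atTop (2 / ‖x‖)] with n h1 h2
    rw [hφ1, hφ0]
    · simp
    · rw [norm_smul, Real.norm_of_nonneg (hpos n).le]
      rwa [div_le_iff₀ hx'] at h2
    · rw [norm_smul, norm_inv, Real.norm_of_nonneg (hpos n).le, ← div_eq_inv_mul,
        div_le_one (hpos n)]
      exact h1
  · refine ⟨((n : ℝ) + 1)⁻¹, inv_pos.2 (hpos n), 2 * (n + 1), fun x hx => ?_⟩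
    simp only
    rcases hx with hx | hx
    · rw [hφ1 (((n : ℝ) + 1) • x), sub_self, mul_zero, Complex.ofReal_zero]
      rw [norm_smul, Real.norm_of_nonneg (hpos n).le]
      calc ((n : ℝ) + 1) * ‖x‖ ≤ (n + 1) * ((n : ℝ) + 1)⁻¹ := by gcongr
        _ = 1 := mul_inv_cancel₀ (hpos n).ne'
    · rw [hφ0, zero_mul, Complex.ofReal_zero]
      rw [norm_smul, norm_inv, Real.norm_of_nonneg (hpos n).le, ← div_eq_inv_mul,
        le_div_iff₀ (hpos n)]
      exact hx.le

/-- Annular functions approximate Schwartz functions in the graph norm of `|i∇|`: multiply the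
Fourier transform by cutoffs exhausting the complement of the origin, a null set. -/
theorem exists_tendsto_annular (f : Schw) : ∃ z : ℕ → Annular,
    Tendsto (fun n => toL2 (z n)) atTop (𝓝 (toL2 f)) ∧
    Tendsto (fun n => absGrad (z n)) atTop (𝓝 (absGrad f)) := by
  obtain ⟨χ, hχ, hb, hlim, hs⟩ := exists_annular_cutoff
  have hlim' : ∀ᵐ x ∂(volume : Measure R3), Tendsto (fun n => χ n x) atTop (𝓝 1) := by
    filter_upwards [Measure.ae_ne volume (0 : R3)] with x hx
    exact hlim x hx
  have key : ∀ n ξ, 𝓕 (𝓕⁻ (mulS (χ n) (𝓕 f))) ξ = χ n ξ * 𝓕 f ξ := fun n ξ => by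
    rw [FourierTransform.fourier_fourierInv_eq, mulS_apply (hχ n)]
  have hmem : ∀ n, 𝓕⁻ (mulS (χ n) (𝓕 f)) ∈ Annular := fun n => by
    obtain ⟨r, hr, R, h⟩ := hs n
    exact mem_annular.2 ⟨r, hr, R, fun ξ hξ => by rw [key, h ξ hξ, zero_mul]⟩
  have hcont : Continuous fun U : L2 => (𝓕⁻ U : L2) :=
    (Lp.fourierTransformₗᵢ R3 ℂ).symm.continuous
  refine ⟨fun n => ⟨_, hmem n⟩, ?_, ?_⟩
  · have h1 : Tendsto (fun n => toL2 (𝓕 (𝓕⁻ (mulS (χ n) (𝓕 f))))) atTop (𝓝 (toL2 (𝓕 f))) := by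
      refine tendsto_L2_of_ae_mul (χ := χ) (fun n => ?_) hb hlim'
      filter_upwards [coeFn_toL2 (𝓕 (𝓕⁻ (mulS (χ n) (𝓕 f)))), coeFn_toL2 (𝓕 f)] with ξ h1 h2
      rw [h1, h2, key]
    have h2 := (hcont.tendsto _).comp h1
    simp only [Function.comp_def, ← fourier_toL2, FourierTransform.fourierInv_fourier_eq] at h2
    exact h2
  · have h1 : Tendsto (fun n => absHat (𝓕⁻ (mulS (χ n) (𝓕 f)))) atTop (𝓝 (absHat f)) := by
      refine tendsto_L2_of_ae_mul (χ := χ) (fun n => ?_) hb hlim'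
      filter_upwards [coeFn_absHat (𝓕⁻ (mulS (χ n) (𝓕 f))), coeFn_absHat f] with ξ h1 h2
      rw [h1, h2, key]
      ring
    exact (hcont.tendsto _).comp h1

theorem denseRange_annular : DenseRange fun z : Annular => toL2 z := by
  have h : Set.range toL2 ⊆ closure (Set.range fun z : Annular => toL2 z) := by
    rintro _ ⟨f, rfl⟩
    obtain ⟨z, hz, -⟩ := exists_tendsto_annular f
    exact mem_closure_of_tendsto hz (Eventually.of_forall fun n => ⟨z n, rfl⟩)
  exact dense_closure.1 (denseRange_toL2.mono h)

end FockSpace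

end

noncomputable section

namespace FockSpace

open Filter Topology
open scoped LineDeriv SchwartzMap

local notation "⟪" x ", " y "⟫" => inner ℂ x y

/-! ### The generator of dilations, cut off at scale `s` -/

theorem norm_le_of_forall_norm_inner_le {H D : Type*} [NormedAddCommGroup H]
    [InnerProductSpace ℂ H] {e : D → H} (he : DenseRange e) {v : H} {C : ℝ}
    (hC : 0 ≤ C) (h : ∀ x, ‖⟪e x, v⟫‖ ≤ C * ‖e x‖) : ‖v‖ ≤ C := by
  have h1 : ∀ u : H, ‖⟪u, v⟫‖ ≤ C * ‖u‖ := fun u =>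
    he.induction_on (p := fun u => ‖⟪u, v⟫‖ ≤ C * ‖u‖) u
      (isClosed_le (by fun_prop) (by fun_prop)) h
  have h2 := h1 v
  rw [inner_self_eq_norm_sq_to_K] at h2
  simp only [Complex.coe_algebraMap, norm_pow, Complex.norm_real, norm_norm] at h2
  rcases (norm_nonneg v).eq_or_lt with h0 | h0
  · rwa [← h0]
  · nlinarith

/-- The operator `i ∑ⱼ (s αⱼ(x/s) ∂ⱼ + (∂ⱼαⱼ)(x/s) / 2)`. -/
def genS (s : ℝˣ) (α : Fin 3 → Schw) : Schw →ₗ[ℂ] Schw :=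
  Complex.I • ∑ j, (((s : ℝ) : ℂ) • (mulS (dil s (α j))).toLinearMap ∘ₗ pd j +
    (1 / 2 : ℂ) • (mulS (dil s (pd j (α j)))).toLinearMap)

theorem genS_apply (s : ℝˣ) (α : Fin 3 → Schw) (f : Schw) :
    genS s α f = Complex.I • ∑ j, (((s : ℝ) : ℂ) • mulS (dil s (α j)) (pd j f) +
      (1 / 2 : ℂ) • mulS (dil s (pd j (α j))) f) := by
  simp only [genS, LinearMap.smul_apply, LinearMap.sum_apply, LinearMap.add_apply,
    LinearMap.comp_apply]
  rfl

theorem pd_mulS (j : Fin 3) (a f : Schw) :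
    pd j (mulS a f) = mulS (pd j a) f + mulS a (pd j f) :=
  lineDeriv_mulS a.hasTemperateGrowth (pd j a).hasTemperateGrowth _
    (fun _ => (a.differentiableAt.hasFDerivAt.hasLineDerivAt _)) f

theorem mulS_smul_left (c : ℂ) (a f : Schw) : mulS (c • a : Schw) f = c • mulS a f := by
  ext x
  rw [mulS_apply (c • a).hasTemperateGrowth, smul_apply, smul_apply,
    mulS_apply a.hasTemperateGrowth, smul_mul_assoc]

theorem pd_mulS_dil (s : ℝˣ) (j : Fin 3) (a f : Schw) :
    pd j (mulS (dil s a) f) =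
      ((s : ℝ) : ℂ)⁻¹ • mulS (dil s (pd j a)) f + mulS (dil s a) (pd j f) := by
  rw [pd_mulS, pd_dil, mulS_smul_left]

theorem pd_star_eq {a : Schw} (h : ∀ x, star (a x) = a x) (j : Fin 3) (x : R3) :
    star (pd j a x) = pd j a x := by
  have h1 : (fun x => star (a x)) = a := funext h
  have h2 : HasFDerivAt (fun x => star (a x))
      ((starL' ℝ : ℂ ≃L[ℝ] ℂ).toContinuousLinearMap.comp (fderiv ℝ a x)) x :=
    a.differentiableAt.hasFDerivAt.star
  rw [h1] at h2
  rw [pd_apply, partialDeriv]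
  conv_rhs => rw [h2.fderiv]
  rfl

theorem inner_mulS_dil (s : ℝˣ) {a : Schw} (h : ∀ x, star (a x) = a x) (f g : Schw) :
    ⟪toL2 (mulS (dil s a) f), toL2 g⟫ = ⟪toL2 f, toL2 (mulS (dil s a) g)⟫ :=
  inner_mulS (dil s a).hasTemperateGrowth (fun x => by rw [dil_apply, h]) f g

/-- Integration by parts sends `s αⱼ ∂ⱼ` to minus itself minus the multiplication by `(∂ⱼαⱼ)(x/s)`;
the term with the coefficient `1/2` is what makes `i` times the sum symmetric. -/
theorem inner_genS_symm (s : ℝˣ) {α : Fin 3 → Schw} (hα : ∀ j x, star (α j x) = α j x)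
    (f g : Schw) : ⟪toL2 (genS s α f), toL2 g⟫ = ⟪toL2 f, toL2 (genS s α g)⟫ := by
  have hs : ((s : ℝ) : ℂ) ≠ 0 := Complex.ofReal_ne_zero.2 s.ne_zero
  rw [genS_apply, genS_apply, map_smul, map_smul, inner_smul_left, inner_smul_right, map_sum,
    map_sum, sum_inner, inner_sum, Finset.mul_sum, Finset.mul_sum]
  refine Finset.sum_congr rfl fun j _ => ?_
  have h1 : ⟪toL2 (mulS (dil s (α j)) (pd j f)), toL2 g⟫ =
      -(((s : ℝ) : ℂ)⁻¹ * ⟪toL2 f, toL2 (mulS (dil s (pd j (α j))) g)⟫ +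
        ⟪toL2 f, toL2 (mulS (dil s (α j)) (pd j g))⟫) := by
    rw [inner_mulS_dil s (hα j), ← inner_smul_right, ← inner_add_right, ← map_smul, ← map_add,
      ← pd_mulS_dil, inner_pd, neg_neg]
  rw [map_add, map_add, map_smul, map_smul, map_smul, map_smul, inner_add_left, inner_add_right,
    inner_smul_left, inner_smul_left, inner_smul_right, inner_smul_right, h1,
    inner_mulS_dil s (pd_star_eq (hα j) j)]
  have h2 : (starRingEnd ℂ) (1 / 2 : ℂ) = 1 / 2 := by rw [map_div₀, map_one, map_ofNat]
  rw [h2, Complex.conj_ofReal, Complex.conj_I]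
  field_simp
  ring

theorem norm_mulS_dil_le (s : ℝˣ) {β : Schw} {M : ℝ} (hM : ∀ x, ‖β x‖ ≤ M) (f : Schw) :
    ‖toL2 (mulS (dil s β) f)‖ ≤ M * ‖toL2 f‖ :=
  norm_mulS_le (dil s β).hasTemperateGrowth (fun x => by rw [dil_apply]; exact hM _) f

/-- Bounds on a vector field supported in the unit ball. -/
structure FieldBound (α : Fin 3 → Schw) (M K : ℝ) : Prop where
  real : ∀ j x, star (α j x) = α j x
  supp : ∀ j, SuppUnit (α j)
  bound : ∀ j x, ‖α j x‖ ≤ M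
  bound_pd : ∀ j x, ‖pd j (α j) x‖ ≤ M
  bound_pd_pd : ∀ i j x, ‖pd i (pd j (α j)) x‖ ≤ M
  moment : ∀ j, fourierMoment (α j) ≤ K

theorem FieldBound.nonneg {α : Fin 3 → Schw} {M K : ℝ} (h : FieldBound α M K) : 0 ≤ M :=
  (norm_nonneg _).trans (h.bound 0 0)

theorem FieldBound.nonneg' {α : Fin 3 → Schw} {M K : ℝ} (h : FieldBound α M K) : 0 ≤ K :=
  (fourierMoment_nonneg _).trans (h.moment 0)

/-- The first order part has the explicit factor `s`, and the multiplication part gains one from the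
Hardy bound because its support has radius `s`. -/
theorem norm_genS_le {α : Fin 3 → Schw} {M K : ℝ} (h : FieldBound α M K) (s : ℝˣ)
    (hs : 0 < (s : ℝ)) (f : Schw) : ‖toL2 (genS s α f)‖ ≤ 17 * M * s * ‖absGrad f‖ := by
  have hM := h.nonneg
  rw [genS_apply, map_smul, norm_smul, Complex.norm_I, one_mul, map_sum]
  -- `11/2 = 1 + 9/2`: the derivative term plus half of the Hardy constant. Three coordinates give
  -- `33/2 ≤ 17`.
  have h1 : ∀ j, ‖toL2 (((s : ℝ) : ℂ) • mulS (dil s (α j)) (pd j f) +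
      (1 / 2 : ℂ) • mulS (dil s (pd j (α j))) f)‖ ≤ 11 / 2 * M * s * ‖absGrad f‖ := fun j => by
    rw [map_add, map_smul, map_smul]
    refine (norm_add_le _ _).trans ?_
    rw [norm_smul, norm_smul, Complex.norm_real, Real.norm_of_nonneg hs.le]
    have h2 : ‖toL2 (mulS (dil s (α j)) (pd j f))‖ ≤ M * ‖absGrad f‖ :=
      (norm_mulS_dil_le s (h.bound j) _).trans
        (mul_le_mul_of_nonneg_left (norm_pd_le j f) hM)
    have h3 := norm_mulS_dil_le_absGrad s hs ((h.supp j).pd j) (h.bound_pd j) f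
    have h4 : ‖(1 / 2 : ℂ)‖ = 1 / 2 := by norm_num
    rw [h4]
    have h5 : (s : ℝ) * ‖toL2 (mulS (dil s (α j)) (pd j f))‖ ≤ s * (M * ‖absGrad f‖) := by gcongr
    linarith
  refine (norm_sum_le _ _).trans ((Finset.sum_le_sum fun j _ => h1 j).trans ?_)
  have : 0 ≤ M * s * ‖absGrad f‖ := by positivity
  simp
  linarith

/-- The commutator of `|i∇|` and `genS`. -/
def commS (s : ℝˣ) (α : Fin 3 → Schw) : Annular →ₗ[ℂ] L2 :=
  absGrad ∘ₗ genS s α ∘ₗ Annular.subtype -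
    toL2 ∘ₗ genS s α ∘ₗ Annular.subtype ∘ₗ absAnn

theorem commS_apply (s : ℝˣ) (α : Fin 3 → Schw) (f : Annular) :
    commS s α f = absGrad (genS s α f) - toL2 (genS s α (absAnn f)) := rfl

/-- Differentiating the cutoff costs `s⁻¹`, and the Hardy bound returns `s`. -/
theorem norm_absGrad_mulS_dil_le {β : Schw} {M : ℝ} (hβ : SuppUnit β) (hM : ∀ x, ‖β x‖ ≤ M)
    (hM' : ∀ i x, ‖pd i β x‖ ≤ M) (s : ℝˣ) (hs : 0 < (s : ℝ)) (f : Schw) :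
    ‖absGrad (mulS (dil s β) f)‖ ≤ 20 * M * ‖absGrad f‖ := by
  have hM0 : 0 ≤ M := (norm_nonneg _).trans (hM 0)
  have h := norm_absGrad_le_of_forall (f := mulS (dil s β) f) (C := 10 * M * ‖absGrad f‖)
    (by positivity) (fun j => by
      rw [pd_mulS_dil, map_add, map_smul]
      refine (norm_add_le _ _).trans ?_
      rw [norm_smul, norm_inv, Complex.norm_real, Real.norm_of_nonneg hs.le]
      have h1 := norm_mulS_dil_le_absGrad s hs (hβ.pd j) (hM' j) f
      have h2 : ‖toL2 (mulS (dil s β) (pd j f))‖ ≤ M * ‖absGrad f‖ :=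
        (norm_mulS_dil_le s hM _).trans (mul_le_mul_of_nonneg_left (norm_pd_le j f) hM0)
      have h3 : (s : ℝ)⁻¹ * ‖toL2 (mulS (dil s (pd j β)) f)‖ ≤
          (s : ℝ)⁻¹ * (9 * M * s * ‖absGrad f‖) := by gcongr
      have h4 : (s : ℝ)⁻¹ * (9 * M * s * ‖absGrad f‖) = 9 * M * ‖absGrad f‖ := by
        field_simp
      linarith)
  linarith

/-- In the first order part `∂ⱼ` commutes with `|i∇|`, so only the commutator with `αⱼ(x/s)`
remains; its moment `s⁻¹ K` meets the prefactor `s`. The multiplication part needs no cancellation: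
both orders of the product are bounded by `‖|i∇| f‖` separately. -/
theorem norm_commS_le {α : Fin 3 → Schw} {M K : ℝ} (h : FieldBound α M K) (s : ℝˣ)
    (hs : 0 < (s : ℝ)) (f : Annular) :
    ‖commS s α f‖ ≤ (3 * K + 32 * M) * ‖absGrad f‖ := by
  have hM := h.nonneg
  have hK := h.nonneg'
  -- By duality, because the commutator with a multiplication operator was estimated as a form.
  refine norm_le_of_forall_norm_inner_le denseRange_toL2 (by positivity) fun g => ?_
  set N := ‖absGrad (f : Schw)‖ with hN
  have e1 : ⟪toL2 g, commS s α f⟫ = Complex.I * ∑ j,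
      (((s : ℝ) : ℂ) * (⟪absGrad g, toL2 (mulS (dil s (α j)) (pd j f))⟫ -
          ⟪toL2 g, toL2 (mulS (dil s (α j)) (pd j (absAnn f)))⟫) +
        (1 / 2 : ℂ) * (⟪toL2 g, absGrad (mulS (dil s (pd j (α j))) f)⟫ -
          ⟪toL2 g, toL2 (mulS (dil s (pd j (α j))) (absAnn f))⟫)) := by
    rw [commS_apply, genS_apply, genS_apply]
    simp only [map_smul, map_sum, map_add, inner_sub_right, inner_smul_right, inner_sum,
      inner_add_right, inner_absGrad_symm]
    rw [← mul_sub, ← Finset.sum_sub_distrib]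
    congr 1
    refine Finset.sum_congr rfl fun j _ => ?_
    ring
  have h1 : ∀ j, ‖⟪absGrad g, toL2 (mulS (dil s (α j)) (pd j f))⟫ -
      ⟪toL2 g, toL2 (mulS (dil s (α j)) (pd j (absAnn f)))⟫‖ ≤
      (s : ℝ)⁻¹ * (K * ‖toL2 g‖ * N) := fun j => by
    refine (norm_comm_absGrad_mulS_le _ g _ _ (fourier_pd_absAnn j f)).trans ?_
    rw [fourierMoment_dil s hs, mul_assoc, mul_assoc, mul_assoc]
    have := norm_pd_le j f
    have := h.moment j
    gcongr
  have h2 : ∀ j, ‖⟪toL2 g, absGrad (mulS (dil s (pd j (α j))) f)⟫ -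
      -- `21 = 20 + 1`: `20` with `|i∇|` acting after the multiplication, `1` with it acting before.
      -- Half of this, over three coordinates, is below `32`.
      ⟪toL2 g, toL2 (mulS (dil s (pd j (α j))) (absAnn f))⟫‖ ≤ 21 * M * N * ‖toL2 g‖ := fun j => by
    rw [← inner_sub_right]
    refine (norm_inner_le_norm _ _).trans ?_
    rw [mul_comm]
    refine mul_le_mul_of_nonneg_right ((norm_sub_le _ _).trans ?_) (norm_nonneg _)
    have h3 := norm_absGrad_mulS_dil_le ((h.supp j).pd j) (h.bound_pd j)
      (fun i => h.bound_pd_pd i j) s hs f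
    have h4 := norm_mulS_dil_le s (h.bound_pd j) (absAnn f)
    rw [toL2_absAnn] at h4
    linarith
  rw [e1, norm_mul, Complex.norm_I, one_mul]
  have h3 : ∀ j, ‖((s : ℝ) : ℂ) * (⟪absGrad g, toL2 (mulS (dil s (α j)) (pd j f))⟫ -
          ⟪toL2 g, toL2 (mulS (dil s (α j)) (pd j (absAnn f)))⟫) +
        (1 / 2 : ℂ) * (⟪toL2 g, absGrad (mulS (dil s (pd j (α j))) f)⟫ -
          ⟪toL2 g, toL2 (mulS (dil s (pd j (α j))) (absAnn f))⟫)‖ ≤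
      (K + 21 / 2 * M) * N * ‖toL2 g‖ := fun j => by
    refine (norm_add_le _ _).trans ?_
    rw [norm_mul, norm_mul, Complex.norm_real, Real.norm_of_nonneg hs.le]
    have h4 : ‖(1 / 2 : ℂ)‖ = 1 / 2 := by norm_num
    rw [h4]
    have h5 := mul_le_mul_of_nonneg_left (h1 j) hs.le
    rw [mul_inv_cancel_left₀ hs.ne'] at h5
    have h6 := h2 j
    linarith
  refine (norm_sum_le _ _).trans ((Finset.sum_le_sum fun j _ => h3 j).trans ?_)
  have : 0 ≤ M * N * ‖toL2 g‖ := by positivity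
  simp
  linarith

theorem inner_commS_symm (s : ℝˣ) {α : Fin 3 → Schw} (hα : ∀ j x, star (α j x) = α j x)
    (f g : Annular) : ⟪commS s α f, toL2 g⟫ = -⟪toL2 f, commS s α g⟫ := by
  have h1 : ⟪absGrad (genS s α f), toL2 g⟫ = ⟪toL2 f, toL2 (genS s α (absAnn g))⟫ := by
    rw [inner_absGrad_symm, ← toL2_absAnn, inner_genS_symm s hα]
  have h2 : ⟪toL2 (genS s α (absAnn f)), toL2 g⟫ = ⟪toL2 f, absGrad (genS s α g)⟫ := by
    rw [inner_genS_symm s hα, toL2_absAnn, inner_absGrad_symm]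
  rw [commS_apply, commS_apply, inner_sub_left, inner_sub_right, h1, h2, neg_sub]

theorem norm_inner_genS_annular_le {α : Fin 3 → Schw} {M K : ℝ} (h : FieldBound α M K) (s : ℝˣ)
    (hs : 0 < (s : ℝ)) (f : Annular) :
    ‖⟪toL2 f, toL2 (genS s α f)⟫‖ ≤ 17 * M * s * (⟪toL2 f, absGrad f⟫).re := by
  have hM := h.nonneg
  have h1 := norm_inner_le_of_norm_le (toL2 ∘ₗ Annular.subtype) denseRange_annular absAnn
    (toL2 ∘ₗ genS s α ∘ₗ Annular.subtype) (17 * M * s) (by positivity)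
    (fun x y => by
      simp only [LinearMap.comp_apply, Submodule.subtype_apply, toL2_absAnn]
      exact inner_absGrad_symm _ _)
    (fun x => by
      simp only [LinearMap.comp_apply, Submodule.subtype_apply, toL2_absAnn]
      exact re_inner_absGrad_nonneg _)
    exists_absAnn_add_smul
    (fun x y => inner_genS_symm s h.real _ _)
    (fun x => by
      simp only [LinearMap.comp_apply, Submodule.subtype_apply, toL2_absAnn]
      exact norm_genS_le h s hs _) f
  simpa only [LinearMap.comp_apply, Submodule.subtype_apply, toL2_absAnn] using h1

theorem norm_inner_commS_le {α : Fin 3 → Schw} {M K : ℝ} (h : FieldBound α M K) (s : ℝˣ)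
    (hs : 0 < (s : ℝ)) (f : Annular) :
    ‖⟪toL2 f, commS s α f⟫‖ ≤ (3 * K + 32 * M) * (⟪toL2 f, absGrad f⟫).re := by
  have hM := h.nonneg
  have hK := h.nonneg'
  obtain ⟨a, ha⟩ : ∃ a : Annular →ₗ[ℂ] L2, ∀ x, a x = Complex.I • commS s α x :=
    ⟨Complex.I • commS s α, fun _ => rfl⟩
  have h1 := norm_inner_le_of_norm_le (toL2 ∘ₗ Annular.subtype) denseRange_annular absAnn
    a (3 * K + 32 * M) (by positivity)
    (fun x y => by
      simp only [LinearMap.comp_apply, Submodule.subtype_apply, toL2_absAnn]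
      exact inner_absGrad_symm _ _)
    (fun x => by
      simp only [LinearMap.comp_apply, Submodule.subtype_apply, toL2_absAnn]
      exact re_inner_absGrad_nonneg _)
    exists_absAnn_add_smul
    (fun x y => by
      simp only [LinearMap.comp_apply, Submodule.subtype_apply]
      rw [ha, ha, inner_smul_left, inner_smul_right, inner_commS_symm s h.real]
      simp)
    (fun x => by
      simp only [LinearMap.comp_apply, Submodule.subtype_apply, toL2_absAnn]
      rw [ha, norm_smul, Complex.norm_I, one_mul]
      exact norm_commS_le h s hs _) f
  rw [ha, inner_smul_right, norm_mul, Complex.norm_I, one_mul] at h1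
  simpa only [LinearMap.comp_apply, Submodule.subtype_apply, toL2_absAnn] using h1

/-- Passes from annular to all Schwartz functions by approximation in the graph norm of `|i∇|`, in
which `genS` is continuous. The extension is needed because `genS` is applied a second time to
functions that need not be annular. -/
theorem norm_inner_genS_le {α : Fin 3 → Schw} {M K : ℝ} (h : FieldBound α M K) (s : ℝˣ)
    (hs : 0 < (s : ℝ)) (f : Schw) :
    ‖⟪toL2 f, toL2 (genS s α f)⟫‖ ≤ 17 * M * s * (⟪toL2 f, absGrad f⟫).re := by
  obtain ⟨z, hz, hz'⟩ := exists_tendsto_annular f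
  have h1 : Tendsto (fun n => toL2 (genS s α (z n))) atTop (𝓝 (toL2 (genS s α f))) := by
    rw [tendsto_iff_norm_sub_tendsto_zero] at hz' ⊢
    have h2 := hz'.const_mul (17 * M * s)
    rw [mul_zero] at h2
    refine squeeze_zero (fun _ => norm_nonneg _) (fun n => ?_) h2
    rw [← map_sub, ← map_sub, ← map_sub]
    exact norm_genS_le h s hs _
  exact le_of_tendsto_of_tendsto' (hz.inner h1).norm
    (((Complex.continuous_re.tendsto _).comp (hz.inner hz')).const_mul _)
    fun n => norm_inner_genS_annular_le h s hs (z n)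

end FockSpace

end

noncomputable section

namespace FockSpace

open Filter Topology
open scoped LineDeriv SchwartzMap

local notation "⟪" x ", " y "⟫" => inner ℂ x y

/-! ### Polarizations -/

theorem measurableEmbedding_inc (l : Fin 2) : MeasurableEmbedding fun k : R3 => ((k, l) : Mode) :=
  MeasurableEmbedding.prodMk_right MeasurableEmbedding.id l

theorem modeMeasure_eq :
    modeMeasure = ∑ l : Fin 2, (volume : Measure R3).map fun k => ((k, l) : Mode) := by
  refine Measure.ext fun s hs => ?_
  rw [Measure.prod_apply_symm hs, lintegral_count, tsum_fintype, Measure.finsetSum_apply]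
  refine Finset.sum_congr rfl fun l _ => ?_
  rw [Measure.map_apply (measurable_inc l) hs]

theorem ae_mode {p : Mode → Prop} (h : ∀ l, ∀ᵐ k : R3, p (k, l)) : ∀ᵐ m ∂modeMeasure, p m := by
  rw [modeMeasure_eq, ← Measure.sum_fintype, Measure.ae_sum_iff]
  intro l
  rw [(measurableEmbedding_inc l).ae_map_iff]
  exact h l

theorem integrable_mode {F : Mode → ℝ} (h : ∀ l, Integrable fun k : R3 => F (k, l)) :
    Integrable F modeMeasure := by
  rw [modeMeasure_eq, integrable_finsetSum_measure]
  intro l _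
  rw [(measurableEmbedding_inc l).integrable_map_iff]
  exact h l

theorem memLp_mode {F : Mode → ℂ} (h : ∀ l, MemLp (fun k : R3 => F (k, l)) 2 volume) :
    MemLp F 2 modeMeasure := by
  have hm : AEStronglyMeasurable F modeMeasure := by
    rw [modeMeasure_eq, ← Measure.sum_fintype, aestronglyMeasurable_sum_measure_iff]
    intro l
    rw [(measurableEmbedding_inc l).aestronglyMeasurable_map_iff]
    exact (h l).aestronglyMeasurable
  rw [memLp_two_iff_integrable_sq_norm hm]
  exact integrable_mode fun l =>
    (memLp_two_iff_integrable_sq_norm (h l).aestronglyMeasurable).1 (h l)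

theorem integral_mode {F : Mode → ℂ} (hF : Integrable F modeMeasure) :
    ∫ m, F m ∂modeMeasure = ∑ l, ∫ k : R3, F (k, l) := by
  rw [modeMeasure_eq] at hF ⊢
  rw [integral_finsetSum_measure (integrable_finsetSum_measure.1 hF)]
  refine Finset.sum_congr rfl fun l _ => ?_
  rw [(measurableEmbedding_inc l).integral_map]

theorem inner_eq_sum_slice (f g : OnePhoton) : ⟪f, g⟫ = ∑ l, ⟪slice l f, slice l g⟫ := by
  rw [L2.inner_def, integral_mode (L2.integrable_inner (𝕜 := ℂ) f g)]
  refine Finset.sum_congr rfl fun l _ => ?_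
  rw [L2.inner_def]
  refine integral_congr_ae ?_
  filter_upwards [(memLp_slice l f).coeFn_toLp, (memLp_slice l g).coeFn_toLp] with k h1 h2
  have e1 : (slice l f : L2) k = f (k, l) := h1
  have e2 : (slice l g : L2) k = g (k, l) := h2
  rw [e1, e2]

theorem norm_sq_eq_sum_slice (f : OnePhoton) : ‖f‖ ^ 2 = ∑ l, ‖slice l f‖ ^ 2 := by
  simp_rw [← inner_self_eq_norm_sq (𝕜 := ℂ)]
  rw [inner_eq_sum_slice, map_sum]

theorem memLp_combine (u : Fin 2 → L2) : MemLp (fun m : Mode => u m.2 m.1) 2 modeMeasure :=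
  memLp_mode fun l => Lp.memLp (u l)

/-- The one-photon state with components `u l`. -/
def combine : (Fin 2 → L2) →ₗ[ℂ] OnePhoton where
  toFun u := (memLp_combine u).toLp
  map_add' u v := by
    rw [← MemLp.toLp_add]
    exact MemLp.toLp_congr _ _ (ae_mode fun l => Lp.coeFn_add (u l) (v l))
  map_smul' c u := by
    rw [RingHom.id_apply, ← MemLp.toLp_const_smul]
    exact MemLp.toLp_congr _ _ (ae_mode fun l => Lp.coeFn_smul c (u l))

theorem coeFn_combine (u : Fin 2 → L2) : combine u =ᵐ[modeMeasure] fun m => u m.2 m.1 :=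
  MemLp.coeFn_toLp (memLp_combine u)

theorem slice_combine (l : Fin 2) (u : Fin 2 → L2) : slice l (combine u) = u l := by
  refine Lp.ext ?_
  filter_upwards [(memLp_slice l (combine u)).coeFn_toLp, ae_inc (coeFn_combine u) l] with k h1 h2
  exact h1.trans h2

theorem combine_slice (f : OnePhoton) : combine (fun l => slice l f) = f := by
  refine Lp.ext ((coeFn_combine _).trans (ae_mode fun l => ?_))
  filter_upwards [(memLp_slice l f).coeFn_toLp] with k h1
  exact h1

theorem inner_combine (u v : Fin 2 → L2) : ⟪combine u, combine v⟫ = ∑ l, ⟪u l, v l⟫ := by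
  simp [inner_eq_sum_slice, slice_combine]

theorem norm_combine_sq (u : Fin 2 → L2) : ‖combine u‖ ^ 2 = ∑ l, ‖u l‖ ^ 2 := by
  simp [norm_sq_eq_sum_slice, slice_combine]

theorem norm_combine_le {u v : Fin 2 → L2} {C : ℝ} (hC : 0 ≤ C) (h : ∀ l, ‖u l‖ ≤ C * ‖v l‖) :
    ‖combine u‖ ≤ C * ‖combine v‖ := by
  refine le_of_sq_le_sq ?_ (by positivity)
  rw [mul_pow, norm_combine_sq, norm_combine_sq, Finset.mul_sum]
  refine Finset.sum_le_sum fun l _ => ?_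
  rw [← mul_pow]
  exact pow_le_pow_left₀ (norm_nonneg _) (h l) 2

theorem continuous_combine : Continuous combine := by
  refine (combine.mkContinuous 2 fun u => ?_).continuous
  refine le_of_sq_le_sq ?_ (by positivity)
  rw [norm_combine_sq]
  have h : ∀ l, ‖u l‖ ^ 2 ≤ ‖u‖ ^ 2 := fun l =>
    pow_le_pow_left₀ (norm_nonneg _) (norm_le_pi_norm u l) 2
  have h0 := h 0
  have h1 := h 1
  rw [Fin.sum_univ_two]
  nlinarith [sq_nonneg ‖u‖]

theorem denseRange_combine {D : Type*} {A : D → L2} (hA : DenseRange A) :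
    DenseRange fun z : Fin 2 → D => combine fun l => A (z l) := by
  have h1 : DenseRange fun z : Fin 2 → D => fun l => A (z l) := DenseRange.piMap fun _ => hA
  have h2 : Function.Surjective combine := fun f => ⟨_, combine_slice f⟩
  exact h2.denseRange.comp h1 continuous_combine

/-- Apply an operator to each component. -/
def liftMap {D : Type*} [AddCommGroup D] [Module ℂ D] (A : D →ₗ[ℂ] L2) :
    (Fin 2 → D) →ₗ[ℂ] OnePhoton :=
  combine ∘ₗ LinearMap.pi fun l => A ∘ₗ LinearMap.proj l

theorem liftMap_apply {D : Type*} [AddCommGroup D] [Module ℂ D] (A : D →ₗ[ℂ] L2) (s : Fin 2 → D) :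
    liftMap A s = combine fun l => A (s l) := rfl

theorem inner_liftMap {D : Type*} [AddCommGroup D] [Module ℂ D] (A A' : D →ₗ[ℂ] L2)
    (s s' : Fin 2 → D) : ⟪liftMap A s, liftMap A' s'⟫ = ∑ l, ⟪A (s l), A' (s' l)⟫ := by
  rw [liftMap_apply, liftMap_apply, inner_combine]

theorem mem_absIGrad (s : Fin 2 → Schw) : (liftMap toL2 s, liftMap absGrad s) ∈ absIGrad := by
  show ∀ l : Fin 2, _
  intro l
  simp only [liftMap_apply, slice_combine]
  rw [fourier_absGrad, fourier_toL2]
  filter_upwards [coeFn_absHat (s l), coeFn_toL2 (𝓕 (s l))] with ξ h1 h2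
  rw [h1, h2, absMul]

theorem isSymm_absIGrad : IsSymm absIGrad := by
  intro p hp q hq
  rw [inner_eq_sum_slice, inner_eq_sum_slice]
  refine Finset.sum_congr rfl fun l _ => ?_
  have hp' : (𝓕 (slice l p.2) : L2) =ᵐ[volume] fun ξ => absMul ξ * (𝓕 (slice l p.1) : L2) ξ := hp l
  have hq' : (𝓕 (slice l q.2) : L2) =ᵐ[volume] fun ξ => absMul ξ * (𝓕 (slice l q.1) : L2) ξ := hq l
  rw [← Lp.inner_fourier_eq (slice l p.2), ← Lp.inner_fourier_eq (slice l p.1), L2.inner_def,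
    L2.inner_def]
  refine integral_congr_ae ?_
  filter_upwards [hp', hq'] with ξ h1 h2
  rw [h1, h2]
  simp [conj_absMul]
  ring

end FockSpace

end

noncomputable section

namespace FockSpace

open Filter Topology
open scoped LineDeriv SchwartzMap

local notation "⟪" x ", " y "⟫" => inner ℂ x y

/-! ### Identification of `b^σ` -/

/-- The vector field `η(x)² x`. -/
def cutField (η : R3 → ℝ) (hη : ContDiff ℝ ∞ η) (h0 : ∀ k, 1 ≤ ‖k‖ → η k = 0) (j : Fin 3) : Schw :=
  HasCompactSupport.toSchwartzMap (f := fun x => (η x : ℂ) ^ 2 * (x j : ℂ))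
    (by
      refine HasCompactSupport.of_support_subset_isCompact (isCompact_closedBall (0 : R3) 1)
        fun x hx => ?_
      by_contra hn
      rw [Metric.mem_closedBall, dist_zero_right, not_le] at hn
      exact hx (by simp [h0 x hn.le]))
    (by
      have h1 : ContDiff ℝ ∞ fun x : R3 => (η x : ℂ) := Complex.ofRealCLM.contDiff.comp hη
      have h2 : ContDiff ℝ ∞ fun x : R3 => (x j : ℂ) :=
        Complex.ofRealCLM.contDiff.comp (EuclideanSpace.proj j : R3 →L[ℝ] ℝ).contDiff
      exact (h1.pow 2).mul h2)

section

variable {η : R3 → ℝ} (hη : ContDiff ℝ ∞ η) (h0 : ∀ k, 1 ≤ ‖k‖ → η k = 0)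

theorem cutField_apply (j : Fin 3) (x : R3) :
    cutField η hη h0 j x = (η x : ℂ) ^ 2 * (x j : ℂ) := rfl

theorem exists_fieldBound : ∃ M K : ℝ, FieldBound (cutField η hη h0) M K := by
  have hb : ∀ f : Schw, ∃ M, ∀ x, ‖f x‖ ≤ M := fun f => ⟨_, f.norm_le_seminorm ℝ⟩
  choose c hc using hb
  have hfin : ∀ {ι : Type} [Finite ι] (g : ι → ℝ), ∃ M, ∀ i, g i ≤ M := fun g =>
    (Set.finite_range g).bddAbove.imp fun M hM i => hM ⟨i, rfl⟩
  obtain ⟨M₁, h1⟩ := hfin fun j => c (cutField η hη h0 j)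
  obtain ⟨M₂, h2⟩ := hfin fun j => c (pd j (cutField η hη h0 j))
  obtain ⟨M₃, h3⟩ := hfin fun q : Fin 3 × Fin 3 => c (pd q.1 (pd q.2 (cutField η hη h0 q.2)))
  obtain ⟨K, hK⟩ := hfin fun j => fourierMoment (cutField η hη h0 j)
  refine ⟨max M₁ (max M₂ M₃), K, ?_, ?_, ?_, ?_, ?_, hK⟩
  · intro j x
    simp [cutField_apply]
  · intro j x hx
    rw [cutField_apply, h0 x hx.le]
    simp
  · exact fun j x => (hc _ x).trans ((h1 j).trans (le_max_left _ _))
  · exact fun j x => (hc _ x).trans ((h2 j).trans ((le_max_left _ _).trans (le_max_right _ _)))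
  · exact fun i j x => (hc _ x).trans ((h3 (i, j)).trans
      ((le_max_right _ _).trans (le_max_right _ _)))

theorem partialDeriv_mul (j : Fin 3) {f g : R3 → ℂ} {k : R3} (hf : DifferentiableAt ℝ f k)
    (hg : DifferentiableAt ℝ g k) :
    partialDeriv j (fun q => f q * g q) k = partialDeriv j f k * g k + f k * partialDeriv j g k := by
  rw [partialDeriv, fderiv_fun_mul hf hg]
  simp [partialDeriv]
  ring

theorem differentiableAt_coord (j : Fin 3) (k : R3) :
    DifferentiableAt ℝ (fun q : R3 => (q j : ℂ)) k :=
  (Complex.ofRealCLM ∘L (EuclideanSpace.proj j : R3 →L[ℝ] ℝ)).differentiableAt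

theorem partialDeriv_coord (j : Fin 3) (k : R3) :
    partialDeriv j (fun q : R3 => (q j : ℂ)) k = 1 := by
  have h : HasFDerivAt (fun q : R3 => (q j : ℂ))
      (Complex.ofRealCLM ∘L (EuclideanSpace.proj j : R3 →L[ℝ] ℝ)) k :=
    (Complex.ofRealCLM ∘L (EuclideanSpace.proj j : R3 →L[ℝ] ℝ)).hasFDerivAt
  rw [partialDeriv, h.fderiv]
  simp

/-- By the Leibniz rule the expression is `i (v·∇ + div v / 2)` with `v = η_s² k`, and `v(k) = s
α(k/s)` for `α(x) = η(x)² x`. The divergence is therefore that of `α` at `k/s`, with no power of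
`s`. -/
theorem dilationExpr_eq (s : ℝˣ) (f : Schw) (k : R3) :
    dilationExpr η s f k = genS s (cutField η hη h0) f k := by
  have hs : ((s : ℝ) : ℂ) ≠ 0 := Complex.ofReal_ne_zero.2 s.ne_zero
  set u : R3 → ℂ := fun q => (scaled η s q : ℂ) with hu
  have du : Differentiable ℝ u := by
    have h1 : ContDiff ℝ ∞ u :=
      Complex.ofRealCLM.contDiff.comp (hη.comp (contDiff_const_smul (s : ℝ)⁻¹))
    exact h1.differentiable (by simp)
  have h1 : ∀ j, dil s (cutField η hη h0 j) k = ((s : ℝ) : ℂ)⁻¹ * (u k ^ 2 * (k j : ℂ)) := fun j => by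
    rw [dil_apply, cutField_apply]
    simp [hu, scaled]
    ring
  have h2 : ∀ j, dil s (pd j (cutField η hη h0 j)) k =
      2 * u k * partialDeriv j u k * (k j : ℂ) + u k ^ 2 := fun j => by
    have e1 : dil s (pd j (cutField η hη h0 j)) =
        pd j (((s : ℝ) : ℂ) • dil s (cutField η hη h0 j)) := by
      rw [map_smul, pd_dil, smul_inv_smul₀ hs]
    have e2 : ((((s : ℝ) : ℂ) • dil s (cutField η hη h0 j) : Schw) : R3 → ℂ) =
        fun q => u q * (u q * (q j : ℂ)) := by
      funext q
      rw [smul_apply, dil_apply, cutField_apply]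
      simp [hu, scaled]
      field_simp
    rw [e1, pd_apply, e2, partialDeriv_mul j (g := fun q => u q * (q j : ℂ)) (du k)
      ((du k).mul (differentiableAt_coord j k)),
      partialDeriv_mul j (du k) (differentiableAt_coord j k), partialDeriv_coord]
    ring
  have h3 : ∀ j, partialDeriv j (fun q => u q * f q) k =
      partialDeriv j u k * f k + u k * pd j f k := fun j =>
    partialDeriv_mul j (du k) f.differentiableAt
  have h4 : ∀ j, partialDeriv j (fun q => (q j : ℂ) * (u q * f q)) k =
      u k * f k + (k j : ℂ) * (partialDeriv j u k * f k + u k * pd j f k) := fun j => by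
    rw [partialDeriv_mul j (g := fun q => u q * f q) (differentiableAt_coord j k)
      ((du k).mul f.differentiableAt),
      partialDeriv_coord, h3, one_mul]
  rw [dilationExpr, genS_apply, smul_apply, ← Finset.sum_add_distrib, smul_eq_mul,
    sum_apply, Finset.mul_sum, Finset.mul_sum]
  refine Finset.sum_congr rfl fun j _ => ?_
  rw [add_apply, smul_apply, smul_apply, mulS_apply (dil s _).hasTemperateGrowth,
    mulS_apply (dil s _).hasTemperateGrowth, h1, h2]
  have h3' := h3 j
  have h4' := h4 j
  simp only [hu] at h3' h4'
  rw [h3', h4']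
  simp only [hu, smul_eq_mul]
  field_simp
  ring

/-- Smooth cutoffs to balls exhausting `ℝ³`. -/
theorem exists_ball_cutoff : ∃ χ : ℕ → R3 → ℂ, (∀ n, ContDiff ℝ ∞ (χ n)) ∧
    (∀ n, HasCompactSupport (χ n)) ∧ (∀ n x, ‖χ n x‖ ≤ 1) ∧
    ∀ (n : ℕ) x, ‖x‖ ≤ n + 1 → χ n x = 1 := by
  let φ : ContDiffBump (0 : R3) := ⟨1, 2, one_pos, one_lt_two⟩
  have hφ1 : ∀ x : R3, ‖x‖ ≤ 1 → φ x = 1 := fun x hx =>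
    φ.one_of_mem_closedBall (by simpa using hx)
  have hφ0 : ∀ x : R3, 2 ≤ ‖x‖ → φ x = 0 := fun x hx =>
    φ.zero_of_le_dist (by simpa using hx)
  have hpos : ∀ n : ℕ, (0 : ℝ) < n + 1 := fun n => by positivity
  refine ⟨fun n x => (φ (((n : ℝ) + 1)⁻¹ • x) : ℝ), fun n => ?_, fun n => ?_, fun n x => ?_,
    fun n x hx => ?_⟩
  · exact Complex.ofRealCLM.contDiff.comp (φ.contDiff.comp (contDiff_const_smul _))
  · refine HasCompactSupport.of_support_subset_isCompact
      (isCompact_closedBall (0 : R3) (2 * (n + 1))) fun x hx => ?_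
    by_contra hn
    rw [Metric.mem_closedBall, dist_zero_right, not_le] at hn
    refine hx ?_
    simp only
    rw [hφ0, Complex.ofReal_zero]
    rw [norm_smul, norm_inv, Real.norm_of_nonneg (hpos n).le, ← div_eq_inv_mul,
      le_div_iff₀ (hpos n)]
    exact hn.le
  · rw [Complex.norm_real, Real.norm_of_nonneg φ.nonneg]
    exact φ.le_one
  · simp only
    rw [hφ1, Complex.ofReal_one]
    rw [norm_smul, norm_inv, Real.norm_of_nonneg (hpos n).le, ← div_eq_inv_mul,
      div_le_one (hpos n)]
    exact hx

/-- The coefficients vanish outside the ball of radius `|s|`. The strict inequality `|s| < R` makes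
`f` and `g` agree near every point of that ball, hence also their derivatives. -/
theorem genS_congr (s : ℝˣ) {α : Fin 3 → Schw} (hα : ∀ j, SuppUnit (α j)) {f g : Schw} {R : ℝ}
    (hR : |(s : ℝ)| < R) (h : ∀ x, ‖x‖ ≤ R → f x = g x) : genS s α f = genS s α g := by
  have key : ∀ {β : Schw}, SuppUnit β → ∀ {f g : Schw}, (∀ x, ‖x‖ < R → f x = g x) →
      mulS (dil s β) f = mulS (dil s β) g := by
    intro β hβ f g hfg
    ext x
    rw [mulS_apply (dil s β).hasTemperateGrowth, mulS_apply (dil s β).hasTemperateGrowth]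
    rcases lt_or_ge ‖x‖ R with hx | hx
    · rw [hfg x hx]
    · rw [dil_apply, hβ, zero_mul, zero_mul]
      rw [norm_smul, norm_inv, Real.norm_eq_abs, ← div_eq_inv_mul,
        one_lt_div (abs_pos.2 s.ne_zero)]
      exact hR.trans_le hx
  rw [genS_apply, genS_apply]
  congr 1
  refine Finset.sum_congr rfl fun j _ => ?_
  rw [key (hα j) (f := pd j f) (g := pd j g) (fun x hx => ?_),
    key ((hα j).pd j) (f := f) (g := g) fun x hx => h x hx.le]
  rw [pd_apply, pd_apply, partialDeriv, partialDeriv]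
  have : (f : R3 → ℂ) =ᶠ[𝓝 x] g := by
    filter_upwards [continuous_norm.continuousAt.eventually (gt_mem_nhds hx)] with y hy
    exact h y hy.le
  rw [this.fderiv_eq]

theorem eq_liftMap_of_core {s : ℝˣ} {p : OnePhoton × OnePhoton} {f : Fin 2 → Schw}
    (h1 : p.1 =ᵐ[modeMeasure] fun m => f m.2 m.1)
    (h2 : p.2 =ᵐ[modeMeasure] fun m => dilationExpr η s (f m.2) m.1) :
    p = (liftMap toL2 f, liftMap (toL2 ∘ₗ genS s (cutField η hη h0)) f) := by
  refine Prod.ext (Lp.ext (h1.trans ?_)) (Lp.ext (h2.trans ?_))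
  · refine EventuallyEq.symm ((coeFn_combine _).trans (ae_mode fun l => ?_))
    filter_upwards [coeFn_toL2 (f l)] with k hk
    exact hk
  · refine EventuallyEq.symm ((coeFn_combine _).trans (ae_mode fun l => ?_))
    filter_upwards [coeFn_toL2 (genS s (cutField η hη h0) (f l))] with k hk
    exact hk.trans (dilationExpr_eq hη h0 s (f l) k).symm

theorem liftMap_mem_bOp_of_hasCompactSupport (s : ℝˣ) (f : Fin 2 → Schw)
    (hf : ∀ l, HasCompactSupport (f l)) :
    (liftMap toL2 f, liftMap (toL2 ∘ₗ genS s (cutField η hη h0)) f) ∈ bOp η s := by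
  refine Submodule.le_topologicalClosure _ (Submodule.subset_span
    ⟨fun l => f l, fun l => (f l).smooth ⊤, hf, ?_, ?_⟩)
  · refine (coeFn_combine _).trans (ae_mode fun l => ?_)
    filter_upwards [coeFn_toL2 (f l)] with k hk
    exact hk
  · refine (coeFn_combine _).trans (ae_mode fun l => ?_)
    filter_upwards [coeFn_toL2 (genS s (cutField η hη h0) (f l))] with k hk
    exact hk.trans (dilationExpr_eq hη h0 s (f l) k).symm

/-- Cut off `f` to growing balls. The first components converge, while the second ones are
eventually constant because the coefficients of `genS` have bounded support; the closure in `bOp`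
then contains the limit. -/
theorem liftMap_mem_bOp (s : ℝˣ) (f : Fin 2 → Schw) :
    (liftMap toL2 f, liftMap (toL2 ∘ₗ genS s (cutField η hη h0)) f) ∈ bOp η s := by
  obtain ⟨χ, hχ, hsupp, hb, hone⟩ := exists_ball_cutoff
  have ht : ∀ n, (χ n).HasTemperateGrowth := fun n => (hsupp n).hasTemperateGrowth (hχ n)
  have hα : ∀ j, SuppUnit (cutField η hη h0 j) := fun j x hx => by
    rw [cutField_apply, h0 x hx.le]
    simp
  have h1 : ∀ l, Tendsto (fun n => toL2 (mulS (χ n) (f l))) atTop (𝓝 (toL2 (f l))) := fun l => by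
    refine tendsto_L2_of_ae_mul (χ := χ) (fun n => ?_) hb (Eventually.of_forall fun x => ?_)
    · filter_upwards [coeFn_toL2 (mulS (χ n) (f l)), coeFn_toL2 (f l)] with x h1 h2
      rw [h1, h2, mulS_apply (ht n)]
    · refine tendsto_const_nhds.congr' ?_
      have t : Tendsto (fun n : ℕ => (n : ℝ) + 1) atTop atTop :=
        tendsto_atTop_add_const_right _ _ tendsto_natCast_atTop_atTop
      filter_upwards [t.eventually_ge_atTop ‖x‖] with n hn
      exact (hone n x hn).symm
  have h2 : Tendsto (fun n => liftMap toL2 fun l => mulS (χ n) (f l)) atTop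
      (𝓝 (liftMap toL2 f)) :=
    (continuous_combine.tendsto _).comp (tendsto_pi_nhds.2 h1)
  have h3 : ∀ᶠ n : ℕ in atTop, liftMap (toL2 ∘ₗ genS s (cutField η hη h0))
      (fun l => mulS (χ n) (f l)) = liftMap (toL2 ∘ₗ genS s (cutField η hη h0)) f := by
    have t : Tendsto (fun n : ℕ => (n : ℝ) + 1) atTop atTop :=
      tendsto_atTop_add_const_right _ _ tendsto_natCast_atTop_atTop
    filter_upwards [t.eventually_gt_atTop |(s : ℝ)|] with n hn
    rw [liftMap_apply, liftMap_apply]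
    congr 1
    funext l
    exact congrArg toL2 (genS_congr s hα hn fun x hx => by
      rw [mulS_apply (ht n), hone n x hx, one_mul])
  have h4 := h2.prodMk_nhds (tendsto_const_nhds.congr' (h3.mono fun n hn => hn.symm))
  refine (Submodule.isClosed_topologicalClosure _).mem_of_tendsto h4
    (Eventually.of_forall fun n => liftMap_mem_bOp_of_hasCompactSupport hη h0 s _ fun l => ?_)
  have : (mulS (χ n) (f l) : R3 → ℂ) = fun x => χ n x * f l x := by
    funext x
    exact mulS_apply (ht n) _ x
  rw [this]
  exact (hsupp n).mul_right

end

theorem isSymm_bOp {η : R3 → ℝ} (hη : ContDiff ℝ ∞ η) (h0 : ∀ k, 1 ≤ ‖k‖ → η k = 0) (s : ℝˣ) :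
    IsSymm (bOp η s) := by
  have hreal : ∀ j x, star (cutField η hη h0 j x) = cutField η hη h0 j x := fun j x => by
    simp [cutField_apply]
  refine IsSymm.topologicalClosure_span ?_
  rintro p ⟨φ, h1, h2, h3, h4⟩ q ⟨ψ, g1, g2, g3, g4⟩
  rw [eq_liftMap_of_core hη h0 (f := fun l => (h2 l).toSchwartzMap (h1 l)) h3 h4,
    eq_liftMap_of_core hη h0 (f := fun l => (g2 l).toSchwartzMap (g1 l)) g3 g4,
    inner_liftMap, inner_liftMap]
  exact Finset.sum_congr rfl fun l _ => inner_genS_symm s hreal _ _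

end FockSpace

end

noncomputable section

namespace FockSpace

open Filter Topology

local notation "⟪" x ", " y "⟫" => inner ℂ x y

/-! ### The commutator data of `|i∇|` and `b^σ` -/

theorem abs_sum_re_le_of_norm_le {ι : Type*} [Fintype ι] {a b : ι → ℂ} {C : ℝ}
    (h : ∀ l, ‖a l‖ ≤ C * (b l).re) : |(∑ l, a l).re| ≤ C * (∑ l, b l).re := by
  rw [Complex.re_sum, Complex.re_sum, Finset.mul_sum]
  exact (Finset.abs_sum_le_sum_abs _ _).trans
    (Finset.sum_le_sum fun l _ => (Complex.abs_re_le_norm _).trans (h l))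

theorem abs_sum_im_le_of_norm_le {ι : Type*} [Fintype ι] {a b : ι → ℂ} {C : ℝ}
    (h : ∀ l, ‖a l‖ ≤ C * (b l).re) : |(∑ l, a l).im| ≤ C * (∑ l, b l).re := by
  rw [Complex.im_sum, Complex.re_sum, Finset.mul_sum]
  exact (Finset.abs_sum_le_sum_abs _ _).trans
    (Finset.sum_le_sum fun l _ => (Complex.abs_im_le_norm _).trans (h l))

/-- The pairs of annular functions with Fourier transform supported in `|ξ| ≤ R`. -/
def boundedAnnular (R : ℝ) : Submodule ℂ (Fin 2 → Annular) where
  carrier := {z | ∀ l ξ, R < ‖ξ‖ → 𝓕 (z l : Schw) ξ = 0}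
  zero_mem' := fun l ξ _ => by simp [FourierTransform.fourier_zero]
  add_mem' := fun {f g} hf hg l ξ hξ => by
    rw [Pi.add_apply, Submodule.coe_add, FourierTransform.fourier_add, add_apply, hf l ξ hξ,
      hg l ξ hξ, add_zero]
  smul_mem' := fun c f hf l ξ hξ => by
    rw [Pi.smul_apply, Submodule.coe_smul, FourierTransform.fourier_smul, smul_apply, hf l ξ hξ,
      smul_zero]

theorem mem_boundedAnnular {R : ℝ} {z : Fin 2 → Annular} :
    z ∈ boundedAnnular R ↔ ∀ l ξ, R < ‖ξ‖ → 𝓕 (z l : Schw) ξ = 0 := Iff.rfl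

theorem exists_mem_boundedAnnular {n : ℕ} (p : Fin n → Fin 2 → Annular) :
    ∃ R, 0 ≤ R ∧ ∀ i, p i ∈ boundedAnnular R := by
  have h : ∀ q : Fin n × Fin 2, ∃ R : ℝ, ∀ ξ, R < ‖ξ‖ → 𝓕 (p q.1 q.2 : Schw) ξ = 0 := fun q => by
    obtain ⟨r, -, R, h⟩ := mem_annular.1 (p q.1 q.2).2
    exact ⟨R, fun ξ hξ => h ξ (Or.inr hξ)⟩
  choose R hR using h
  obtain ⟨M, hM⟩ := (Set.finite_range R).bddAbove
  refine ⟨max M 0, le_max_right _ _, fun i => mem_boundedAnnular.2 fun l ξ hξ => ?_⟩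
  exact hR (i, l) ξ ((hM ⟨(i, l), rfl⟩).trans_lt ((le_max_left _ _).trans_lt hξ))

/-- `|i∇|` and `genS` satisfy the hypotheses of the Fock space estimate. -/
def genData {α : Fin 3 → Schw} {M K : ℝ} (h : FieldBound α M K) (s : ℝˣ) (hs : 0 < (s : ℝ)) :
    CommutatorData (Fin 2 → Schw) (Fin 2 → Annular) where
  e := liftMap toL2
  w := liftMap absGrad
  b := LinearMap.pi fun l => genS s α ∘ₗ LinearMap.proj l
  ι := LinearMap.pi fun l => Annular.subtype ∘ₗ LinearMap.proj l
  wz := LinearMap.pi fun l => absAnn ∘ₗ LinearMap.proj l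
  C₁ := 17 * M * s
  C₂ := 3 * K + 32 * M
  C₁_nonneg := by have := h.nonneg; positivity
  C₂_nonneg := by have := h.nonneg; have := h.nonneg'; positivity
  e_wz z := congrArg combine (funext fun l => toL2_absAnn (z l))
  w_symm x y := by
    rw [inner_liftMap, inner_liftMap]
    exact Finset.sum_congr rfl fun l _ => inner_absGrad_symm _ _
  b_symm x y := by
    rw [inner_liftMap, inner_liftMap]
    exact Finset.sum_congr rfl fun l _ => inner_genS_symm s h.real _ _
  norm_b_le x := norm_combine_le (by have := h.nonneg; positivity) fun l => norm_genS_le h s hs _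
  form_b_le x := by
    rw [inner_liftMap, inner_liftMap]
    exact abs_sum_re_le_of_norm_le fun l => norm_inner_genS_le h s hs _
  norm_comm_le z := by
    rw [liftMap_apply, liftMap_apply, ← map_sub]
    exact norm_combine_le (by have := h.nonneg; have := h.nonneg'; positivity)
      fun l => norm_commS_le h s hs _
  form_comm_le z := by
    rw [inner_liftMap, liftMap_apply, liftMap_apply, liftMap_apply, ← map_sub, inner_combine]
    exact abs_sum_im_le_of_norm_le fun l => norm_inner_commS_le h s hs _
  exists_bounded n p := by
    obtain ⟨R, hR, hp⟩ := exists_mem_boundedAnnular p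
    refine ⟨boundedAnnular R, 2 * Real.pi * R, by positivity, hp, fun z hz => ?_, fun z hz => ?_⟩
    · refine mem_boundedAnnular.2 fun l ξ hξ => ?_
      have := fourier_absAnn (z l) ξ
      rw [mem_boundedAnnular.1 hz l ξ hξ, mul_zero] at this
      exact this
    · exact norm_combine_le (by positivity) fun l =>
        norm_absGrad_le_of_fourier_supp (mem_boundedAnnular.1 hz l)
  dense := denseRange_combine denseRange_annular

end FockSpace

end

/-! ### The lemma -/

theorem lemma3p8 (η : FockSpace.R3 → ℝ) (hη_smooth : ContDiff ℝ ∞ η)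
    (hη_range : ∀ k, η k ∈ Set.Icc (0 : ℝ) 1)
    (hη_one : ∀ k, ‖k‖ ≤ 1 / 2 → η k = 1) (hη_zero : ∀ k, 1 ≤ ‖k‖ → η k = 0)
    (e_gap : ℝ) (he_gap : 0 < e_gap) :
    ∃ C : ℝ, 0 < C ∧ ∀ σ : ℝ, 0 < σ → σ ≤ e_gap / 2 →
      FockSpace.dom (FockSpace.sq FockSpace.X) ≤
        FockSpace.dom (FockSpace.sq (FockSpace.B η σ)) ∧
      (∀ Φ : FockSpace.Fock, ∃ Ψ : FockSpace.Fock,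
        (Φ, Ψ) ∈ FockSpace.comp (FockSpace.sq (FockSpace.B η σ))
          (FockSpace.bracketInvSq FockSpace.X)) ∧
      ∀ Φ Ψ : FockSpace.Fock,
        (Φ, Ψ) ∈ FockSpace.comp (FockSpace.sq (FockSpace.B η σ))
          (FockSpace.bracketInvSq FockSpace.X) →
        ‖Ψ‖ ≤ C * σ * ‖Φ‖ := by
  obtain ⟨M, K, h⟩ := FockSpace.exists_fieldBound hη_smooth hη_zero
  have hM := h.nonneg
  have hK := h.nonneg'
  -- `C₁ (C₁ + C₂)` with `C₁ = 17 M σ` and `C₂ = 3 K + 32 M`, where `M` and `K` come from `η` alone.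
  -- One factor `σ` is kept and the other is bounded by `e_gap / 2`. The summand `1` ensures
  -- positivity when `M = 0`.
  refine ⟨17 * M * (17 * M * (e_gap / 2) + (3 * K + 32 * M)) + 1, by positivity,
    fun σ hσ hσe => ?_⟩
  obtain ⟨s, rfl⟩ : ∃ s : ℝˣ, (s : ℝ) = σ := ⟨Units.mk0 σ hσ.ne', rfl⟩
  obtain ⟨h1, h2, h3⟩ := (FockSpace.genData h s hσ).fock_estimate FockSpace.mem_absIGrad
    (FockSpace.liftMap_mem_bOp hη_smooth hη_zero s) FockSpace.isSymm_absIGrad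
    (FockSpace.isSymm_bOp hη_smooth hη_zero s)
  refine ⟨h1, h2, fun Φ Ψ hΦ => (h3 Φ Ψ hΦ).trans ?_⟩
  refine mul_le_mul_of_nonneg_right ?_ (norm_nonneg _)
  calc 17 * M * (s : ℝ) * (17 * M * (s : ℝ) + (3 * K + 32 * M))
      ≤ 17 * M * (s : ℝ) * (17 * M * (e_gap / 2) + (3 * K + 32 * M)) := by gcongr
    _ ≤ (17 * M * (17 * M * (e_gap / 2) + (3 * K + 32 * M)) + 1) * (s : ℝ) := by
        nlinarith
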